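/- Write $x=(x_0,x')=(t,x_1,x_2)\in\mathbb R\times\mathbb R^2$, $\xi=(\xi_0,\xi')=(\xi_0,\xi_1,\xi_2)$, $\partial_t=\partial_0$. Let $\varepsilon:\mathbb R\times\mathbb R^2\to\mathbb R^{2\times2}$ be symmetric with $$\Lambda_1|\xi'|^2\le\sum_{i,j=1}^2\varepsilon^{ij}(x)\xi_i\xi_j\le\Lambda_2|\xi'|^2\qquad(x\in\mathbb R^3,\ \xi'\in\mathbb R^2)$$ for constants $\Lambda_1,\Lambda_2>0$, and with coefficients in $C^1(\mathbb R^3)$ such that $\|\varepsilon^{ij}\|_\infty\le K$ and $\|\nabla\varepsilon^{ij}\|_\infty\le K$. Fix an even real $\chi\in C_c^\infty(\mathbb R^3)$ with $\chi=1$ near $0$, and a real $a\in C_c^\infty(\mathbb R^3)$ supported, for some $c>0$, in $\{c^{-1}\le|\xi'|\le c,\ |\xi_0|\le c|\xi'|\}$. For $\lambda\in2^{\mathbb N_0}$ let $S'_\lambda=a(D/\lambda)$ (frequency localization to $|\xi_0|\lesssim|\xi'|\sim\lambda$), and let $\varepsilon_{ij}$ denote the entries of the inverse matrix $\varepsilon(x)^{-1}$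 truncated at space-time frequency $\lambda^{1/2}$, i.e. $\varepsilon_{ij}=\chi(D/\lambda^{1/2})(\varepsilon^{-1})_{ij}$. Let $$\|\xi'\|_{\tilde\varepsilon(x)}=\big(\varepsilon_{22}(x)\xi_1^2-(\varepsilon_{12}+\varepsilon_{21})(x)\xi_1\xi_2+\varepsilon_{11}(x)\xi_2^2\big)^{1/2},$$ and let $D_{\tilde\varepsilon}$ and $\frac1{D_{\tilde\varepsilon}}$ be the operators $b(x,D)u(x)=(2\pi)^{-3}\int e^{i\langle x,\xi\rangle}b(x,\xi)\hat u(\xi)\,d\xi$ with symbols $b(x,\xi)=\|\xi'\|_{\tilde\varepsilon(x)}$ and $\|\xi'\|_{\tilde\varepsilon(x)}^{-1}$. Define $$P=\begin{pmatrix}\partial_t&0&-\partial_2\\0&\partial_t&\partial_1\\-\partial_2(\varepsilon_{11}\cdot)+\partial_1(\varepsilon_{21}\cdot)&\partial_1(\varepsilon_{22}\cdot)-\partial_2(\varepsilon_{12}\cdot)&\partial_t\end{pmatrix},\qquad \mathcal D=\operatorname{diag}(\partial_t,\ \partial_t-iD_{\tilde\varepsilon},\ \partial_t+iD_{\tilde\varepsilon}),$$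 $$\mathcal M=\begin{pmatrix}\frac{i}{D_{\tilde\varepsilon}}(\partial_1(\varepsilon_{22}\cdot)-\partial_2(\varepsilon_{12}\cdot))&\frac{-i}{D_{\tilde\varepsilon}}\partial_2&\frac{i}{D_{\tilde\varepsilon}}\partial_2\\ \frac{i}{D_{\tilde\varepsilon}}(\partial_2(\varepsilon_{11}\cdot)-\partial_1(\varepsilon_{12}\cdot))&\frac{i}{D_{\tilde\varepsilon}}\partial_1&\frac{-i}{D_{\tilde\varepsilon}}\partial_1\\0&1&1\end{pmatrix},$$ $$\mathcal N=\begin{pmatrix}i\partial_1\frac1{D_{\tilde\varepsilon}}&i\partial_2\frac1{D_{\tilde\varepsilon}}&0\\ \frac{i}{2}(\varepsilon_{12}\partial_1-\varepsilon_{11}\partial_2)\frac1{D_{\tilde\varepsilon}}&\frac{i}{2}(\varepsilon_{22}\partial_1-\varepsilon_{12}\partial_2)\frac1{D_{\tilde\varepsilon}}&\frac12\\ \frac{i}{2}(\varepsilon_{11}\partial_2-\varepsilon_{12}\partial_1)\frac1{D_{\tilde\varepsilon}}&\frac{i}{2}(\varepsilon_{12}\partial_2-\varepsilon_{22}\partial_1)\frac1{D_{\tilde\varepsilon}}&\frac12\end{pmatrix}.$$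 Then there are constants $C$ and $\lambda_0$, depending only on $\Lambda_1,\Lambda_2,K,\chi,a$, such that for all $\lambda\in2^{\mathbb N_0}$ with $\lambda\ge\lambda_0$ and all $f\in L^2(\mathbb R^3;\mathbb C^3)$ the functions $\mathcal M\mathcal D\mathcal N S'_\lambda f$ and $PS'_\lambda f$ belong to $L^2$ and $$\|\mathcal M\mathcal D\mathcal N S'_\lambda f-PS'_\lambda f\|_{L^2}\le C\,\|f\|_{L^2}.$$ -/

import Mathlib

open scoped FourierTransform ContDiff

noncomputable section

namespace MaxwellDiag

/-- Space-time `ℝ × ℝ²` (and its dual): coordinate `0` is the time `t` (dual variable `ξ₀ = τ`),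
coordinates `1, 2` are the spatial ones. -/
abbrev E := EuclideanSpace ℝ (Fin 3)

/-- A (linear) operator acting on complex functions of space-time. -/
abbrev Oper := (E → ℂ) → (E → ℂ)

/-- The length `|ξ'|` of the spatial part `ξ' = (ξ₁, ξ₂)` of `ξ = (ξ₀, ξ₁, ξ₂)`. -/
def spatialNorm (ξ : E) : ℝ := Real.sqrt (ξ 1 ^ 2 + ξ 2 ^ 2)

/-! ### The permittivity and the truncation of its coefficients -/

/-- `ε` is symmetric and `Λ₁ |ξ'|² ≤ ∑ εⁱʲ(x) ξᵢ ξⱼ ≤ Λ₂ |ξ'|²` for all `x` and `ξ' ∈ ℝ²`. -/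
def IsElliptic (Λ₁ Λ₂ : ℝ) (ε : E → Matrix (Fin 2) (Fin 2) ℝ) : Prop :=
  ∀ x, (∀ i j, ε x i j = ε x j i) ∧
    ∀ η : Fin 2 → ℝ, Λ₁ * ∑ i, η i ^ 2 ≤ ∑ i, ∑ j, ε x i j * η i * η j ∧
      ∑ i, ∑ j, ε x i j * η i * η j ≤ Λ₂ * ∑ i, η i ^ 2

/-- The coefficients of `ε` belong to `C¹(ℝ³)` (bounded with bounded first derivatives), with
`C¹` norm at most `K`. -/
def HasC1Bound (K : ℝ) (ε : E → Matrix (Fin 2) (Fin 2) ℝ) : Prop :=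
  ∀ i j, ContDiff ℝ 1 (fun x => ε x i j) ∧
    ∀ x, |ε x i j| ≤ K ∧ ‖fderiv ℝ (fun y => ε y i j) x‖ ≤ K

/-- The profile of a smooth low-frequency truncation: `χ ∈ C_c^∞(ℝ³)`, even, and equal to `1`
near the origin. -/
def IsLowFrequencyCutoff (χ : E → ℝ) : Prop :=
  ContDiff ℝ ∞ χ ∧ HasCompactSupport χ ∧ (∀ ξ, χ (-ξ) = χ ξ) ∧ ∀ᶠ ξ in nhds 0, χ ξ = 1

/-- The convolution kernel `(2π)⁻³ ∫ e^{i⟨y,ξ⟩} χ(ξ/R) dξ` of the Fourier multiplier `χ(D/R)`.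
It is real because `χ` is even. -/
def truncKernel (χ : E → ℝ) (R : ℝ) (y : E) : ℝ :=
  ((2 * Real.pi) ^ 3)⁻¹ * ∫ ξ : E, χ (R⁻¹ • ξ) * Real.cos (inner ℝ y ξ)

/-- The frequency truncation `χ(D/R) g` of a bounded function `g`. -/
def truncate (χ : E → ℝ) (R : ℝ) (g : E → ℝ) (x : E) : ℝ :=
  ∫ y : E, g (x - y) * truncKernel χ R y

/-- The coefficients `ε_{ij}` of the inverse matrix `ε⁻¹`, truncated (in space-time frequency) at
`lam ^ (1/2)`. -/
def truncInv (χ : E → ℝ) (ε : E → Matrix (Fin 2) (Fin 2) ℝ) (lam : ℝ) (x : E) :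
    Matrix (Fin 2) (Fin 2) ℝ :=
  fun i j => truncate χ (Real.sqrt lam) (fun y => (ε y)⁻¹ i j) x

/-- The adjugate `ε̃` of the matrix function `e = (ε_{ij})`. -/
def epsTilde (e : E → Matrix (Fin 2) (Fin 2) ℝ) (x : E) : Matrix (Fin 2) (Fin 2) ℝ :=
  !![e x 1 1, -(e x 0 1); -(e x 1 0), e x 0 0]

/-- `‖ξ'‖_{ε̃(x)} = (ε̃ⁱʲ(x) ξᵢ ξⱼ)^{1/2}`. -/
def epsNorm (e : E → Matrix (Fin 2) (Fin 2) ℝ) (x ξ : E) : ℝ :=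
  Real.sqrt (∑ i : Fin 2, ∑ j : Fin 2, epsTilde e x i j * ξ i.succ * ξ j.succ)

/-! ### Pseudo-differential operators -/

open Classical in
/-- The Fourier transform (with phase `e^{-2πi⟨x,ξ⟩}`) of a square integrable function, in the
sense of Plancherel. -/
def l2Fourier (u : E → ℂ) : E → ℂ :=
  if h : MeasureTheory.MemLp u 2 MeasureTheory.volume then
    ⇑(𝓕 (h.toLp u) : MeasureTheory.Lp ℂ 2 (MeasureTheory.volume : MeasureTheory.Measure E))
  else 0

/-- The operator `a(x,D) u (x) = (2π)⁻³ ∫ e^{i⟨x,ξ⟩} a(x,ξ) û(ξ) dξ`, `û(ξ) = ∫ e^{-i⟨y,ξ⟩} u(y) dy`,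
written (after replacing `ξ` by `2πξ`) with the Fourier transform normalised as above. -/
def op (a : E → E → ℂ) : Oper := fun u x =>
  ∫ ξ : E, Complex.exp (2 * Real.pi * Complex.I * (inner ℝ x ξ : ℝ)) *
    a x ((2 * Real.pi) • ξ) * l2Fourier u ξ

/-- The partial derivative `∂ₖ`; `k = 0` is `∂ₜ`. -/
def pd (k : Fin 3) : Oper := fun u x => fderiv ℝ u x (EuclideanSpace.single k 1)

/-- Multiplication by a real function. -/
def mulOp (g : E → ℝ) : Oper := fun u x => (g x : ℂ) * u x

/-- `D_{ε̃}`, with symbol `‖ξ'‖_{ε̃(x)}`. -/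
def opD (e : E → Matrix (Fin 2) (Fin 2) ℝ) : Oper := op fun x ξ => (epsNorm e x ξ : ℂ)

/-- `1 / D_{ε̃}`, with symbol `1 / ‖ξ'‖_{ε̃(x)}`. -/
def opInvD (e : E → Matrix (Fin 2) (Fin 2) ℝ) : Oper :=
  op fun x ξ => ((epsNorm e x ξ)⁻¹ : ℂ)

/-- The profile of a smooth projection to `{|ξ₀| ≲ |ξ'| ∼ 1}`. -/
def IsConeCutoff (a : E → ℝ) : Prop :=
  ContDiff ℝ ∞ a ∧ ∃ c : ℝ, 0 < c ∧
    ∀ ξ, a ξ ≠ 0 → c⁻¹ ≤ spatialNorm ξ ∧ spatialNorm ξ ≤ c ∧ |ξ 0| ≤ c * spatialNorm ξ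

/-- The frequency projection `S'_{lam,τ} = a(D/lam)` to `{|ξ₀| ≲ |ξ'| ∼ lam}`. -/
def freqProj (a : E → ℝ) (lam : ℝ) : Oper := op fun _ ξ => (a (lam⁻¹ • ξ) : ℂ)

/-! ### The operator matrices -/

/-- The action of a `3 × 3` matrix of operators on a vector of functions. -/
def act (A : Fin 3 → Fin 3 → Oper) (u : Fin 3 → E → ℂ) : Fin 3 → E → ℂ :=
  fun i x => ∑ j, A i j (u j) x

/-- The Maxwell operator `P(x,D)` for the coefficients `e = (ε_{ij})` of the inverse
permittivity. -/
def opP (e : E → Matrix (Fin 2) (Fin 2) ℝ) : Fin 3 → Fin 3 → Oper :=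
  let c (i j : Fin 2) : Oper := mulOp fun x => e x i j
  ![![pd 0, 0, -pd 2],
    ![0, pd 0, pd 1],
    ![fun u => -pd 2 (c 0 0 u) + pd 1 (c 1 0 u),
      fun u => pd 1 (c 1 1 u) - pd 2 (c 0 1 u),
      pd 0]]

/-- `𝓓 = diag(∂ₜ, ∂ₜ - i D_{ε̃}, ∂ₜ + i D_{ε̃})`. -/
def opDiag (e : E → Matrix (Fin 2) (Fin 2) ℝ) : Fin 3 → Fin 3 → Oper :=
  ![![pd 0, 0, 0],
    ![0, fun u => pd 0 u - Complex.I • opD e u, 0],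
    ![0, 0, fun u => pd 0 u + Complex.I • opD e u]]

/-- The operator `𝓜` of (approximate) eigenvectors. -/
def opM (e : E → Matrix (Fin 2) (Fin 2) ℝ) : Fin 3 → Fin 3 → Oper :=
  let c (i j : Fin 2) : Oper := mulOp fun x => e x i j
  ![![fun u => Complex.I • opInvD e (pd 1 (c 1 1 u) - pd 2 (c 0 1 u)),
      fun u => -Complex.I • opInvD e (pd 2 u),
      fun u => Complex.I • opInvD e (pd 2 u)],
    ![fun u => Complex.I • opInvD e (pd 2 (c 0 0 u) - pd 1 (c 0 1 u)),
      fun u => Complex.I • opInvD e (pd 1 u),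
      fun u => -Complex.I • opInvD e (pd 1 u)],
    ![0, id, id]]

/-- The operator `𝓝` associated with the inverse of the eigenvector matrix. -/
def opN (e : E → Matrix (Fin 2) (Fin 2) ℝ) : Fin 3 → Fin 3 → Oper :=
  let c (i j : Fin 2) : Oper := mulOp fun x => e x i j
  let R : Oper := opInvD e
  ![![fun u => Complex.I • pd 1 (R u),
      fun u => Complex.I • pd 2 (R u),
      0],
    ![fun u => (Complex.I / 2) • (c 0 1 (pd 1 (R u)) - c 0 0 (pd 2 (R u))),
      fun u => (Complex.I / 2) • (c 1 1 (pd 1 (R u)) - c 0 1 (pd 2 (R u))),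
      fun u => (1 / 2 : ℂ) • u],
    ![fun u => (Complex.I / 2) • (c 0 0 (pd 2 (R u)) - c 0 1 (pd 1 (R u))),
      fun u => (Complex.I / 2) • (c 0 1 (pd 2 (R u)) - c 1 1 (pd 1 (R u))),
      fun u => (1 / 2 : ℂ) • u]]

/-- The composition `𝓜 𝓓 𝓝`. -/
def actMDN (e : E → Matrix (Fin 2) (Fin 2) ℝ) (u : Fin 3 → E → ℂ) : Fin 3 → E → ℂ :=
  act (opM e) (act (opDiag e) (act (opN e) u))

/-- The norm `‖u‖_{L²} = ‖u₁‖_{L²} + ‖u₂‖_{L²} + ‖u₃‖_{L²}` of a vector of functions on `ℝ × ℝ²`. -/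
def l2norm (u : Fin 3 → E → ℂ) : ENNReal :=
  ∑ i, MeasureTheory.eLpNorm (u i) 2 MeasureTheory.volume

/-- `u ∈ L²(ℝ × ℝ²; ℂ³)`. -/
def IsL2 (u : Fin 3 → E → ℂ) : Prop :=
  ∀ i, MeasureTheory.MemLp (u i) 2 MeasureTheory.volume

end MaxwellDiag

end

open scoped FourierTransform ContDiff

noncomputable section

open MeasureTheory SchwartzMap

namespace MaxwellDiag

section

/-! ### The Fourier transform on `L²` -/

/-! Put q(x,ξ) = ‖ξ'‖²_ε̃/|ξ'|² (`quad`). If symbols are multiplied as if operators commuted, 𝓜 𝓓 𝓝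
is exactly P: the computation reduces to q · (q^{-1/2})² = 1 and to cancellations between symmetric
products of ξ₁ and ξ₂. What has to be shown is that each exchange of operators needed to reach this
form costs an operator bounded on L², uniformly in λ. An exchange puts one derivative on a
coefficient, which is bounded because the truncated inverse permittivity is uniformly Lipschitz, and
gains a factor 1/λ, which pays for one first-order operator. Where two derivatives fall on a
coefficient, the truncation at frequency λ^{1/2} bounds them by a multiple of λ, and a factor 1/D
pays for it.

No general pseudodifferential calculus is used. The form q is cf0 + cf1 cos 2θ + cf2 sin 2θ in the
direction θ of ξ', and ellipticity makes (q/cf0 - 1) smaller than 1 uniformly. The binomial series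
therefore writes |ξ'|/‖ξ'‖ = q^{-1/2} as an absolutely convergent sum of products c(x) m(ξ), with c
Lipschitz and m homogeneous of degree zero (`exists_tensorBound_invRoot`). For such sums L²
boundedness is immediate. The defect of a composition is a sum of commutators [m(D), c], each O(1/λ)
on functions of frequency λ, because the kernel of a multiplier rescaled to frequency λ has first
moment O(1/λ) (`commBound_of_cutoff`, `TensorRep.norm_comp_sub_le`).

Derivatives are genuine Fréchet derivatives, so all intermediate functions are kept in a class with
square integrable derivatives of every order. This works because oscillatory integrals with symbols
q^{-m/2} are stable under differentiation (`pd_oscRoot`). Multiplication by a coefficient destroys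
exact frequency localization, but afterwards 1/D is only ever applied to ∂₁ or ∂₂ of something, so
the singularity at ξ' = 0 is harmless.

The estimates `exists_l2Bound_third`, `exists_l2Bound_opInvD_pd_opD` and `exists_l2Bound_opD_coeff`
treat the three kinds of terms in the expanded product; `exists_close` adds them up, and
`exists_smoothAdmissible` provides the uniform bounds on the truncated coefficients. -/

/-- The Hilbert space `L²(ℝ × ℝ²)`. -/
abbrev L2 := Lp ℂ 2 (volume : Measure E)

theorem integral_schwartz_mul_fourier (f : L2) (φ : 𝓢(E, ℂ)) :
    ∫ ξ, φ ξ * (𝓕 f : L2) ξ = ∫ x, (𝓕 φ) x * f x := by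
  have h := congrArg (fun T => T φ) (Lp.fourier_toTemperedDistribution_eq f)
  simp only [TemperedDistribution.fourier_apply, Lp.toTemperedDistribution_apply,
    smul_eq_mul] at h
  exact h.symm

theorem integral_schwartz_mul_fourierInv (f : L2) (φ : 𝓢(E, ℂ)) :
    ∫ ξ, φ ξ * (𝓕⁻ f : L2) ξ = ∫ x, (𝓕⁻ φ) x * f x := by
  have h := congrArg (fun T => T φ) (Lp.fourierInv_toTemperedDistribution_eq f)
  simp only [TemperedDistribution.fourierInv_apply, Lp.toTemperedDistribution_apply,
    smul_eq_mul] at h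
  exact h.symm

/-- Compactly supported tests suffice, so local integrability is enough. This lets products of L²
functions with polynomials be identified by duality. -/
theorem ae_eq_of_integral_schwartz_mul_eq {f g : E → ℂ} (hf : LocallyIntegrable f)
    (hg : LocallyIntegrable g)
    (h : ∀ φ : 𝓢(E, ℂ), HasCompactSupport φ → ∫ x, φ x * f x = ∫ x, φ x * g x) :
    f =ᵐ[volume] g := by
  refine ae_eq_of_integral_contDiff_smul_eq hf hg fun φ hφ hc => ?_
  have hφ' : ContDiff ℝ ∞ fun x => (φ x : ℂ) := Complex.ofRealCLM.contDiff.comp hφ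
  have hc' : HasCompactSupport fun x => (φ x : ℂ) := hc.comp_left Complex.ofReal_zero
  simpa using h (hc'.toSchwartzMap hφ') hc'

theorem locallyIntegrable_of_memLp_two {f : E → ℂ} (hf : MemLp f 2) : LocallyIntegrable f :=
  hf.locallyIntegrable (by norm_num)

theorem l2Fourier_eq {u : E → ℂ} (hu : MemLp u 2) : l2Fourier u = (𝓕 (hu.toLp u) : L2) := by
  simp [l2Fourier, hu]

theorem memLp_l2Fourier (u : E → ℂ) : MemLp (l2Fourier u) 2 := by
  by_cases hu : MemLp u 2
  · rw [l2Fourier_eq hu]; exact Lp.memLp _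
  · simp [l2Fourier, hu]

theorem eLpNorm_l2Fourier {u : E → ℂ} (hu : MemLp u 2) :
    eLpNorm (l2Fourier u) 2 = eLpNorm u 2 := by
  have h := congrArg ENNReal.ofReal (Lp.norm_fourier_eq (hu.toLp u))
  rw [Lp.norm_def, Lp.norm_def, ENNReal.ofReal_toReal (Lp.eLpNorm_ne_top _),
    ENNReal.ofReal_toReal (Lp.eLpNorm_ne_top _), eLpNorm_congr_ae hu.coeFn_toLp] at h
  rw [l2Fourier_eq hu, h]

theorem l2Fourier_add {u v : E → ℂ} (hu : MemLp u 2) (hv : MemLp v 2) :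
    l2Fourier (u + v) =ᵐ[volume] l2Fourier u + l2Fourier v := by
  rw [l2Fourier_eq hu, l2Fourier_eq hv, l2Fourier_eq (hu.add hv), MemLp.toLp_add,
    FourierTransform.fourier_add]
  exact Lp.coeFn_add _ _

theorem l2Fourier_smul (c : ℂ) {u : E → ℂ} (hu : MemLp u 2) :
    l2Fourier (c • u) =ᵐ[volume] c • l2Fourier u := by
  rw [l2Fourier_eq hu, l2Fourier_eq (hu.const_smul c), MemLp.toLp_const_smul,
    FourierTransform.fourier_smul]
  exact Lp.coeFn_smul _ _

theorem continuous_neg_inner : Continuous fun p : E × E => (-innerₗ E) p.1 p.2 := by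
  simpa [Pi.neg_def] using (continuous_inner (𝕜 := ℝ) (E := E)).neg

theorem fourierInv_eq_vectorFourier (v : E → ℂ) :
    𝓕⁻ v = VectorFourier.fourierIntegral Real.fourierChar volume (-innerₗ E) v := by
  ext x
  simp [Real.fourierInv_eq, VectorFourier.fourierIntegral]

theorem integral_schwartz_mul_fourierInv_fun {v : E → ℂ} (hv : Integrable v) (φ : 𝓢(E, ℂ)) :
    ∫ x, φ x * (𝓕⁻ v) x = ∫ ξ, (𝓕⁻ φ) ξ * v ξ := by
  have h := VectorFourier.integral_fourierIntegral_smul_eq_flip (μ := (volume : Measure E))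
    (ν := (volume : Measure E)) (L := -innerₗ E)
    Real.continuous_fourierChar continuous_neg_inner φ.integrable hv
  have hflip : (-innerₗ E).flip = -innerₗ E := by
    ext x y; simp [real_inner_comm]
  rw [hflip, ← fourierInv_eq_vectorFourier, ← fourierInv_eq_vectorFourier] at h
  simp only [smul_eq_mul] at h
  rw [fourierInv_coe]
  exact h.symm

theorem continuous_fourierInv {v : E → ℂ} (h1 : Integrable v) : Continuous (𝓕⁻ v) := by
  rw [fourierInv_eq_vectorFourier]
  exact VectorFourier.fourierIntegral_continuous Real.continuous_fourierChar
      (L := -innerₗ E) continuous_neg_inner h1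

/-- The Plancherel transform and the absolutely convergent integral satisfy the same duality
relation with Schwartz functions, hence coincide almost everywhere. -/
theorem toLp_fourierInv_ae {v : E → ℂ} (h1 : Integrable v) (h2 : MemLp v 2) :
    (𝓕⁻ (h2.toLp v) : L2) =ᵐ[volume] 𝓕⁻ v := by
  refine ae_eq_of_integral_schwartz_mul_eq (locallyIntegrable_of_memLp_two (Lp.memLp _)) ?_ ?_
  · exact (continuous_fourierInv h1).locallyIntegrable
  · intro φ _
    rw [integral_schwartz_mul_fourierInv, integral_schwartz_mul_fourierInv_fun h1]
    refine integral_congr_ae ?_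
    filter_upwards [h2.coeFn_toLp] with x hx
    rw [hx]

theorem memLp_fourierInv {v : E → ℂ} (h1 : Integrable v) (h2 : MemLp v 2) :
    MemLp (𝓕⁻ v) 2 :=
  (memLp_congr_ae (toLp_fourierInv_ae h1 h2)).1 (Lp.memLp _)

theorem toLp_fourierInv {v : E → ℂ} (h1 : Integrable v) (h2 : MemLp v 2) :
    (memLp_fourierInv h1 h2).toLp (𝓕⁻ v) = (𝓕⁻ (h2.toLp v) : L2) :=
  Lp.ext ((memLp_fourierInv h1 h2).coeFn_toLp.trans (toLp_fourierInv_ae h1 h2).symm)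

theorem l2Fourier_fourierInv {v : E → ℂ} (h1 : Integrable v) (h2 : MemLp v 2) :
    l2Fourier (𝓕⁻ v) =ᵐ[volume] v := by
  rw [l2Fourier_eq (memLp_fourierInv h1 h2), toLp_fourierInv h1 h2,
    FourierTransform.fourier_fourierInv_eq]
  exact h2.coeFn_toLp

theorem integrable_schwartz_mul {f : E → ℂ} (hf : MemLp f 2) (φ : 𝓢(E, ℂ)) :
    Integrable fun x => φ x * f x :=
  (φ.memLp 2).integrable_mul hf

theorem inner_single (ξ : E) (k : Fin 3) : inner ℝ ξ (EuclideanSpace.single k (1 : ℝ)) = ξ k := by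
  simp [EuclideanSpace.inner_single_right]

/-- Duality again: the derivative is moved onto the Fourier transform of a Schwartz test function.
The integration by parts has no boundary terms because each product of an L² function with a
Schwartz function is integrable. -/
theorem l2Fourier_pd {w : E → ℂ} (k : Fin 3) (hw : MemLp w 2) (hd : Differentiable ℝ w)
    (hk : MemLp (pd k w) 2) :
    l2Fourier (pd k w) =ᵐ[volume] fun ξ => 2 * Real.pi * Complex.I * ξ k * l2Fourier w ξ := by
  have hl : LocallyIntegrable fun ξ : E => 2 * Real.pi * Complex.I * ξ k * l2Fourier w ξ := by
    refine (locallyIntegrableOn_univ.1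
      ((locallyIntegrable_of_memLp_two (memLp_l2Fourier w)).locallyIntegrableOn _
        |>.continuousOn_mul (g := fun ξ : E => 2 * Real.pi * Complex.I * ξ k)
        (by fun_prop) isClosed_univ.isLocallyClosed))
  refine ae_eq_of_integral_schwartz_mul_eq (locallyIntegrable_of_memLp_two (memLp_l2Fourier _))
    hl ?_
  intro φ _
  set m : E := EuclideanSpace.single k (1 : ℝ)
  have htg : (inner ℝ · m : E → ℝ).HasTemperateGrowth :=
    ((innerSL ℝ).flip m).hasTemperateGrowth
  have h1 : ∀ x, fderiv ℝ (𝓕 φ : 𝓢(E, ℂ)) x m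
      = (𝓕 (-(2 * Real.pi * Complex.I) • smulLeftCLM ℂ (inner ℝ · m) φ) : 𝓢(E, ℂ)) x := fun x => by
    rw [← lineDerivOp_apply_eq_fderiv, lineDerivOp_fourier_eq]
  have hψ : MemLp (fun x => fderiv ℝ (𝓕 φ : 𝓢(E, ℂ)) x m) 2 := by
    simp_rw [h1]; exact SchwartzMap.memLp _ 2 volume
  have key := integral_mul_fderiv_eq_neg_fderiv_mul_of_integrable (μ := (volume : Measure E))
    (f := w) (g := (𝓕 φ : 𝓢(E, ℂ))) (v := m)
    (by simpa only [mul_comm, pd] using integrable_schwartz_mul hk (𝓕 φ : 𝓢(E, ℂ)))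
    (hw.integrable_mul hψ)
    (by simpa only [mul_comm] using integrable_schwartz_mul hw (𝓕 φ : 𝓢(E, ℂ)))
    (fun x _ => hd x) (fun x _ => (𝓕 φ : 𝓢(E, ℂ)).differentiableAt)
  calc ∫ x, φ x * l2Fourier (pd k w) x
      = ∫ x, (𝓕 φ : 𝓢(E, ℂ)) x * pd k w x := by
        rw [l2Fourier_eq hk, integral_schwartz_mul_fourier]
        refine integral_congr_ae ?_
        filter_upwards [hk.coeFn_toLp] with x hx
        rw [hx]
    _ = ∫ x, fderiv ℝ w x m * (𝓕 φ : 𝓢(E, ℂ)) x := by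
        simp only [mul_comm]; rfl
    _ = - ∫ x, w x * fderiv ℝ (𝓕 φ : 𝓢(E, ℂ)) x m := by rw [key, neg_neg]
    _ = ∫ x, (𝓕 ((2 * Real.pi * Complex.I) • smulLeftCLM ℂ (inner ℝ · m) φ) : 𝓢(E, ℂ)) x * w x := by
        rw [← integral_neg]
        congr 1; ext x
        rw [h1, neg_smul, FourierTransform.fourier_neg, neg_apply]
        ring
    _ = ∫ x, ((2 * Real.pi * Complex.I) • smulLeftCLM ℂ (inner ℝ · m) φ) x * l2Fourier w x := by
        rw [l2Fourier_eq hw, integral_schwartz_mul_fourier]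
        refine integral_congr_ae ?_
        filter_upwards [hw.coeFn_toLp] with x hx
        rw [hx]
    _ = ∫ x, φ x * (2 * Real.pi * Complex.I * x k * l2Fourier w x) := by
        congr 1; ext x
        rw [smul_apply, smulLeftCLM_apply_apply htg, inner_single]
        simp only [smul_eq_mul, Complex.real_smul]
        ring

end

section

/-! ### Multiplication operators and Fourier multipliers on `L²` -/

open Classical in
/-- Multiplication by a bounded function on `L²`. -/
def mulL (g : E → ℂ) : L2 →L[ℂ] L2 :=
  if h : MemLp g ⊤ volume then (ContinuousLinearMap.mul ℂ ℂ).holderL volume ⊤ 2 2 (h.toLp g) else 0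

theorem memLp_top_of_le {g : E → ℂ} (hg : Measurable g) {C : ℝ} (hC : ∀ x, ‖g x‖ ≤ C) :
    MemLp g ⊤ volume :=
  memLp_top_of_bound hg.aestronglyMeasurable C (Filter.Eventually.of_forall hC)

theorem mulL_ae {g : E → ℂ} (h : MemLp g ⊤ volume) (f : L2) :
    mulL g f =ᵐ[volume] fun x => g x * f x := by
  have h1 : mulL g f = (ContinuousLinearMap.mul ℂ ℂ).holder 2 (h.toLp g) f := by
    simp only [mulL, h, dite_true]; rfl
  rw [h1]
  refine ((ContinuousLinearMap.mul ℂ ℂ).coeFn_holder _ _).trans ?_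
  filter_upwards [h.coeFn_toLp] with x hx
  simp [hx]

theorem norm_mulL_le {g : E → ℂ} (hg : Measurable g) {C : ℝ} (hC : ∀ x, ‖g x‖ ≤ C) (f : L2) :
    ‖mulL g f‖ ≤ C * ‖f‖ := by
  refine Lp.norm_le_mul_norm_of_ae_le_mul ?_
  filter_upwards [mulL_ae (memLp_top_of_le hg hC) f] with x hx
  rw [hx, norm_mul]
  exact mul_le_mul_of_nonneg_right (hC x) (norm_nonneg _)

theorem mulL_mul {g g' : E → ℂ} (h : MemLp g ⊤ volume) (h' : MemLp g' ⊤ volume)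
    (hm : MemLp (fun x => g x * g' x) ⊤ volume) (f : L2) :
    mulL (fun x => g x * g' x) f = mulL g (mulL g' f) := by
  refine Lp.ext ?_
  filter_upwards [mulL_ae hm f, mulL_ae h (mulL g' f), mulL_ae h' f] with x h1 h2 h3
  rw [h1, h2, h3]; ring

/-- The symbol `m(2πξ)` in the variable dual to the phase `e^{2πi⟨x,ξ⟩}`. -/
def dil (m : E → ℂ) (ξ : E) : ℂ := m ((2 * Real.pi) • ξ)

theorem measurable_dil {m : E → ℂ} (hm : Measurable m) : Measurable (dil m) :=
  hm.comp (measurable_const_smul _)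

/-- The Fourier multiplier `m(D)` as a bounded operator on `L²`. -/
def multCLM (m : E → ℂ) : L2 →L[ℂ] L2 :=
  ((Lp.fourierTransformₗᵢ E ℂ).symm : L2 →L[ℂ] L2) ∘L mulL (dil m) ∘L
    ((Lp.fourierTransformₗᵢ E ℂ) : L2 →L[ℂ] L2)

theorem multCLM_apply (m : E → ℂ) (f : L2) : multCLM m f = 𝓕⁻ (mulL (dil m) (𝓕 f)) := rfl

theorem norm_fourierInv_L2 (f : L2) : ‖(𝓕⁻ f : L2)‖ = ‖f‖ :=
  (Lp.fourierTransformₗᵢ E ℂ).symm.norm_map f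

theorem norm_multCLM_le {m : E → ℂ} (hm : Measurable m) {C : ℝ} (hC : ∀ ξ, ‖m ξ‖ ≤ C) (f : L2) :
    ‖multCLM m f‖ ≤ C * ‖f‖ := by
  rw [multCLM_apply, norm_fourierInv_L2, ← Lp.norm_fourier_eq f]
  exact norm_mulL_le (measurable_dil hm) (fun _ => hC _) _

theorem fourier_multCLM (m : E → ℂ) (f : L2) : 𝓕 (multCLM m f) = mulL (dil m) (𝓕 f) := by
  rw [multCLM_apply, FourierTransform.fourier_fourierInv_eq]

theorem multCLM_mul {m m' : E → ℂ} (hm : Measurable m) (hm' : Measurable m') {C C' : ℝ}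
    (hC : ∀ ξ, ‖m ξ‖ ≤ C) (hC' : ∀ ξ, ‖m' ξ‖ ≤ C') (f : L2) :
    multCLM (fun ξ => m ξ * m' ξ) f = multCLM m (multCLM m' f) := by
  rw [multCLM_apply, multCLM_apply m, fourier_multCLM]
  congr 1
  have h0 : 0 ≤ C := (norm_nonneg _).trans (hC 0)
  refine mulL_mul (memLp_top_of_le (measurable_dil hm) fun _ => hC _)
    (memLp_top_of_le (measurable_dil hm') fun _ => hC' _)
    (memLp_top_of_le (C := C * C') ((measurable_dil hm).mul (measurable_dil hm')) fun x => ?_) _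
  simp only [norm_mul, dil]
  exact mul_le_mul (hC _) (hC' _) (norm_nonneg _) h0

/-- `f` is localized at frequencies in the dilated set `lam • K`. -/
def Localized (K : Set E) (lam : ℝ) (f : E → ℂ) : Prop :=
  ∀ᵐ ξ, f ξ ≠ 0 → lam⁻¹ • ξ ∈ K

theorem Localized.multCLM {K : Set E} {lam : ℝ} {h : L2} (hh : Localized K lam (𝓕 h : L2))
    {m : E → ℂ} (hm : Measurable m) {C : ℝ} (hC : ∀ ξ, ‖m ξ‖ ≤ C) :
    Localized K lam (𝓕 (multCLM m h) : L2) := by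
  rw [fourier_multCLM]
  filter_upwards [hh, mulL_ae (memLp_top_of_le (measurable_dil hm) fun _ => hC _) (𝓕 h)]
    with ξ h1 h2 h3
  refine h1 fun h4 => h3 ?_
  rw [h2, h4, mul_zero]

/-- `m(D)` is bounded by one and its commutators with Lipschitz functions gain one derivative at
frequencies `lam • K`. -/
structure CommBound (K : Set E) (m : E → ℂ) (M : ℝ) : Prop where
  measurable : Measurable m
  norm_le : ∀ ξ, ‖m ξ‖ ≤ 1
  nonneg : 0 ≤ M
  comm : ∀ (lam : ℝ), 0 < lam → ∀ (g : E → ℂ) (B L : ℝ), (∀ x, ‖g x‖ ≤ B) →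
    (∀ x y, ‖g x - g y‖ ≤ L * ‖x - y‖) → ∀ h : L2, Localized K lam (𝓕 h : L2) →
      ‖multCLM m (mulL g h) - mulL g (multCLM m h)‖ ≤ M * L / lam * ‖h‖

theorem lipschitz_nonneg {g : E → ℂ} {L : ℝ} (hL : ∀ x y, ‖g x - g y‖ ≤ L * ‖x - y‖) : 0 ≤ L := by
  have h := (norm_nonneg _).trans (hL (EuclideanSpace.single 0 1) 0)
  simpa using h

theorem measurable_of_lipschitz {g : E → ℂ} {L : ℝ} (hL : ∀ x y, ‖g x - g y‖ ≤ L * ‖x - y‖) :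
    Measurable g := by
  have h : LipschitzWith ⟨L, lipschitz_nonneg hL⟩ g :=
    LipschitzWith.of_dist_le_mul fun x y => by
      rw [dist_eq_norm, dist_eq_norm]; exact hL x y
  exact h.continuous.measurable

/-- Leibniz rule [m m', g] = m [m', g] + [m, g] m'. The normalization |m| ≤ 1 makes the constants
add, and m'(D) preserves frequency localization, so the second commutator may be estimated. -/
theorem CommBound.mul {K : Set E} {m m' : E → ℂ} {M M' : ℝ} (h : CommBound K m M)
    (h' : CommBound K m' M') : CommBound K (fun ξ => m ξ * m' ξ) (M + M') where
  measurable := h.measurable.mul h'.measurable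
  norm_le ξ := by
    rw [norm_mul]; exact mul_le_one₀ (h.norm_le ξ) (norm_nonneg _) (h'.norm_le ξ)
  nonneg := add_nonneg h.nonneg h'.nonneg
  comm lam hlam g B L hB hL f hf := by
    rw [multCLM_mul h.measurable h'.measurable h.norm_le h'.norm_le,
      multCLM_mul h.measurable h'.measurable h.norm_le h'.norm_le]
    have e : multCLM m (multCLM m' (mulL g f)) - mulL g (multCLM m (multCLM m' f))
        = multCLM m (multCLM m' (mulL g f) - mulL g (multCLM m' f))
          + (multCLM m (mulL g (multCLM m' f)) - mulL g (multCLM m (multCLM m' f))) := by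
      rw [map_sub]; abel
    rw [e]
    have h1 := norm_multCLM_le h.measurable h.norm_le
      (multCLM m' (mulL g f) - mulL g (multCLM m' f))
    have h2 := h'.comm lam hlam g B L hB hL f hf
    have h3 := h.comm lam hlam g B L hB hL (multCLM m' f)
      (hf.multCLM h'.measurable h'.norm_le)
    have h4 := norm_multCLM_le h'.measurable h'.norm_le f
    have h5 : M * L / lam * ‖multCLM m' f‖ ≤ M * L / lam * ‖f‖ :=
      mul_le_mul_of_nonneg_left (by linarith)
        (div_nonneg (mul_nonneg h.nonneg (lipschitz_nonneg hL)) hlam.le)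
    calc _ ≤ _ := norm_add_le _ _
      _ ≤ M' * L / lam * ‖f‖ + M * L / lam * ‖f‖ := by linarith
      _ = _ := by ring

end

section

/-! ### Symbols that are absolutely convergent sums of tensor products -/

/-- A representation `b(x,ξ) = ∑ᵢ cᵢ(x) mᵢ(ξ)` with Lipschitz coefficients `cᵢ` and multipliers `mᵢ`
with commutator bounds at frequencies in the dilates of `K`. -/
structure TensorRep (K : Set E) (b : E → E → ℂ) (ι : Type) where
  /-- the coefficients -/
  c : ι → E → ℂ
  /-- the multipliers -/
  m : ι → E → ℂ
  /-- bounds of the coefficients -/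
  κ : ι → ℝ
  /-- Lipschitz constants of the coefficients -/
  κ' : ι → ℝ
  /-- commutator bounds of the multipliers -/
  μ : ι → ℝ
  norm_c_le : ∀ i x, ‖c i x‖ ≤ κ i
  lip_c : ∀ i x y, ‖c i x - c i y‖ ≤ κ' i * ‖x - y‖
  comm : ∀ i, CommBound K (m i) (μ i)
  mul_le : ∀ i, κ i * μ i ≤ κ' i
  summable : Summable κ
  summable' : Summable κ'
  hasSum : ∀ x ξ, HasSum (fun i => c i x * m i ξ) (b x ξ)

/-- `b` has a tensor representation of size at most `C`, and of size at most `C'` if one derivative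
falls on a coefficient or a multiplier. -/
def TensorBound (K : Set E) (b : E → E → ℂ) (C C' : ℝ) : Prop :=
  ∃ (ι : Type) (_ : Countable ι) (T : TensorRep K b ι), ∑' i, T.κ i ≤ C ∧ ∑' i, T.κ' i ≤ C'

namespace TensorRep

variable {K : Set E} {b : E → E → ℂ} {ι : Type} (T : TensorRep K b ι)

theorem κ_nonneg (i : ι) : 0 ≤ T.κ i := (norm_nonneg _).trans (T.norm_c_le i 0)

theorem κ'_nonneg (i : ι) : 0 ≤ T.κ' i := lipschitz_nonneg (T.lip_c i)

theorem measurable_c (i : ι) : Measurable (T.c i) := measurable_of_lipschitz (T.lip_c i)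

theorem norm_term_le (i : ι) (x ξ : E) : ‖T.c i x * T.m i ξ‖ ≤ T.κ i := by
  rw [norm_mul]
  calc _ ≤ T.κ i * 1 := mul_le_mul (T.norm_c_le i x) ((T.comm i).norm_le ξ) (norm_nonneg _)
        (T.κ_nonneg i)
    _ = _ := mul_one _

theorem summable_norm (x ξ : E) : Summable fun i => ‖T.c i x * T.m i ξ‖ :=
  Summable.of_nonneg_of_le (fun _ => norm_nonneg _) (fun i => T.norm_term_le i x ξ) T.summable

theorem hasSum_mul {b' : E → E → ℂ} {ι' : Type} (T' : TensorRep K b' ι') (x ξ : E) :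
    HasSum (fun p : ι × ι' => T.c p.1 x * T'.c p.2 x * (T.m p.1 ξ * T'.m p.2 ξ))
      (b x ξ * b' x ξ) := by
  have hs := summable_mul_of_summable_norm (T.summable_norm x ξ) (T'.summable_norm x ξ)
  have h3 := HasSum.mul (T.hasSum x ξ) (T'.hasSum x ξ) hs
  have e : (fun p : ι × ι' => T.c p.1 x * T'.c p.2 x * (T.m p.1 ξ * T'.m p.2 ξ))
      = fun p => T.c p.1 x * T.m p.1 ξ * (T'.c p.2 x * T'.m p.2 ξ) := by
    funext p; ring
  rw [e]; exact h3

/-- The product of two tensor representations. -/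
def mul {b' : E → E → ℂ} {ι' : Type} (T' : TensorRep K b' ι') :
    TensorRep K (fun x ξ => b x ξ * b' x ξ) (ι × ι') where
  c p x := T.c p.1 x * T'.c p.2 x
  m p ξ := T.m p.1 ξ * T'.m p.2 ξ
  κ p := T.κ p.1 * T'.κ p.2
  κ' p := T.κ' p.1 * T'.κ p.2 + T.κ p.1 * T'.κ' p.2
  μ p := T.μ p.1 + T'.μ p.2
  norm_c_le p x := by
    rw [norm_mul]
    exact mul_le_mul (T.norm_c_le _ x) (T'.norm_c_le _ x) (norm_nonneg _) (T.κ_nonneg _)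
  lip_c p x y := by
    have e : T.c p.1 x * T'.c p.2 x - T.c p.1 y * T'.c p.2 y
        = (T.c p.1 x - T.c p.1 y) * T'.c p.2 x + T.c p.1 y * (T'.c p.2 x - T'.c p.2 y) := by ring
    rw [e]
    refine (norm_add_le _ _).trans ?_
    rw [norm_mul, norm_mul]
    have h1 := mul_le_mul (T.lip_c p.1 x y) (T'.norm_c_le p.2 x) (norm_nonneg _)
      (mul_nonneg (T.κ'_nonneg _) (norm_nonneg _))
    have h2 := mul_le_mul (T.norm_c_le p.1 y) (T'.lip_c p.2 x y) (norm_nonneg _) (T.κ_nonneg _)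
    linarith
  comm p := (T.comm p.1).mul (T'.comm p.2)
  mul_le p := by
    have h1 := mul_le_mul_of_nonneg_right (T.mul_le p.1) (T'.κ_nonneg p.2)
    have h2 := mul_le_mul_of_nonneg_left (T'.mul_le p.2) (T.κ_nonneg p.1)
    linarith
  summable := T.summable.mul_of_nonneg T'.summable T.κ_nonneg T'.κ_nonneg
  summable' := by
    have s1 : Summable fun p : ι × ι' => T.κ' p.1 * T'.κ p.2 :=
      T.summable'.mul_of_nonneg T'.summable T.κ'_nonneg T'.κ_nonneg
    have s2 : Summable fun p : ι × ι' => T.κ p.1 * T'.κ' p.2 :=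
      T.summable.mul_of_nonneg T'.summable' T.κ_nonneg T'.κ'_nonneg
    exact s1.add s2
  hasSum x ξ := by
    exact T.hasSum_mul T' x ξ

end TensorRep

/-- The second constant behaves like a derivative and obeys the product rule; the sums over pairs of
indices factorize. -/
theorem TensorBound.mul {K : Set E} {b b' : E → E → ℂ} {C C' D D' : ℝ} (h : TensorBound K b C C')
    (h' : TensorBound K b' D D') :
    TensorBound K (fun x ξ => b x ξ * b' x ξ) (C * D) (C' * D + C * D') := by
  obtain ⟨ι, _, T, h1, h2⟩ := h
  obtain ⟨ι', _, T', h1', h2'⟩ := h'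
  have n1 : 0 ≤ ∑' i, T.κ i := tsum_nonneg T.κ_nonneg
  have n2 : 0 ≤ ∑' i, T.κ' i := tsum_nonneg T.κ'_nonneg
  have n1' : 0 ≤ ∑' i, T'.κ i := tsum_nonneg T'.κ_nonneg
  have n2' : 0 ≤ ∑' i, T'.κ' i := tsum_nonneg T'.κ'_nonneg
  refine ⟨ι × ι', inferInstance, T.mul T', ?_, ?_⟩
  · have := (T.summable.hasSum.mul T'.summable.hasSum (T.mul T').summable).tsum_eq
    change ∑' p : ι × ι', T.κ p.1 * T'.κ p.2 ≤ _
    rw [this]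
    exact mul_le_mul h1 h1' n1' (n1.trans h1)
  · have s1 := T.summable'.mul_of_nonneg T'.summable T.κ'_nonneg T'.κ_nonneg
    have s2 := T.summable.mul_of_nonneg T'.summable' T.κ_nonneg T'.κ'_nonneg
    have e1 := T.summable'.hasSum.mul T'.summable.hasSum s1
    have e2 := T.summable.hasSum.mul T'.summable'.hasSum s2
    change ∑' p : ι × ι', (T.κ' p.1 * T'.κ p.2 + T.κ p.1 * T'.κ' p.2) ≤ _
    rw [(e1.add e2).tsum_eq]
    exact add_le_add (mul_le_mul h2 h1' n1' (n2.trans h2)) (mul_le_mul h1 h2' n2' (n1.trans h1))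

theorem TensorBound.mono {K : Set E} {b : E → E → ℂ} {C C' D D' : ℝ} (h : TensorBound K b C C')
    (hC : C ≤ D) (hC' : C' ≤ D') : TensorBound K b D D' := by
  obtain ⟨ι, hι, T, h1, h2⟩ := h
  exact ⟨ι, hι, T, h1.trans hC, h2.trans hC'⟩

/-- Allows a power series in a tensor symbol to be treated as one tensor symbol, indexed by pairs of
a degree and a term of that degree. -/
theorem TensorBound.tsum {K : Set E} {b : E → E → ℂ} {bn : ℕ → E → E → ℂ} {C C' : ℕ → ℝ}
    (h : ∀ n, TensorBound K (bn n) (C n) (C' n)) (hC : Summable C) (hC' : Summable C')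
    (hb : ∀ x ξ, HasSum (fun n => bn n x ξ) (b x ξ)) :
    TensorBound K b (∑' n, C n) (∑' n, C' n) := by
  choose ι hι T h1 h2 using h
  have n1 : ∀ n, 0 ≤ ∑' i, (T n).κ i := fun n => tsum_nonneg (T n).κ_nonneg
  have n2 : ∀ n, 0 ≤ ∑' i, (T n).κ' i := fun n => tsum_nonneg (T n).κ'_nonneg
  have t1 : Summable fun n => ∑' i, (T n).κ i := Summable.of_nonneg_of_le n1 h1 hC
  have t2 : Summable fun n => ∑' i, (T n).κ' i := Summable.of_nonneg_of_le n2 h2 hC'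
  have s1 : Summable fun p : Σ n, ι n => (T p.1).κ p.2 :=
    (summable_sigma_of_nonneg fun p => (T p.1).κ_nonneg p.2).2 ⟨fun n => (T n).summable, t1⟩
  have s2 : Summable fun p : Σ n, ι n => (T p.1).κ' p.2 :=
    (summable_sigma_of_nonneg fun p => (T p.1).κ'_nonneg p.2).2 ⟨fun n => (T n).summable', t2⟩
  refine ⟨Σ n, ι n, inferInstance, {
    c := fun p => (T p.1).c p.2
    m := fun p => (T p.1).m p.2
    κ := fun p => (T p.1).κ p.2
    κ' := fun p => (T p.1).κ' p.2
    μ := fun p => (T p.1).μ p.2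
    norm_c_le := fun p => (T p.1).norm_c_le p.2
    lip_c := fun p => (T p.1).lip_c p.2
    comm := fun p => (T p.1).comm p.2
    mul_le := fun p => (T p.1).mul_le p.2
    summable := s1
    summable' := s2
    hasSum := fun x ξ => ?_ }, ?_, ?_⟩
  · have hs : Summable fun p : Σ n, ι n => (T p.1).c p.2 x * (T p.1).m p.2 ξ :=
      Summable.of_norm_bounded s1 fun p => (T p.1).norm_term_le p.2 x ξ
    have := hs.hasSum.sigma fun n => (T n).hasSum x ξ
    rw [(hb x ξ).unique this]
    exact hs.hasSum
  · rw [s1.tsum_sigma' fun n => (T n).summable]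
    exact t1.tsum_le_tsum h1 hC
  · rw [s2.tsum_sigma' fun n => (T n).summable']
    exact t2.tsum_le_tsum h2 hC'

/-- A single tensor product. -/
theorem TensorBound.single {K : Set E} {c m : E → ℂ} {A L M : ℝ} (hA : ∀ x, ‖c x‖ ≤ A)
    (hL : ∀ x y, ‖c x - c y‖ ≤ L * ‖x - y‖) (hm : CommBound K m M) :
    TensorBound K (fun x ξ => c x * m ξ) A (L + A * M) := by
  have h0 : 0 ≤ A := (norm_nonneg _).trans (hA 0)
  refine ⟨Unit, inferInstance, {
    c := fun _ => c
    m := fun _ => m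
    κ := fun _ => A
    -- The entry has to dominate both the Lipschitz constant of `c` and the product `A * M` required
    -- by `mul_le`.
    κ' := fun _ => L + A * M
    μ := fun _ => M
    norm_c_le := fun _ => hA
    lip_c := fun _ x y => (hL x y).trans
      (mul_le_mul_of_nonneg_right (by linarith [mul_nonneg h0 hm.nonneg]) (norm_nonneg _))
    comm := fun _ => hm
    mul_le := fun _ => by linarith [lipschitz_nonneg hL]
    summable := (hasSum_fintype _).summable
    summable' := (hasSum_fintype _).summable
    hasSum := fun x ξ => by
      simpa only [Fintype.sum_unique] using hasSum_fintype fun _ : Unit => c x * m ξ }, ?_, ?_⟩ <;>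
  simp

theorem TensorBound.add {K : Set E} {b b' : E → E → ℂ} {C C' D D' : ℝ} (h : TensorBound K b C C')
    (h' : TensorBound K b' D D') :
    TensorBound K (fun x ξ => b x ξ + b' x ξ) (C + D) (C' + D') := by
  obtain ⟨ι, _, T, h1, h2⟩ := h
  obtain ⟨ι', _, T', h1', h2'⟩ := h'
  have s1 : HasSum (Sum.elim T.κ T'.κ) (∑' i, T.κ i + ∑' i, T'.κ i) :=
    HasSum.sum T.summable.hasSum T'.summable.hasSum
  have s2 : HasSum (Sum.elim T.κ' T'.κ') (∑' i, T.κ' i + ∑' i, T'.κ' i) :=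
    HasSum.sum T.summable'.hasSum T'.summable'.hasSum
  refine ⟨ι ⊕ ι', inferInstance, {
    c := Sum.elim T.c T'.c
    m := Sum.elim T.m T'.m
    κ := Sum.elim T.κ T'.κ
    κ' := Sum.elim T.κ' T'.κ'
    μ := Sum.elim T.μ T'.μ
    norm_c_le := by rintro (i | i) <;> [exact T.norm_c_le i; exact T'.norm_c_le i]
    lip_c := by rintro (i | i) <;> [exact T.lip_c i; exact T'.lip_c i]
    comm := by rintro (i | i) <;> [exact T.comm i; exact T'.comm i]
    mul_le := by rintro (i | i) <;> [exact T.mul_le i; exact T'.mul_le i]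
    summable := s1.summable
    summable' := s2.summable
    hasSum := fun x ξ => HasSum.sum (T.hasSum x ξ) (T'.hasSum x ξ) }, ?_, ?_⟩
  · exact s1.tsum_eq.trans_le (add_le_add h1 h1')
  · exact s2.tsum_eq.trans_le (add_le_add h2 h2')

end

section

/-! ### Operators with tensor symbols on `L²` -/

/-- `w` is square integrable, with norm at most `A`. -/
def L2Bound (w : E → ℂ) (A : ℝ) : Prop := MemLp w 2 ∧ eLpNorm w 2 ≤ ENNReal.ofReal A

/-- The oscillatory integral `∫ e^{2πi⟨x,ξ⟩} b(x, 2πξ) v(ξ) dξ`. -/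
def osc (b : E → E → ℂ) (v : E → ℂ) (x : E) : ℂ :=
  ∫ ξ : E, Complex.exp (2 * Real.pi * Complex.I * (inner ℝ x ξ : ℝ)) * b x ((2 * Real.pi) • ξ) * v ξ

theorem osc_congr_ae {b b' : E → E → ℂ} {v v' : E → ℂ}
    (h : ∀ x, ∀ᵐ ξ, b x ((2 * Real.pi) • ξ) * v ξ = b' x ((2 * Real.pi) • ξ) * v' ξ) :
    osc b v = osc b' v' := by
  funext x
  refine integral_congr_ae ?_
  filter_upwards [h x] with ξ hξ
  rw [mul_assoc, hξ, ← mul_assoc]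

theorem fourierInv_apply_eq_integral (v : E → ℂ) (x : E) :
    𝓕⁻ v x = ∫ ξ : E, Complex.exp (2 * Real.pi * Complex.I * (inner ℝ x ξ : ℝ)) * v ξ := by
  rw [Real.fourierInv_eq']
  refine integral_congr_ae (Filter.Eventually.of_forall fun ξ => ?_)
  simp only [smul_eq_mul, real_inner_comm x ξ]
  congr 2
  push_cast
  ring

theorem osc_multiplier (m v : E → ℂ) : osc (fun _ ξ => m ξ) v = 𝓕⁻ (fun ξ => dil m ξ * v ξ) := by
  funext x
  rw [fourierInv_apply_eq_integral]
  simp only [osc, dil, mul_assoc]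

theorem osc_one (v : E → ℂ) : osc (fun _ _ => 1) v = 𝓕⁻ v := by
  rw [osc_multiplier]; simp [dil]

theorem norm_exp_phase (x ξ : E) :
    ‖Complex.exp (2 * Real.pi * Complex.I * (inner ℝ x ξ : ℝ))‖ = 1 := by
  rw [show (2 * Real.pi * Complex.I * (inner ℝ x ξ : ℝ) : ℂ)
    = ((2 * Real.pi * inner ℝ x ξ : ℝ) : ℂ) * Complex.I by push_cast; ring]
  exact Complex.norm_exp_ofReal_mul_I _

theorem continuous_phase (x : E) :
    Continuous fun ξ : E => Complex.exp (2 * Real.pi * Complex.I * (inner ℝ x ξ : ℝ)) := by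
  fun_prop

/-- Convergence in L² gives almost everywhere convergence along a sequence of partial sums, whose
limit must be the pointwise sum. Countability puts all finite partial sums outside one common null
set. -/
theorem ae_eq_of_hasSum {ι : Type} [Countable ι] {f : ι → L2} {S : L2} {F : E → ℂ}
    (h : HasSum f S) (hF : ∀ᵐ x, HasSum (fun i => f i x) (F x)) : S =ᵐ[volume] F := by
  have h1 := tendstoInMeasure_of_tendsto_Lp (μ := (volume : Measure E)) h
  obtain ⟨ns, hns, hae⟩ := h1.exists_seq_tendsto_ae'
  have h2 : ∀ᵐ x, ∀ s : Finset ι, (∑ i ∈ s, f i : L2) x = ∑ i ∈ s, f i x := by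
    rw [ae_all_iff]
    intro s
    filter_upwards [Lp.coeFn_finsetSum s f] with x hx
    rw [hx, Finset.sum_apply]
  filter_upwards [hae, hF, h2] with x hx hFx h2x
  refine tendsto_nhds_unique hx ?_
  simp only [h2x]
  exact hFx.comp hns

theorem norm_le_toReal {w : E → ℂ} {A : ℝ} (hA : 0 ≤ A) :
    L2Bound w A ↔ ∃ h : MemLp w 2, ‖h.toLp w‖ ≤ A := by
  constructor
  · rintro ⟨h, h'⟩
    refine ⟨h, ?_⟩
    rw [Lp.norm_toLp]
    exact ENNReal.toReal_le_of_le_ofReal hA h'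
  · rintro ⟨h, h'⟩
    refine ⟨h, ?_⟩
    rw [Lp.norm_toLp] at h'
    exact (ENNReal.le_ofReal_iff_toReal_le h.2.ne hA).2 h'

theorem integrable_bounded_mul {m v : E → ℂ} (hm : Measurable m) {C : ℝ} (hC : ∀ ξ, ‖m ξ‖ ≤ C)
    (hv : Integrable v) : Integrable fun ξ => m ξ * v ξ :=
  hv.bdd_mul hm.aestronglyMeasurable (Filter.Eventually.of_forall hC)

theorem memLp_bounded_mul {m v : E → ℂ} (hm : Measurable m) {C : ℝ} (hC : ∀ ξ, ‖m ξ‖ ≤ C)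
    (hv : MemLp v 2) : MemLp (fun ξ => m ξ * v ξ) 2 :=
  hv.mul (memLp_top_of_le hm hC)

theorem toLp_bounded_mul {m v : E → ℂ} (hm : Measurable m) {C : ℝ} (hC : ∀ ξ, ‖m ξ‖ ≤ C)
    (hv : MemLp v 2) :
    (memLp_bounded_mul hm hC hv).toLp _ = mulL m (hv.toLp v) := by
  refine Lp.ext ?_
  filter_upwards [(memLp_bounded_mul hm hC hv).coeFn_toLp, mulL_ae (memLp_top_of_le hm hC)
    (hv.toLp v), hv.coeFn_toLp] with x h1 h2 h3
  rw [h1, h2, h3]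

namespace TensorRep

variable {K : Set E} {b : E → E → ℂ} {ι : Type} (T : TensorRep K b ι)

/-- Sum and integral may be exchanged because the i-th integrand is bounded by κᵢ |v| and the κᵢ are
summable. -/
theorem hasSum_osc [Countable ι] {v : E → ℂ} (h1 : Integrable v) (x : E) :
    HasSum (fun i => T.c i x * 𝓕⁻ (fun ξ => dil (T.m i) ξ * v ξ) x) (osc b v x) := by
  have hm : ∀ i, Integrable fun ξ => dil (T.m i) ξ * v ξ := fun i =>
    integrable_bounded_mul (measurable_dil (T.comm i).measurable) (fun _ => (T.comm i).norm_le _) h1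
  have hnorm : ∀ i ξ, ‖T.c i x * (Complex.exp (2 * Real.pi * Complex.I * (inner ℝ x ξ : ℝ))
      * (dil (T.m i) ξ * v ξ))‖ ≤ T.κ i * ‖v ξ‖ := fun i ξ => by
    rw [norm_mul, norm_mul, norm_exp_phase, one_mul, norm_mul, ← mul_assoc, ← norm_mul]
    exact mul_le_mul_of_nonneg_right (T.norm_term_le i x _) (norm_nonneg _)
  have hint : ∀ i, Integrable fun ξ => T.c i x *
      (Complex.exp (2 * Real.pi * Complex.I * (inner ℝ x ξ : ℝ)) * (dil (T.m i) ξ * v ξ)) :=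
    fun i => ((hm i).bdd_mul (continuous_phase x).aestronglyMeasurable
      (Filter.Eventually.of_forall fun ξ => (norm_exp_phase x ξ).le)).const_mul _
  have hs : Summable fun i => ∫ ξ, ‖T.c i x *
      (Complex.exp (2 * Real.pi * Complex.I * (inner ℝ x ξ : ℝ)) * (dil (T.m i) ξ * v ξ))‖ := by
    refine Summable.of_nonneg_of_le (fun i => integral_nonneg fun ξ => norm_nonneg _)
      (fun i => integral_mono (hint i).norm (h1.norm.const_mul (T.κ i)) (hnorm i)) ?_
    simp only [integral_const_mul]
    exact T.summable.mul_right _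
  have key := hasSum_integral_of_summable_integral_norm hint hs
  simp only [integral_const_mul, ← fourierInv_apply_eq_integral] at key
  have e : osc b v x = ∫ ξ, ∑' i, T.c i x *
      (Complex.exp (2 * Real.pi * Complex.I * (inner ℝ x ξ : ℝ)) * (dil (T.m i) ξ * v ξ)) := by
    refine integral_congr_ae (Filter.Eventually.of_forall fun ξ => ?_)
    simp only
    have h := ((T.hasSum x ((2 * Real.pi) • ξ)).mul_left
      (Complex.exp (2 * Real.pi * Complex.I * (inner ℝ x ξ : ℝ)))).mul_right (v ξ)
    rw [← h.tsum_eq]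
    congr 1; funext i; simp only [dil]; ring
  rw [e]; exact key

/-- The terms of the operator on `L²`. -/
def term (i : ι) (f : L2) : L2 := mulL (T.c i) (multCLM (T.m i) f)

theorem norm_term_apply_le (i : ι) (f : L2) : ‖T.term i f‖ ≤ T.κ i * ‖f‖ := by
  refine (norm_mulL_le (T.measurable_c i) (T.norm_c_le i) _).trans ?_
  refine mul_le_mul_of_nonneg_left ?_ (T.κ_nonneg i)
  simpa using norm_multCLM_le (T.comm i).measurable (T.comm i).norm_le f

theorem summable_term (f : L2) : Summable fun i => T.term i f :=
  Summable.of_norm_bounded (T.summable.mul_right ‖f‖) fun i => T.norm_term_apply_le i f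

theorem term_ae {v : E → ℂ} (h1 : Integrable v) (h2 : MemLp v 2) (i : ι) :
    T.term i (𝓕⁻ (h2.toLp v)) =ᵐ[volume]
      fun x => T.c i x * 𝓕⁻ (fun ξ => dil (T.m i) ξ * v ξ) x := by
  have hb := fun ξ => (T.comm i).norm_le ((2 * Real.pi) • ξ)
  have hm := measurable_dil (T.comm i).measurable
  have e : multCLM (T.m i) (𝓕⁻ (h2.toLp v)) = 𝓕⁻ ((memLp_bounded_mul hm hb h2).toLp _) := by
    rw [multCLM_apply, FourierTransform.fourier_fourierInv_eq, toLp_bounded_mul hm hb]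
  rw [term, e]
  filter_upwards [mulL_ae (memLp_top_of_le (T.measurable_c i) (T.norm_c_le i))
    (𝓕⁻ ((memLp_bounded_mul hm hb h2).toLp _)),
    toLp_fourierInv_ae (integrable_bounded_mul hm hb h1) (memLp_bounded_mul hm hb h2)]
    with x h3 h4
  rw [h3, h4]

/-- Links the two descriptions of the operator: the norm convergent series in L², convenient for
estimates, and the pointwise oscillatory integral in terms of which the operators are defined. -/
theorem tsum_term_ae [Countable ι] {v : E → ℂ} (h1 : Integrable v) (h2 : MemLp v 2) :
    (∑' i, T.term i (𝓕⁻ (h2.toLp v)) : L2) =ᵐ[volume] osc b v := by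
  refine ae_eq_of_hasSum (T.summable_term _).hasSum ?_
  have h := ae_all_iff.2 fun i => T.term_ae h1 h2 i
  filter_upwards [h] with x hx
  simp only [hx]
  exact T.hasSum_osc h1 x

theorem memLp_osc [Countable ι] (T : TensorRep K b ι) {v : E → ℂ} (h1 : Integrable v) (h2 : MemLp v 2) :
    MemLp (osc b v) 2 :=
  (memLp_congr_ae (T.tsum_term_ae h1 h2)).1 (Lp.memLp _)

theorem toLp_osc [Countable ι] {v : E → ℂ} (h1 : Integrable v) (h2 : MemLp v 2) :
    (T.memLp_osc h1 h2).toLp _ = ∑' i, T.term i (𝓕⁻ (h2.toLp v)) :=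
  Lp.ext ((MemLp.coeFn_toLp _).trans (T.tsum_term_ae h1 h2).symm)

theorem norm_tsum_term_le (f : L2) : ‖∑' i, T.term i f‖ ≤ (∑' i, T.κ i) * ‖f‖ :=
  tsum_of_norm_bounded (T.summable.hasSum.mul_right ‖f‖) fun i => T.norm_term_apply_le i f

/-- The (i,j) term of the defect is cᵢ [mᵢ(D), c'ⱼ] m'ⱼ(D), of size at most κᵢ μᵢ κ'ⱼ / lam. The
condition `mul_le` absorbs κᵢ μᵢ into κ'ᵢ, after which the double sum splits. -/
theorem norm_comp_sub_le {b' : E → E → ℂ} {ι' : Type} (T' : TensorRep K b' ι') {lam : ℝ}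
    (hlam : 0 < lam) {h : L2} (hh : Localized K lam (𝓕 h : L2)) :
    ‖∑' i, T.term i (∑' j, T'.term j h) - ∑' p, (T.mul T').term p h‖
      ≤ (∑' i, T.κ' i) * (∑' j, T'.κ' j) / lam * ‖h‖ := by
  have e1 : ∀ i j, (T.mul T').term (i, j) h
      = mulL (T.c i) (mulL (T'.c j) (multCLM (T.m i) (multCLM (T'.m j) h))) := fun i j => by
    change mulL (fun x => T.c i x * T'.c j x) (multCLM (fun ξ => T.m i ξ * T'.m j ξ) h) = _
    rw [multCLM_mul (T.comm i).measurable (T'.comm j).measurable (T.comm i).norm_le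
      (T'.comm j).norm_le]
    refine mulL_mul (memLp_top_of_le (T.measurable_c i) (T.norm_c_le i))
      (memLp_top_of_le (T'.measurable_c j) (T'.norm_c_le j))
      (memLp_top_of_le ((T.measurable_c i).mul (T'.measurable_c j))
        ((T.mul T').norm_c_le (i, j))) _
  have s1 : ∀ i, Summable fun j => (T.mul T').term (i, j) h := fun i =>
    ((T.mul T').summable_term h).prod_factor i
  have e2 : ∑' p, (T.mul T').term p h = ∑' i, ∑' j, (T.mul T').term (i, j) h :=
    ((T.mul T').summable_term h).tsum_prod
  have s2 : Summable fun i => ∑' j, (T.mul T').term (i, j) h :=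
    ((T.mul T').summable_term h).prod
  rw [e2, ← (T.summable_term _).tsum_sub s2]
  set D' := ∑' j, T'.κ' j
  have hb : ∀ i, ‖T.term i (∑' j, T'.term j h) - ∑' j, (T.mul T').term (i, j) h‖
      ≤ T.κ' i * (D' / lam * ‖h‖) := by
    intro i
    have e3 : T.term i (∑' j, T'.term j h) = ∑' j, T.term i (T'.term j h) :=
      ((mulL (T.c i)) ∘L multCLM (T.m i)).map_tsum (T'.summable_term h)
    have s3 : Summable fun j => T.term i (T'.term j h) :=
      ((mulL (T.c i)) ∘L multCLM (T.m i)).summable (T'.summable_term h)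
    rw [e3, ← s3.tsum_sub (s1 i)]
    have hj : ∀ j, ‖T.term i (T'.term j h) - (T.mul T').term (i, j) h‖
        ≤ T.κ i * (T.μ i * T'.κ' j / lam * ‖h‖) := by
      intro j
      rw [e1]
      simp only [term]
      rw [← map_sub]
      refine (norm_mulL_le (T.measurable_c i) (T.norm_c_le i) _).trans ?_
      refine mul_le_mul_of_nonneg_left ?_ (T.κ_nonneg i)
      refine ((T.comm i).comm lam hlam (T'.c j) (T'.κ j) (T'.κ' j) (T'.norm_c_le j)
        (T'.lip_c j) _ (hh.multCLM (T'.comm j).measurable (T'.comm j).norm_le)).trans ?_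
      refine mul_le_mul_of_nonneg_left ?_ (div_nonneg (mul_nonneg (T.comm i).nonneg
        (T'.κ'_nonneg j)) hlam.le)
      simpa using norm_multCLM_le (T'.comm j).measurable (T'.comm j).norm_le h
    have hs := (((T'.summable'.hasSum.mul_left (T.μ i)).div_const lam).mul_right ‖h‖).mul_left
      (T.κ i)
    refine (tsum_of_norm_bounded hs hj).trans ?_
    have h0 : 0 ≤ D' / lam * ‖h‖ :=
      mul_nonneg (div_nonneg (tsum_nonneg T'.κ'_nonneg) hlam.le) (norm_nonneg _)
    calc T.κ i * (T.μ i * D' / lam * ‖h‖) = T.κ i * T.μ i * (D' / lam * ‖h‖) := by ring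
      _ ≤ _ := mul_le_mul_of_nonneg_right (T.mul_le i) h0
  refine (tsum_of_norm_bounded (T.summable'.hasSum.mul_right _) hb).trans (le_of_eq ?_)
  ring

end TensorRep

/-- Only the sizes of coefficients and multipliers enter, not the commutator bounds; no localization
to `K` is needed. -/
theorem TensorBound.l2Bound_osc {K : Set E} {b : E → E → ℂ} {C C' : ℝ} (hb : TensorBound K b C C')
    {v : E → ℂ} (h1 : Integrable v) {A : ℝ} (hv : L2Bound v A) (hA : 0 ≤ A) :
    L2Bound (osc b v) (C * A) := by
  obtain ⟨ι, _, T, hT, -⟩ := hb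
  have h0 : 0 ≤ ∑' i, T.κ i := tsum_nonneg T.κ_nonneg
  obtain ⟨h2, hn⟩ := (norm_le_toReal hA).1 hv
  refine (norm_le_toReal (mul_nonneg (h0.trans hT) hA)).2 ⟨T.memLp_osc h1 h2, ?_⟩
  rw [T.toLp_osc h1 h2]
  refine (T.norm_tsum_term_le _).trans ?_
  rw [norm_fourierInv_L2]
  exact mul_le_mul hT hn (norm_nonneg _) (h0.trans hT)

theorem TensorBound.comp {K : Set E} {b b' : E → E → ℂ} {C C' D D' : ℝ}
    (hb : TensorBound K b C C') (hb' : TensorBound K b' D D') {v : E → ℂ} (h1 : Integrable v)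
    {A : ℝ} (hv : L2Bound v A) (hA : 0 ≤ A) {lam : ℝ} (hlam : 0 < lam)
    (hloc : Localized K lam v) (hF : Integrable (l2Fourier (osc b' v))) :
    L2Bound (osc b (l2Fourier (osc b' v))
      - osc (fun x ξ => b x ξ * b' x ξ) v) (C' * D' / lam * A) := by
  obtain ⟨ι, _, T, -, hT⟩ := hb
  obtain ⟨ι', _, T', -, hT'⟩ := hb'
  have h0 : 0 ≤ ∑' i, T.κ' i := tsum_nonneg T.κ'_nonneg
  have h0' : 0 ≤ ∑' i, T'.κ' i := tsum_nonneg T'.κ'_nonneg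
  obtain ⟨h2, hn⟩ := (norm_le_toReal hA).1 hv
  have hle : (∑' i, T.κ' i) * (∑' j, T'.κ' j) ≤ C' * D' :=
    mul_le_mul hT hT' h0' (h0.trans hT)
  have hpos : 0 ≤ C' * D' / lam := div_nonneg ((mul_nonneg h0 h0').trans hle) hlam.le
  have hw := T'.memLp_osc h1 h2
  have hFw := memLp_l2Fourier (osc b' v)
  refine (norm_le_toReal (mul_nonneg hpos hA)).2
    ⟨(T.memLp_osc hF hFw).sub ((T.mul T').memLp_osc h1 h2), ?_⟩
  rw [MemLp.toLp_sub (T.memLp_osc hF hFw) ((T.mul T').memLp_osc h1 h2), T.toLp_osc hF hFw,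
    (T.mul T').toLp_osc h1 h2]
  -- The inner oscillatory integral is passed through the Fourier transform and back, which turns
  -- the composition into one of norm convergent series.
  have e : (𝓕⁻ (hFw.toLp (l2Fourier (osc b' v))) : L2)
      = ∑' j, T'.term j (𝓕⁻ (h2.toLp v)) := by
    have : hFw.toLp (l2Fourier (osc b' v)) = (𝓕 (hw.toLp _) : L2) := by
      simp only [l2Fourier_eq hw]; exact Lp.toLp_coeFn _ _
    rw [this, FourierTransform.fourierInv_fourier_eq, T'.toLp_osc h1 h2]
  rw [e]
  have hh : Localized K lam (𝓕 (𝓕⁻ (h2.toLp v) : L2) : L2) := by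
    rw [FourierTransform.fourier_fourierInv_eq]
    filter_upwards [hloc, h2.coeFn_toLp] with ξ h3 h4
    rw [h4]; exact h3
  refine (T.norm_comp_sub_le T' hlam hh).trans ?_
  rw [norm_fourierInv_L2]
  exact mul_le_mul (div_le_div_of_nonneg_right hle hlam.le) hn (norm_nonneg _) hpos

end

section

/-! ### Commutators of homogeneous multipliers with Lipschitz functions -/

/-- Young's inequality L¹ * L² → L²: Cauchy–Schwarz after splitting k f = k^{1/2} · k^{1/2} f, then
Tonelli. -/
theorem lintegral_convolution_sq_le {k f : E → ENNReal} (hk : Measurable k)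
    (hf : AEMeasurable f) :
    ∫⁻ x, (∫⁻ y, k (x - y) * f y) ^ 2 ≤ (∫⁻ y, k y) ^ 2 * ∫⁻ y, f y ^ 2 := by
  set I := ∫⁻ y, k y
  have hI : ∀ x : E, ∫⁻ y, k (x - y) = I := fun x => lintegral_sub_left_eq_self k x
  have hI' : ∀ y : E, ∫⁻ x, k (x - y) = I := fun y => lintegral_sub_right_eq_self k y
  have h1 : ∀ x, (∫⁻ y, k (x - y) * f y) ^ 2 ≤ I * ∫⁻ y, k (x - y) * f y ^ 2 := by
    intro x
    have hkx : Measurable fun y => k (x - y) := hk.comp (measurable_const.sub measurable_id)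
    have hold := ENNReal.lintegral_mul_le_Lp_mul_Lq volume Real.HolderConjugate.two_two
      (f := fun y => k (x - y) ^ (1 / 2 : ℝ)) (g := fun y => k (x - y) ^ (1 / 2 : ℝ) * f y)
      (hkx.pow_const _).aemeasurable ((hkx.pow_const _).aemeasurable.mul hf)
    have e1 : ∀ y, ((fun y => k (x - y) ^ (1 / 2 : ℝ)) * fun y => k (x - y) ^ (1 / 2 : ℝ) * f y) y
        = k (x - y) * f y := fun y => by
      simp only [Pi.mul_apply]
      rw [← mul_assoc, ← ENNReal.rpow_add_of_nonneg _ _ (by norm_num) (by norm_num)]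
      norm_num
    have e2 : ∀ y, (k (x - y) ^ (1 / 2 : ℝ)) ^ (2 : ℝ) = k (x - y) := fun y => by
      rw [← ENNReal.rpow_mul]; norm_num
    have e3 : ∀ y, (k (x - y) ^ (1 / 2 : ℝ) * f y) ^ (2 : ℝ) = k (x - y) * f y ^ 2 := fun y => by
      rw [ENNReal.mul_rpow_of_nonneg _ _ (by norm_num), e2]; norm_num
    simp only [e1, e2, e3, hI] at hold
    calc (∫⁻ y, k (x - y) * f y) ^ 2
        ≤ (I ^ (1 / 2 : ℝ) * (∫⁻ y, k (x - y) * f y ^ 2) ^ (1 / 2 : ℝ)) ^ 2 := by gcongr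
      _ = I * ∫⁻ y, k (x - y) * f y ^ 2 := by
        rw [mul_pow, ← ENNReal.rpow_natCast, ← ENNReal.rpow_natCast, ← ENNReal.rpow_mul,
          ← ENNReal.rpow_mul]
        norm_num
  calc ∫⁻ x, (∫⁻ y, k (x - y) * f y) ^ 2 ≤ ∫⁻ x, I * ∫⁻ y, k (x - y) * f y ^ 2 :=
        lintegral_mono h1
    _ ≤ I ^ 2 * ∫⁻ y, f y ^ 2 := by
      have hm : AEMeasurable (fun p : E × E => k (p.1 - p.2) * f p.2 ^ 2)
          (volume.prod volume) :=
        (hk.comp (measurable_fst.sub measurable_snd)).aemeasurable.mul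
          ((hf.comp_quasiMeasurePreserving Measure.quasiMeasurePreserving_snd).pow_const 2)
      rw [lintegral_const_mul'' _ hm.lintegral_prod_right', lintegral_lintegral_swap hm]
      have : ∀ y, ∫⁻ x, k (x - y) * f y ^ 2 = I * f y ^ 2 := fun y => by
        have hky : Measurable fun x => k (x - y) := hk.comp (measurable_id.sub measurable_const)
        rw [lintegral_mul_const _ hky, hI']
      simp only [this]
      rw [lintegral_const_mul'' _ (hf.pow_const 2), ← mul_assoc, sq]

theorem eLpNorm_two_sq (w : E → ℂ) : eLpNorm w 2 ^ 2 = ∫⁻ x, ‖w x‖ₑ ^ 2 := by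
  have h := eLpNorm_nnreal_pow_eq_lintegral (f := w) (μ := (volume : Measure E)) (p := 2)
    two_ne_zero
  norm_num at h
  exact h

theorem norm_le_of_enorm_le_convolution {F G : L2} {k : E → ℝ} (hk0 : ∀ y, 0 ≤ k y)
    (hk : Integrable k) (hkm : Measurable k)
    (h : ∀ᵐ x, ‖F x‖ₑ ≤ ∫⁻ y, ENNReal.ofReal (k (x - y)) * ‖G y‖ₑ) :
    ‖F‖ ≤ (∫ y, k y) * ‖G‖ := by
  have h1 : ∫⁻ x, ‖F x‖ₑ ^ 2 ≤ (∫⁻ y, ENNReal.ofReal (k y)) ^ 2 * ∫⁻ y, ‖G y‖ₑ ^ 2 := by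
    refine (lintegral_mono_ae ?_).trans
      (lintegral_convolution_sq_le hkm.ennreal_ofReal (Lp.aestronglyMeasurable G).enorm)
    filter_upwards [h] with x hx
    gcongr
  rw [← eLpNorm_two_sq, ← eLpNorm_two_sq, ← ofReal_integral_eq_lintegral_ofReal hk
    (Filter.Eventually.of_forall hk0), ← mul_pow] at h1
  have h2 : eLpNorm F 2 volume ≤ ENNReal.ofReal (∫ y, k y) * eLpNorm G 2 volume :=
    (ENNReal.pow_le_pow_left_iff two_ne_zero).1 h1
  rw [Lp.norm_def, Lp.norm_def]
  have h3 := ENNReal.toReal_mono (ENNReal.mul_ne_top ENNReal.ofReal_ne_top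
    (Lp.eLpNorm_ne_top G)) h2
  rwa [ENNReal.toReal_mul, ENNReal.toReal_ofReal (integral_nonneg hk0)] at h3

/-- The Fourier multiplier `p(ξ)` in the variable dual to the phase `e^{2πi⟨x,ξ⟩}`. -/
def fmul (p : E → ℂ) (f : L2) : L2 := 𝓕⁻ (mulL p (𝓕 f))

theorem memLp_top_of_compact {ψ : E → ℂ} (hψ : ContDiff ℝ ∞ ψ) (hc : HasCompactSupport ψ) :
    MemLp ψ ⊤ volume :=
  (hc.toSchwartzMap hψ).memLp ⊤ volume

/-- For fixed x the function e^{2πi⟨x,ξ⟩} ψ(ξ) is Schwartz; the duality relation for the Fourier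
transform applied to it produces the convolution at x. -/
theorem fmul_ae {ψ : E → ℂ} (hψ : ContDiff ℝ ∞ ψ) (hc : HasCompactSupport ψ) (f : L2) :
    fmul ψ f =ᵐ[volume] fun x => ∫ y, 𝓕⁻ ψ (x - y) * f y := by
  have hψ2 : MemLp ψ 2 := (hc.toSchwartzMap hψ).memLp 2 volume
  have h1 : Integrable fun ξ => ψ ξ * (𝓕 f : L2) ξ := hψ2.integrable_mul (Lp.memLp _)
  have h2 : MemLp (fun ξ => ψ ξ * (𝓕 f : L2) ξ) 2 :=
    (Lp.memLp (𝓕 f : L2)).mul (memLp_top_of_compact hψ hc)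
  have e : mulL ψ (𝓕 f) = h2.toLp _ :=
    Lp.ext ((mulL_ae (memLp_top_of_compact hψ hc) _).trans h2.coeFn_toLp.symm)
  rw [fmul, e]
  refine (toLp_fourierInv_ae h1 h2).trans (Filter.Eventually.of_forall fun x => ?_)
  have hφ : ContDiff ℝ ∞ fun ξ : E =>
      Complex.exp (2 * Real.pi * Complex.I * (inner ℝ x ξ : ℝ)) * ψ ξ := by
    refine ContDiff.mul (Complex.contDiff_exp.comp (contDiff_const.mul
      (Complex.ofRealCLM.contDiff.comp (contDiff_const.inner ℝ contDiff_id)))) hψ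
  have hφc : HasCompactSupport fun ξ : E =>
      Complex.exp (2 * Real.pi * Complex.I * (inner ℝ x ξ : ℝ)) * ψ ξ := hc.mul_left
  have key := integral_schwartz_mul_fourier f (hφc.toSchwartzMap hφ)
  rw [fourierInv_apply_eq_integral]
  simp only [HasCompactSupport.toSchwartzMap_toFun, fourier_coe, mul_assoc] at key ⊢
  refine (Eq.trans (integral_congr_ae (Filter.Eventually.of_forall fun ξ => ?_)) key).trans ?_
  · rfl
  · refine integral_congr_ae (Filter.Eventually.of_forall fun y => ?_)
    simp only
    congr 1
    rw [fourierInv_apply_eq_integral, Real.fourier_eq']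
    refine integral_congr_ae (Filter.Eventually.of_forall fun ξ => ?_)
    simp only [HasCompactSupport.toSchwartzMap, smul_eq_mul]
    change Complex.exp _ * (Complex.exp _ * ψ ξ) = _
    rw [← mul_assoc, ← Complex.exp_add, inner_sub_left, real_inner_comm y ξ]
    congr 2
    push_cast
    ring

/-- The commutator has kernel k(x - y)(g(y) - g(x)), dominated by L |x - y| |k(x - y)|. Young's
inequality then leaves the first moment of k. -/
theorem norm_fmul_comm_le {ψ : E → ℂ} (hψ : ContDiff ℝ ∞ ψ) (hc : HasCompactSupport ψ)
    {g : E → ℂ} {B L : ℝ} (hB : ∀ x, ‖g x‖ ≤ B) (hL : ∀ x y, ‖g x - g y‖ ≤ L * ‖x - y‖) (f : L2) :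
    ‖fmul ψ (mulL g f) - mulL g (fmul ψ f)‖ ≤ (L * ∫ y, ‖y‖ * ‖𝓕⁻ ψ y‖) * ‖f‖ := by
  have hg := memLp_top_of_le (measurable_of_lipschitz hL) hB
  have hL0 := lipschitz_nonneg hL
  set k : 𝓢(E, ℂ) := 𝓕⁻ (hc.toSchwartzMap hψ)
  have hk : 𝓕⁻ ψ = k := by rw [fourierInv_coe]; rfl
  have hint : Integrable fun y => ‖y‖ * ‖k y‖ := by simpa using k.integrable_pow_mul volume 1
  have hkx : ∀ x, MemLp (fun y => k (x - y)) 2 := fun x =>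
    (k.memLp 2 volume).comp_measurePreserving (Measure.measurePreserving_sub_left volume x)
  rw [hk, ← integral_const_mul]
  refine norm_le_of_enorm_le_convolution (k := fun y => L * (‖y‖ * ‖k y‖)) (fun y => by positivity)
    (hint.const_mul L) (by have := k.continuous.measurable; fun_prop) ?_
  filter_upwards [Lp.coeFn_sub (fmul ψ (mulL g f)) (mulL g (fmul ψ f)), fmul_ae hψ hc (mulL g f),
    fmul_ae hψ hc f, mulL_ae hg (fmul ψ f)] with x h1 h2 h3 h4
  rw [h1, Pi.sub_apply, h2, h4, h3, ← integral_const_mul, hk]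
  have e : ∫ y, k (x - y) * mulL g f y = ∫ y, k (x - y) * (g y * f y) := by
    refine integral_congr_ae ?_
    filter_upwards [mulL_ae hg f] with y hy
    rw [hy]
  have hgf : MemLp (fun y => g y * f y) 2 := (Lp.memLp f).mul hg
  have i1 : Integrable fun y => k (x - y) * (g y * f y) := (hkx x).integrable_mul hgf
  have i2 : Integrable fun y => g x * (k (x - y) * f y) :=
    ((hkx x).integrable_mul (Lp.memLp f)).const_mul _
  rw [e, ← integral_sub i1 i2]
  refine (enorm_integral_le_lintegral_enorm _).trans (lintegral_mono fun y => ?_)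
  have e2 : k (x - y) * (g y * f y) - g x * (k (x - y) * f y)
      = k (x - y) * (g y - g x) * f y := by ring
  rw [e2, enorm_mul]
  gcongr
  rw [← ofReal_norm]
  refine ENNReal.ofReal_le_ofReal ?_
  rw [norm_mul]
  have := hL y x
  rw [norm_sub_rev y x] at this
  nlinarith [norm_nonneg (k (x - y))]

/-! ### Rescaled kernels and the gain of one derivative -/

theorem fourierInv_comp_inv_smul (ψ : E → ℂ) {lam : ℝ} (hlam : 0 < lam) (y : E) :
    𝓕⁻ (fun ξ => ψ (lam⁻¹ • ξ)) y = lam ^ 3 * 𝓕⁻ ψ (lam • y) := by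
  rw [fourierInv_apply_eq_integral, fourierInv_apply_eq_integral]
  have h := Measure.integral_comp_inv_smul (volume : Measure E) (fun ξ : E =>
    Complex.exp (2 * Real.pi * Complex.I * (inner ℝ (lam • y) ξ : ℝ)) * ψ ξ) lam
  simp only [finrank_euclideanSpace, Fintype.card_fin, abs_of_pos (pow_pos hlam 3)] at h
  rw [Complex.real_smul] at h
  push_cast at h
  rw [← h]
  refine integral_congr_ae (Filter.Eventually.of_forall fun ξ => ?_)
  simp only [inner_smul_left, inner_smul_right]
  congr 4
  simp
  field_simp

/-- The kernel lam³ k(lam y) keeps its mass but has first moment smaller by 1/lam. This is the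
source of every factor 1/lam in the commutator estimates. -/
theorem integral_norm_mul_fourierInv_comp (ψ : E → ℂ) {lam : ℝ} (hlam : 0 < lam) :
    ∫ y, ‖y‖ * ‖𝓕⁻ (fun ξ => ψ (lam⁻¹ • ξ)) y‖ = lam⁻¹ * ∫ y, ‖y‖ * ‖𝓕⁻ ψ y‖ := by
  have h := Measure.integral_comp_smul (volume : Measure E) (fun y : E => ‖y‖ * ‖𝓕⁻ ψ y‖) lam
  simp only [finrank_euclideanSpace, Fintype.card_fin, abs_of_pos (inv_pos.2 (pow_pos hlam 3)),
    smul_eq_mul, norm_smul, Real.norm_of_nonneg hlam.le] at h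
  have e : ∀ y : E, ‖y‖ * ‖𝓕⁻ (fun ξ => ψ (lam⁻¹ • ξ)) y‖
      = lam ^ 2 * (lam * ‖y‖ * ‖𝓕⁻ ψ (lam • y)‖) := fun y => by
    rw [fourierInv_comp_inv_smul ψ hlam, norm_mul]
    simp only [norm_pow, Complex.norm_real, Real.norm_of_nonneg hlam.le]
    ring
  simp only [e]
  rw [integral_const_mul, h, ← mul_assoc]
  congr 1
  field_simp

theorem norm_fmul_dilate_comm_le {ψ : E → ℂ} (hψ : ContDiff ℝ ∞ ψ) (hc : HasCompactSupport ψ)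
    {lam : ℝ} (hlam : 0 < lam)
    {g : E → ℂ} {B L : ℝ} (hB : ∀ x, ‖g x‖ ≤ B) (hL : ∀ x y, ‖g x - g y‖ ≤ L * ‖x - y‖) (f : L2) :
    ‖fmul (fun ξ => ψ (lam⁻¹ • ξ)) (mulL g f) - mulL g (fmul (fun ξ => ψ (lam⁻¹ • ξ)) f)‖
      ≤ (∫ y, ‖y‖ * ‖𝓕⁻ ψ y‖) * L / lam * ‖f‖ := by
  have h := norm_fmul_comm_le (ψ := fun ξ => ψ (lam⁻¹ • ξ)) (hψ.comp (contDiff_const_smul _))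
    (hc.comp_smul (inv_ne_zero hlam.ne')) hB hL f
  rw [integral_norm_mul_fourierInv_comp ψ hlam] at h
  refine h.trans (le_of_eq ?_)
  ring

/-- The symbol m is singular, so it is replaced by the smooth compactly supported m φ, dilated by
lam. By homogeneity m itself is unchanged by the dilation, so the constant does not depend on lam.
-/
theorem commBound_of_cutoff {K : Set E} {m : E → ℂ} (hm : Measurable m) (hm1 : ∀ ξ, ‖m ξ‖ ≤ 1)
    (hhom : ∀ (r : ℝ) (ξ : E), 0 < r → m (r • ξ) = m ξ) {φ : E → ℂ} (hφ : ContDiff ℝ ∞ φ)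
    (hφc : HasCompactSupport φ) (hφK : ∀ ξ ∈ K, φ ξ = 1)
    (hmφ : ContDiff ℝ ∞ fun ξ => m ξ * φ ξ) :
    CommBound K m ((∫ y, ‖y‖ * ‖𝓕⁻ (fun ξ => m ξ * φ ξ) y‖) + ∫ y, ‖y‖ * ‖𝓕⁻ φ y‖) where
  measurable := hm
  norm_le := hm1
  nonneg := add_nonneg (integral_nonneg fun y => by positivity)
    (integral_nonneg fun y => by positivity)
  comm lam hlam g B L hB hL h hh := by
    have hdil : ∀ ξ, dil m ξ = m ξ := fun ξ => hhom _ _ (by positivity)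
    have hmφc : HasCompactSupport fun ξ => m ξ * φ ξ := hφc.mul_left
    have t0 : MemLp (dil m) ⊤ volume := memLp_top_of_le (measurable_dil hm) fun _ => hm1 _
    have t1 : MemLp (fun ξ => φ (lam⁻¹ • ξ)) ⊤ volume :=
      memLp_top_of_compact (hφ.comp (contDiff_const_smul _))
        (hφc.comp_smul (inv_ne_zero hlam.ne'))
    have t2 : MemLp (fun ξ => m (lam⁻¹ • ξ) * φ (lam⁻¹ • ξ)) ⊤ volume :=
      memLp_top_of_compact (hmφ.comp (contDiff_const_smul _))
        (hmφc.comp_smul (inv_ne_zero hlam.ne'))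
    have hcomp : ∀ f : L2, fmul (fun ξ => m (lam⁻¹ • ξ) * φ (lam⁻¹ • ξ)) f
        = multCLM m (fmul (fun ξ => φ (lam⁻¹ • ξ)) f) := by
      intro f
      rw [fmul, multCLM_apply, fmul, FourierTransform.fourier_fourierInv_eq]
      congr 1
      refine Lp.ext ?_
      filter_upwards [mulL_ae t2 (𝓕 f), mulL_ae t0 (mulL (fun ξ => φ (lam⁻¹ • ξ)) (𝓕 f)),
        mulL_ae t1 (𝓕 f)] with ξ h1 h2 h3
      rw [h1, h2, h3, hdil, hhom _ _ (inv_pos.2 hlam)]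
      ring
    have hφh : fmul (fun ξ => φ (lam⁻¹ • ξ)) h = h := by
      have e0 : mulL (fun ξ => φ (lam⁻¹ • ξ)) (𝓕 h) = 𝓕 h := by
        refine Lp.ext ?_
        filter_upwards [mulL_ae t1 (𝓕 h), hh] with ξ h1 h2
        rw [h1]
        by_cases h3 : (𝓕 h : L2) ξ = 0
        · rw [h3, mul_zero]
        · rw [hφK _ (h2 h3), one_mul]
      rw [fmul, e0]
      exact FourierTransform.fourierInv_fourier_eq h
    set A := fmul (fun ξ => m (lam⁻¹ • ξ) * φ (lam⁻¹ • ξ))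
    set Φ := fmul (fun ξ => φ (lam⁻¹ • ξ))
    -- Multiplication by g spoils the localization of h, so m and m φ differ on g h. The difference
    -- is m [φ, g] h, because φ(D/lam) h = h; it is again a commutator with a smooth cutoff.
    have e : multCLM m (mulL g h) - mulL g (multCLM m h)
        = (A (mulL g h) - mulL g (A h)) - multCLM m (Φ (mulL g h) - mulL g (Φ h)) := by
      rw [hcomp, hcomp, hφh, map_sub]
      abel
    rw [e]
    have b1 := norm_fmul_dilate_comm_le hmφ hmφc hlam hB hL h
    have b2 := norm_fmul_dilate_comm_le hφ hφc hlam hB hL h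
    have b3 := norm_multCLM_le hm hm1 (Φ (mulL g h) - mulL g (Φ h))
    calc _ ≤ _ := norm_sub_le _ _
      _ ≤ (∫ y, ‖y‖ * ‖𝓕⁻ (fun ξ => m ξ * φ ξ) y‖) * L / lam * ‖h‖
          + (∫ y, ‖y‖ * ‖𝓕⁻ φ y‖) * L / lam * ‖h‖ := by linarith
      _ = _ := by ring

end

section

/-! ### The homogeneous multipliers -/

/-- `|ξ'|²`. -/
def rho (ξ : E) : ℝ := ξ 1 ^ 2 + ξ 2 ^ 2

/-- Frequencies with `|ξ'|² ∈ [r, R]` and `ξ₀² ≤ R`. -/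
def annulus (r R : ℝ) : Set E := {ξ | r ≤ rho ξ ∧ rho ξ ≤ R ∧ ξ 0 ^ 2 ≤ R}

theorem contDiff_rho : ContDiff ℝ ∞ rho := by unfold rho; fun_prop

theorem rho_nonneg (ξ : E) : 0 ≤ rho ξ := by unfold rho; positivity

theorem spatialNorm_sq (ξ : E) : spatialNorm ξ ^ 2 = rho ξ := Real.sq_sqrt (rho_nonneg ξ)

theorem spatialNorm_nonneg (ξ : E) : 0 ≤ spatialNorm ξ := Real.sqrt_nonneg _

theorem rho_smul (r : ℝ) (ξ : E) : rho (r • ξ) = r ^ 2 * rho ξ := by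
  simp [rho]; ring

theorem spatialNorm_smul (r : ℝ) (hr : 0 ≤ r) (ξ : E) :
    spatialNorm (r • ξ) = r * spatialNorm ξ := by
  change Real.sqrt (rho (r • ξ)) = r * Real.sqrt (rho ξ)
  rw [rho_smul, Real.sqrt_mul (sq_nonneg r), Real.sqrt_sq hr]

theorem continuous_spatialNorm : Continuous spatialNorm := by unfold spatialNorm; fun_prop

theorem norm_sq_eq (ξ : E) : ‖ξ‖ ^ 2 = ξ 0 ^ 2 + rho ξ := by
  rw [EuclideanSpace.norm_sq_eq, Fin.sum_univ_three]
  simp [rho]; ring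

theorem exists_cutoff {r R : ℝ} (hr : 0 < r) (hR : r < R) :
    ∃ φ : E → ℝ, ContDiff ℝ ∞ φ ∧ HasCompactSupport φ ∧ (∀ ξ ∈ annulus r R, φ ξ = 1) ∧
      ∀ ξ, rho ξ ≤ r / 4 → φ ξ = 0 := by
  -- As a function of |ξ'|², η equals 1 on [r, R] and vanishes below r/2, hence away from the
  -- singular set ξ' = 0.
  let η : ContDiffBump ((r + R) / 2 : ℝ) := ⟨(R - r) / 2, (R - r) / 2 + r / 2, by linarith,
    by linarith⟩
  let η₀ : ContDiffBump (0 : ℝ) := ⟨R, R + 1, by linarith, by linarith⟩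
  refine ⟨fun ξ => η (rho ξ) * η₀ (ξ 0 ^ 2), ?_, ?_, ?_, ?_⟩
  · exact (η.contDiff.comp contDiff_rho).mul (η₀.contDiff.comp (by fun_prop))
  · refine HasCompactSupport.intro (isCompact_closedBall (0 : E) (2 * R + r + 2)) fun ξ hξ => ?_
    by_contra hne
    have h1 : rho ξ ∈ Function.support η := left_ne_zero_of_mul hne
    have h2 : ξ 0 ^ 2 ∈ Function.support η₀ := right_ne_zero_of_mul hne
    rw [η.support_eq, Metric.mem_ball, Real.dist_eq, abs_lt] at h1
    rw [η₀.support_eq, Metric.mem_ball, Real.dist_eq, abs_lt] at h2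
    simp only [η, η₀] at h1 h2
    apply hξ
    rw [mem_closedBall_zero_iff]
    refine abs_le_of_sq_le_sq' ?_ (by linarith) |>.2
    rw [norm_sq_eq]
    nlinarith [h1.2, h2.2]
  · rintro ξ ⟨h1, h2, h3⟩
    have e1 : η (rho ξ) = 1 := η.one_of_mem_closedBall (by
      rw [Metric.mem_closedBall, Real.dist_eq, abs_le]
      simp only [η]; constructor <;> linarith)
    have e2 : η₀ (ξ 0 ^ 2) = 1 := η₀.one_of_mem_closedBall (by
      rw [Metric.mem_closedBall, Real.dist_eq, abs_le]
      simp only [η₀]; constructor <;> nlinarith [sq_nonneg (ξ 0)])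
    simp [e1, e2]
  · intro ξ hξ
    have e1 : η (rho ξ) = 0 := by
      rw [← Function.notMem_support, η.support_eq, Metric.mem_ball, Real.dist_eq, abs_lt]
      simp only [η]
      rintro ⟨h, -⟩
      linarith
    simp [e1]

/-- A bounded function, homogeneous of degree zero and smooth away from `ξ' = 0`. -/
structure IsHomogeneousSymbol (m : E → ℂ) : Prop where
  measurable : Measurable m
  norm_le : ∀ ξ, ‖m ξ‖ ≤ 1
  hom : ∀ (r : ℝ) (ξ : E), 0 < r → m (r • ξ) = m ξ
  smooth : ∀ ξ, rho ξ ≠ 0 → ContDiffAt ℝ ∞ m ξ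

/-- The cutoff vanishes near ξ' = 0, the only place where m may fail to be smooth, so their product
is smooth everywhere. -/
theorem IsHomogeneousSymbol.exists_commBound {m : E → ℂ} (hm : IsHomogeneousSymbol m) {r R : ℝ}
    (hr : 0 < r) (hR : r < R) : ∃ M, CommBound (annulus r R) m M := by
  obtain ⟨φ, h1, h2, h3, h4⟩ := exists_cutoff hr hR
  have h1' : ContDiff ℝ ∞ fun ξ => (φ ξ : ℂ) := Complex.ofRealCLM.contDiff.comp h1
  refine ⟨_, commBound_of_cutoff hm.measurable hm.norm_le hm.hom h1'
    (h2.comp_left Complex.ofReal_zero) (fun ξ hξ => by simp [h3 ξ hξ]) ?_⟩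
  rw [contDiff_iff_contDiffAt]
  intro ξ
  by_cases hξ : rho ξ = 0
  · have : (fun ξ => m ξ * (φ ξ : ℂ)) =ᶠ[nhds ξ] fun _ => 0 := by
      have : ∀ᶠ ζ in nhds ξ, rho ζ < r / 4 :=
        contDiff_rho.continuous.continuousAt.eventually_lt_const (by rw [hξ]; linarith)
      filter_upwards [this] with ζ hζ
      simp [h4 ζ hζ.le]
    exact contDiffAt_const.congr_of_eventuallyEq this
  · exact (hm.smooth ξ hξ).mul h1'.contDiffAt

/-- `cos 2θ`, where `θ` is the direction of `ξ'`. -/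
def cosD (ξ : E) : ℝ := (ξ 1 ^ 2 - ξ 2 ^ 2) / rho ξ

/-- `sin 2θ`, where `θ` is the direction of `ξ'`. -/
def sinD (ξ : E) : ℝ := 2 * ξ 1 * ξ 2 / rho ξ

/-- `exp (2 i θ)`, where `θ` is the direction of `ξ'`. -/
def zD (ξ : E) : ℂ := cosD ξ + sinD ξ * Complex.I

/-- The symbol `i ξₖ / |ξ'|`. -/
def riesz (k : Fin 3) (ξ : E) : ℂ := Complex.I * (ξ k / spatialNorm ξ : ℝ)

/-- Only an inequality: at ξ' = 0 the divisions return 0 and the left side vanishes. -/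
theorem cosD_sq_add_sinD_sq_le (ξ : E) : cosD ξ ^ 2 + sinD ξ ^ 2 ≤ 1 := by
  rcases eq_or_ne (rho ξ) 0 with h | h
  · simp [cosD, sinD, h]
  · have : cosD ξ ^ 2 + sinD ξ ^ 2 = 1 := by
      rw [cosD, sinD, div_pow, div_pow, ← add_div, div_eq_one_iff_eq (pow_ne_zero 2 h)]
      unfold rho; ring
    exact this.le

theorem contDiffAt_rho_div {f : E → ℝ} (hf : ContDiff ℝ ∞ f) {ξ : E} (h : rho ξ ≠ 0) :
    ContDiffAt ℝ ∞ (fun ξ => f ξ / rho ξ) ξ :=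
  hf.contDiffAt.div contDiff_rho.contDiffAt h

theorem contDiffAt_cosD {ξ : E} (h : rho ξ ≠ 0) : ContDiffAt ℝ ∞ cosD ξ :=
  contDiffAt_rho_div (f := fun ξ : E => ξ 1 ^ 2 - ξ 2 ^ 2) (by fun_prop) h

theorem contDiffAt_sinD {ξ : E} (h : rho ξ ≠ 0) : ContDiffAt ℝ ∞ sinD ξ :=
  contDiffAt_rho_div (f := fun ξ : E => 2 * ξ 1 * ξ 2) (by fun_prop) h

theorem measurable_rho : Measurable rho := contDiff_rho.continuous.measurable

theorem measurable_cosD : Measurable cosD :=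
  (by fun_prop : Measurable fun ξ : E => ξ 1 ^ 2 - ξ 2 ^ 2).div measurable_rho

theorem measurable_sinD : Measurable sinD :=
  (by fun_prop : Measurable fun ξ : E => 2 * ξ 1 * ξ 2).div measurable_rho

theorem cosD_smul (r : ℝ) (ξ : E) (hr : 0 < r) : cosD (r • ξ) = cosD ξ := by
  simp only [cosD, rho_smul, PiLp.smul_apply, smul_eq_mul, mul_pow, ← mul_sub]
  rw [mul_div_mul_left _ _ (by positivity)]

theorem sinD_smul (r : ℝ) (ξ : E) (hr : 0 < r) : sinD (r • ξ) = sinD ξ := by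
  simp only [sinD, rho_smul, PiLp.smul_apply, smul_eq_mul]
  rw [show 2 * (r * ξ 1) * (r * ξ 2) = r ^ 2 * (2 * ξ 1 * ξ 2) by ring,
    mul_div_mul_left _ _ (by positivity)]

theorem normSq_zD (ξ : E) : ‖zD ξ‖ ^ 2 = cosD ξ ^ 2 + sinD ξ ^ 2 := by
  rw [← Complex.normSq_eq_norm_sq, zD, Complex.normSq_add_mul_I]

theorem isHomogeneousSymbol_zD : IsHomogeneousSymbol zD where
  measurable := (Complex.measurable_ofReal.comp measurable_cosD).add
    ((Complex.measurable_ofReal.comp measurable_sinD).mul_const _)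
  norm_le ξ := by
    have := normSq_zD ξ
    have := cosD_sq_add_sinD_sq_le ξ
    nlinarith [norm_nonneg (zD ξ)]
  hom r ξ hr := by simp only [zD, cosD_smul r ξ hr, sinD_smul r ξ hr]
  smooth ξ h := (Complex.ofRealCLM.contDiff.contDiffAt.comp ξ (contDiffAt_cosD h)).add
    ((Complex.ofRealCLM.contDiff.contDiffAt.comp ξ (contDiffAt_sinD h)).mul contDiffAt_const)

theorem IsHomogeneousSymbol.conj {m : E → ℂ} (hm : IsHomogeneousSymbol m) :
    IsHomogeneousSymbol fun ξ => (starRingEnd ℂ) (m ξ) where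
  measurable := Complex.continuous_conj.measurable.comp hm.measurable
  norm_le ξ := by rw [RCLike.norm_conj]; exact hm.norm_le ξ
  hom r ξ hr := by rw [hm.hom r ξ hr]
  smooth ξ h := Complex.conjCLE.contDiff.contDiffAt.comp ξ (hm.smooth ξ h)

theorem isHomogeneousSymbol_one : IsHomogeneousSymbol fun _ => 1 where
  measurable := measurable_const
  norm_le ξ := by simp
  hom r ξ hr := rfl
  smooth ξ h := contDiffAt_const

theorem isHomogeneousSymbol_cosD : IsHomogeneousSymbol fun ξ => (cosD ξ : ℂ) where
  measurable := Complex.measurable_ofReal.comp measurable_cosD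
  norm_le ξ := by
    rw [Complex.norm_real, Real.norm_eq_abs]
    exact abs_le_one_iff_mul_self_le_one.2 (by nlinarith [cosD_sq_add_sinD_sq_le ξ])
  hom r ξ hr := by rw [cosD_smul r ξ hr]
  smooth ξ h := Complex.ofRealCLM.contDiff.contDiffAt.comp ξ (contDiffAt_cosD h)

theorem isHomogeneousSymbol_sinD : IsHomogeneousSymbol fun ξ => (sinD ξ : ℂ) where
  measurable := Complex.measurable_ofReal.comp measurable_sinD
  norm_le ξ := by
    rw [Complex.norm_real, Real.norm_eq_abs]
    exact abs_le_one_iff_mul_self_le_one.2 (by nlinarith [cosD_sq_add_sinD_sq_le ξ])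
  hom r ξ hr := by rw [sinD_smul r ξ hr]
  smooth ξ h := Complex.ofRealCLM.contDiff.contDiffAt.comp ξ (contDiffAt_sinD h)

theorem abs_le_spatialNorm (k : Fin 3) (hk : k ≠ 0) (ξ : E) : |ξ k| ≤ spatialNorm ξ := by
  refine Real.abs_le_sqrt ?_
  fin_cases k
  · exact absurd rfl hk
  · simp; positivity
  · simp; positivity

theorem isHomogeneousSymbol_riesz (k : Fin 3) (hk : k ≠ 0) : IsHomogeneousSymbol (riesz k) where
  measurable := by
    have := continuous_spatialNorm.measurable
    unfold riesz; fun_prop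
  norm_le ξ := by
    rw [riesz, norm_mul, Complex.norm_I, one_mul, Complex.norm_real, Real.norm_eq_abs, abs_div,
      abs_of_nonneg (spatialNorm_nonneg ξ)]
    exact div_le_one_of_le₀ (abs_le_spatialNorm k hk ξ) (spatialNorm_nonneg ξ)
  hom r ξ hr := by
    simp only [riesz, spatialNorm_smul r hr.le, PiLp.smul_apply, smul_eq_mul]
    rw [mul_div_mul_left _ _ hr.ne']
  smooth ξ h := by
    have h1 : ContDiffAt ℝ ∞ spatialNorm ξ := contDiff_rho.contDiffAt.sqrt h
    have h2 : spatialNorm ξ ≠ 0 := fun h0 => h (by rw [← spatialNorm_sq, h0]; simp)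
    have h3 : ContDiffAt ℝ ∞ (fun ζ : E => ζ k / spatialNorm ζ) ξ :=
      (by fun_prop : ContDiff ℝ ∞ fun ζ : E => ζ k).contDiffAt.div h1 h2
    exact contDiffAt_const.mul (Complex.ofRealCLM.contDiff.contDiffAt.comp ξ h3)

end

section

/-! ### The inverse square root of an elliptic quadratic form as a tensor symbol -/

theorem hasSum_binomial_inv_sqrt {y : ℝ} (hy : |y| < 1) :
    HasSum (fun n => Ring.choose (-1 / 2 : ℝ) n * y ^ n) (Real.sqrt (1 + y))⁻¹ := by
  have h := (Real.one_add_rpow_hasFPowerSeriesOnBall_zero (a := -1 / 2)).hasSum (y := y)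
    (by simpa [Metric.mem_eball, edist_zero_right, ← ofReal_norm, ENNReal.ofReal_lt_one] using hy)
  have e : (1 + (0 + y)) ^ (-1 / 2 : ℝ) = (Real.sqrt (1 + y))⁻¹ := by
    rw [zero_add, Real.sqrt_eq_rpow, ← Real.rpow_neg (by linarith [neg_abs_le y])]
    norm_num
  rw [e] at h
  simp only [binomialSeries_apply, List.ofFn_const, List.prod_replicate, smul_eq_mul] at h
  exact h

/-- The second series is the termwise derivative; it controls the constants in which a derivative
falls on one of n factors. Both are dominated through a geometric rate a < 1 supplied by the radius
of convergence. -/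
theorem summable_binomial {r : ℝ} (h0 : 0 < r) (h1 : r < 1) :
    Summable (fun n : ℕ => |Ring.choose (-1 / 2 : ℝ) n| * r ^ n) ∧
      Summable (fun n : ℕ => |Ring.choose (-1 / 2 : ℝ) n| * (n * r ^ (n - 1))) := by
  lift r to NNReal using h0.le
  have hr : (r : ENNReal) < (binomialSeries ℝ (-1 / 2 : ℝ)).radius :=
    lt_of_lt_of_le (by exact_mod_cast h1) binomialSeries_radius_ge_one
  obtain ⟨a, ha, C, hC, h⟩ := (binomialSeries ℝ (-1 / 2 : ℝ)).norm_mul_pow_le_mul_pow_of_lt_radius hr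
  have hn : ∀ n, ‖binomialSeries ℝ (-1 / 2 : ℝ) n‖ = |Ring.choose (-1 / 2 : ℝ) n| := fun n => by
    rw [binomialSeries, FormalMultilinearSeries.ofScalars_norm, Real.norm_eq_abs]
  simp only [hn] at h
  constructor
  · exact Summable.of_nonneg_of_le (fun n => by positivity) h
      ((summable_geometric_of_lt_one ha.1.le ha.2).mul_left C)
  · have hs := (summable_pow_mul_geometric_of_norm_lt_one 1 (r := a)
      (by rw [Real.norm_of_nonneg ha.1.le]; exact ha.2)).mul_left (C / r)
    refine Summable.of_nonneg_of_le (fun n => by positivity) (fun n => ?_) hs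
    rcases n with _ | n
    · simp
    · have := h (n + 1)
      have e : |Ring.choose (-1 / 2 : ℝ) (n + 1)| * (((n + 1 : ℕ) : ℝ) * r ^ (n + 1 - 1))
          = ((n + 1 : ℕ) : ℝ) / r * (|Ring.choose (-1 / 2 : ℝ) (n + 1)| * r ^ (n + 1)) := by
        rw [Nat.add_sub_cancel]; field_simp; rw [mul_assoc, ← pow_succ]
      rw [e]
      calc _ ≤ ((n + 1 : ℕ) : ℝ) / r * (C * a ^ (n + 1)) := by gcongr
        _ = _ := by ring

theorem mulL_one (f : L2) : mulL (fun _ => 1) f = f :=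
  Lp.ext ((mulL_ae (memLp_top_const 1) f).trans (by simp))

theorem multCLM_one (f : L2) : multCLM (fun _ => 1) f = f := by
  have : dil (fun _ => 1) = fun _ => 1 := rfl
  rw [multCLM_apply, this, mulL_one]
  exact FourierTransform.fourierInv_fourier_eq f

theorem commBound_one (K : Set E) : CommBound K (fun _ => 1) 0 where
  measurable := measurable_const
  norm_le ξ := by simp
  nonneg := le_rfl
  comm lam _ g B L _ _ h _ := by simp [multCLM_one]

theorem TensorBound.coeff {K : Set E} {c : E → ℂ} {A L : ℝ} (hA : ∀ x, ‖c x‖ ≤ A)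
    (hL : ∀ x y, ‖c x - c y‖ ≤ L * ‖x - y‖) : TensorBound K (fun x _ => c x) A L := by
  have h := TensorBound.single hA hL (commBound_one K)
  simpa using h

theorem TensorBound.multiplier {K : Set E} {m : E → ℂ} {M : ℝ} (hm : CommBound K m M) :
    TensorBound K (fun _ ξ => m ξ) 1 M := by
  have h := TensorBound.single (c := fun _ => 1) (A := 1) (L := 0) (by simp) (by simp) hm
  simpa using h

/-- The derivative constant has only the additional linear factor n, so it stays summable in a power
series with C inside the disc of convergence. -/
theorem TensorBound.pow {K : Set E} {b : E → E → ℂ} {C C' : ℝ} (h : TensorBound K b C C')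
    (n : ℕ) : TensorBound K (fun x ξ => b x ξ ^ n) (C ^ n) (n * C ^ (n - 1) * C') := by
  induction n with
  | zero =>
    simp only [pow_zero]
    refine (TensorBound.coeff (c := fun _ => 1) (A := 1) (L := 0) (by simp) (by simp)).mono
      le_rfl (by simp)
  | succ n ih =>
    have := ih.mul h
    simp only [← pow_succ] at this
    refine this.mono le_rfl (le_of_eq ?_)
    rcases n with _ | n
    · simp
    · simp only [Nat.add_sub_cancel, pow_succ]; push_cast; ring

/-- Quantitative ellipticity, bounds and Lipschitz bounds of a symmetric coefficient matrix. -/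
structure Admissible (μ A L : ℝ) (e : E → Matrix (Fin 2) (Fin 2) ℝ) : Prop where
  symm : ∀ x, e x 0 1 = e x 1 0
  abs_le : ∀ x i j, |e x i j| ≤ A
  lip : ∀ x y i j, |e x i j - e y i j| ≤ L * ‖x - y‖
  elliptic : ∀ x (s t : ℝ), μ * (s ^ 2 + t ^ 2)
    ≤ e x 0 0 * s ^ 2 + 2 * e x 0 1 * s * t + e x 1 1 * t ^ 2

/-- Half the trace. -/
def cf0 (e : E → Matrix (Fin 2) (Fin 2) ℝ) (x : E) : ℝ := (e x 0 0 + e x 1 1) / 2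

/-- The coefficient of `cos 2θ`. -/
def cf1 (e : E → Matrix (Fin 2) (Fin 2) ℝ) (x : E) : ℝ := (e x 1 1 - e x 0 0) / 2

/-- The coefficient of `sin 2θ`. -/
def cf2 (e : E → Matrix (Fin 2) (Fin 2) ℝ) (x : E) : ℝ := -e x 0 1

/-- The quadratic form `‖ξ'‖_{ε̃(x)}² / |ξ'|²`. -/
def quad (e : E → Matrix (Fin 2) (Fin 2) ℝ) (x ξ : E) : ℝ :=
  cf0 e x + cf1 e x * cosD ξ + cf2 e x * sinD ξ

/-- The symbol `|ξ'| / ‖ξ'‖_{ε̃(x)}`. -/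
def invRoot (e : E → Matrix (Fin 2) (Fin 2) ℝ) (x ξ : E) : ℝ := (Real.sqrt (quad e x ξ))⁻¹

variable {μ A L : ℝ} {e : E → Matrix (Fin 2) (Fin 2) ℝ}

/-! ### Bounds and ellipticity of the normalized quadratic form -/

namespace Admissible

theorem abs_cf0_le (h : Admissible μ A L e) (x : E) : |cf0 e x| ≤ A := by
  have h1 := _root_.abs_le.1 (h.abs_le x 0 0)
  have h2 := _root_.abs_le.1 (h.abs_le x 1 1)
  rw [cf0, _root_.abs_le]; constructor <;> linarith

theorem abs_cf1_le (h : Admissible μ A L e) (x : E) : |cf1 e x| ≤ A := by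
  have h1 := _root_.abs_le.1 (h.abs_le x 0 0)
  have h2 := _root_.abs_le.1 (h.abs_le x 1 1)
  rw [cf1, _root_.abs_le]; constructor <;> linarith

theorem abs_cf2_le (h : Admissible μ A L e) (x : E) : |cf2 e x| ≤ A := by
  rw [cf2, abs_neg]; exact h.abs_le x 0 1

theorem lip_cf0 (h : Admissible μ A L e) (x y : E) : |cf0 e x - cf0 e y| ≤ L * ‖x - y‖ := by
  have h1 := _root_.abs_le.1 (h.lip x y 0 0)
  have h2 := _root_.abs_le.1 (h.lip x y 1 1)
  rw [cf0, cf0, _root_.abs_le]; constructor <;> linarith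

theorem lip_cf1 (h : Admissible μ A L e) (x y : E) : |cf1 e x - cf1 e y| ≤ L * ‖x - y‖ := by
  have h1 := _root_.abs_le.1 (h.lip x y 0 0)
  have h2 := _root_.abs_le.1 (h.lip x y 1 1)
  rw [cf1, cf1, _root_.abs_le]; constructor <;> linarith

theorem lip_cf2 (h : Admissible μ A L e) (x y : E) : |cf2 e x - cf2 e y| ≤ L * ‖x - y‖ := by
  have h1 := _root_.abs_le.1 (h.lip x y 0 1)
  rw [cf2, cf2, _root_.abs_le]; constructor <;> linarith

theorem le_cf0 (h : Admissible μ A L e) (x : E) : μ ≤ cf0 e x := by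
  have h1 := h.elliptic x 1 0
  have h2 := h.elliptic x 0 1
  rw [cf0]; linarith

/-- Ellipticity says that e - μ is positive semidefinite, so its determinant is nonnegative; this is
that inequality in the variables half trace, half difference and off-diagonal entry. -/
theorem disc (h : Admissible μ A L e) (x : E) :
    cf1 e x ^ 2 + cf2 e x ^ 2 ≤ (cf0 e x - μ) ^ 2 := by
  have hd : discrim (e x 0 0 - μ) (2 * e x 0 1) (e x 1 1 - μ) ≤ 0 := by
    refine discrim_le_zero fun s => ?_
    have := h.elliptic x s 1
    nlinarith
  rw [discrim] at hd
  simp only [cf0, cf1, cf2]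
  nlinarith

/-- By Cauchy–Schwarz the oscillating part is at most (cf1² + cf2²)^{1/2} ≤ cf0 - μ. The argument
also covers ξ' = 0, where `cosD` and `sinD` vanish. -/
theorem le_quad (h : Admissible μ A L e) (x ξ : E) : μ ≤ quad e x ξ := by
  have h1 := h.disc x
  have h2 := cosD_sq_add_sinD_sq_le ξ
  have h3 := h.le_cf0 x
  have h4 : (cf1 e x * cosD ξ + cf2 e x * sinD ξ) ^ 2 ≤ (cf0 e x - μ) ^ 2 := by
    have h5 : (cf1 e x * cosD ξ + cf2 e x * sinD ξ) ^ 2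
        ≤ (cf1 e x ^ 2 + cf2 e x ^ 2) * (cosD ξ ^ 2 + sinD ξ ^ 2) := by
      nlinarith [sq_nonneg (cf1 e x * sinD ξ - cf2 e x * cosD ξ)]
    have h6 : 0 ≤ cf1 e x ^ 2 + cf2 e x ^ 2 := by positivity
    calc _ ≤ _ := h5
      _ ≤ (cf1 e x ^ 2 + cf2 e x ^ 2) * 1 := by gcongr
      _ ≤ _ := by linarith
  have h7 := (abs_le_of_sq_le_sq' h4 (by linarith)).1
  rw [quad]; linarith

theorem le_bound (h : Admissible μ A L e) : μ ≤ A :=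
  (h.le_cf0 0).trans ((le_abs_self _).trans (h.abs_cf0_le 0))

theorem lip_nonneg (h : Admissible μ A L e) : 0 ≤ L :=
  lipschitz_nonneg (g := fun x => ((cf0 e x : ℝ) : ℂ)) fun x y => by
    rw [← Complex.ofReal_sub, Complex.norm_real]; exact h.lip_cf0 x y

end Admissible

/-- The coefficient of `exp (2 i θ)` in the normalised quadratic form. -/
def cfz (e : E → Matrix (Fin 2) (Fin 2) ℝ) (x : E) : ℂ :=
  (cf1 e x - cf2 e x * Complex.I) / (2 * cf0 e x)

/-- From a cos 2θ + b sin 2θ = Re((a - ib) e^{2iθ}). The perturbation of 1 becomes a sum of two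
products of a coefficient and a homogeneous multiplier. -/
theorem quad_eq (hμ : 0 < μ) (h : Admissible μ A L e) (x ξ : E) :
    (quad e x ξ : ℂ) = cf0 e x *
      (1 + (cfz e x * zD ξ + (starRingEnd ℂ) (cfz e x) * (starRingEnd ℂ) (zD ξ))) := by
  have h0 : (cf0 e x : ℂ) ≠ 0 := by exact_mod_cast (hμ.trans_le (h.le_cf0 x)).ne'
  simp only [cfz, zD, quad, map_div₀, map_sub, map_add, map_mul, Complex.conj_ofReal,
    Complex.conj_I, map_ofNat]
  push_cast
  field_simp
  linear_combination (2 * (cf2 e x : ℂ) * sinD ξ) * Complex.I_sq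

/-- By `disc` the norm is at most (1 - μ/cf0)/2, and cf0 ≤ A. The gap μ/A below 1/2 is what makes
the binomial series converge at a rate uniform in x and in the coefficients. -/
theorem norm_cfz_le (hμ : 0 < μ) (h : Admissible μ A L e) (x : E) :
    ‖cfz e x‖ ≤ (1 - μ / A) / 2 := by
  have h0 := hμ.trans_le (h.le_cf0 x)
  have h1 : ‖(cf1 e x - cf2 e x * Complex.I : ℂ)‖ ≤ cf0 e x - μ := by
    refine abs_le_of_sq_le_sq' ?_ (by linarith [h.le_cf0 x]) |>.2
    rw [← Complex.normSq_eq_norm_sq, sub_eq_add_neg, ← neg_mul, ← Complex.ofReal_neg,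
      Complex.normSq_add_mul_I, neg_sq]
    exact h.disc x
  have h2 : ‖(2 * cf0 e x : ℂ)‖ = 2 * cf0 e x := by
    rw [norm_mul, Complex.norm_real, Real.norm_of_nonneg h0.le]; norm_num
  rw [cfz, norm_div, h2, div_le_div_iff₀ (by positivity) (by norm_num)]
  have h3 : μ / A * cf0 e x ≤ μ := by
    rw [div_mul_eq_mul_div, div_le_iff₀ (hμ.trans_le h.le_bound)]
    exact mul_le_mul_of_nonneg_left ((le_abs_self _).trans (h.abs_cf0_le x)) hμ.le
  nlinarith

theorem lip_cfz (hμ : 0 < μ) (h : Admissible μ A L e) (x y : E) :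
    ‖cfz e x - cfz e y‖ ≤ (L / μ + A * L / μ ^ 2) * ‖x - y‖ := by
  have hx := hμ.trans_le (h.le_cf0 x)
  have hy := hμ.trans_le (h.le_cf0 y)
  set N : E → ℂ := fun x => cf1 e x - cf2 e x * Complex.I
  have hxc : (cf0 e x : ℂ) ≠ 0 := by exact_mod_cast hx.ne'
  have hyc : (cf0 e y : ℂ) ≠ 0 := by exact_mod_cast hy.ne'
  have e1 : cfz e x - cfz e y = (N x - N y) / (2 * cf0 e x)
      + N y * (((cf0 e y - cf0 e x : ℝ)) : ℂ) / (2 * cf0 e x * cf0 e y) := by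
    simp only [cfz, N]; push_cast; field_simp; ring
  have n1 : ‖N x - N y‖ ≤ 2 * (L * ‖x - y‖) := by
    have : N x - N y = ((cf1 e x - cf1 e y : ℝ) : ℂ) - ((cf2 e x - cf2 e y : ℝ) : ℂ) * Complex.I := by
      simp only [N]; push_cast; ring
    rw [this]
    refine (norm_sub_le _ _).trans ?_
    rw [norm_mul, Complex.norm_I, Complex.norm_real, Complex.norm_real, Real.norm_eq_abs,
      Real.norm_eq_abs]
    linarith [h.lip_cf1 x y, h.lip_cf2 x y]
  have n2 : ‖N y‖ ≤ 2 * A := by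
    refine (norm_sub_le _ _).trans ?_
    rw [norm_mul, Complex.norm_I, Complex.norm_real, Complex.norm_real, Real.norm_eq_abs,
      Real.norm_eq_abs]
    linarith [h.abs_cf1_le y, h.abs_cf2_le y]
  have hA : 0 ≤ A := hμ.le.trans h.le_bound
  have hL : 0 ≤ L * ‖x - y‖ := mul_nonneg h.lip_nonneg (norm_nonneg _)
  rw [e1]
  refine (norm_add_le _ _).trans ?_
  rw [norm_div, norm_div, norm_mul (N y), norm_mul, norm_mul, norm_mul]
  simp only [Complex.norm_real, Real.norm_of_nonneg hx.le, Real.norm_of_nonneg hy.le,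
    Complex.norm_ofNat]
  have b1 : ‖N x - N y‖ / (2 * cf0 e x) ≤ 2 * (L * ‖x - y‖) / (2 * μ) := by
    gcongr; exact h.le_cf0 x
  have b2 : ‖N y‖ * ‖cf0 e y - cf0 e x‖ / (2 * cf0 e x * cf0 e y)
      ≤ 2 * A * (L * ‖x - y‖) / (2 * μ * μ) := by
    have := h.lip_cf0 y x
    rw [norm_sub_rev] at this
    gcongr
    · exact this
    · exact h.le_cf0 x
    · exact h.le_cf0 y
  refine (add_le_add b1 b2).trans (le_of_eq ?_)
  field_simp

theorem lip_inv_sqrt_cf0 (hμ : 0 < μ) (h : Admissible μ A L e) (x y : E) :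
    |(Real.sqrt (cf0 e x))⁻¹ - (Real.sqrt (cf0 e y))⁻¹|
      ≤ L / (2 * μ * Real.sqrt μ) * ‖x - y‖ := by
  have hx := hμ.trans_le (h.le_cf0 x)
  have hy := hμ.trans_le (h.le_cf0 y)
  set a := Real.sqrt (cf0 e x)
  set b := Real.sqrt (cf0 e y)
  set s := Real.sqrt μ
  have hs : 0 < s := Real.sqrt_pos.2 hμ
  have ha : s ≤ a := Real.sqrt_le_sqrt (h.le_cf0 x)
  have hb : s ≤ b := Real.sqrt_le_sqrt (h.le_cf0 y)
  have ha2 : a ^ 2 = cf0 e x := Real.sq_sqrt hx.le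
  have hb2 : b ^ 2 = cf0 e y := Real.sq_sqrt hy.le
  have hs2 : s ^ 2 = μ := Real.sq_sqrt hμ.le
  have ha0 := hs.trans_le ha
  have hb0 := hs.trans_le hb
  have e1 : a⁻¹ - b⁻¹ = (cf0 e y - cf0 e x) / (a * b * (a + b)) := by
    rw [← ha2, ← hb2]; field_simp; ring
  have h1 := h.lip_cf0 y x
  rw [norm_sub_rev] at h1
  rw [e1, abs_div, abs_of_pos (by positivity : 0 < a * b * (a + b)), div_mul_eq_mul_div]
  have h2 : 2 * μ * s ≤ a * b * (a + b) := by
    calc 2 * μ * s = s * s * (s + s) := by rw [← hs2]; ring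
      _ ≤ _ := by gcongr
  gcongr
  exact mul_nonneg h.lip_nonneg (norm_nonneg _)

/-- The half trace is factored out, q = cf0 (1 + y) with |y| < 1, and (1 + y)^{-1/2} is expanded. -/
theorem invRoot_eq (hμ : 0 < μ) (h : Admissible μ A L e) (x ξ : E) :
    HasSum (fun n => ((Real.sqrt (cf0 e x))⁻¹ : ℂ) * (((Ring.choose (-1 / 2 : ℝ) n : ℝ) : ℂ) *
      (cfz e x * zD ξ + (starRingEnd ℂ) (cfz e x) * (starRingEnd ℂ) (zD ξ)) ^ n))
      (invRoot e x ξ : ℂ) := by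
  have h0 := hμ.trans_le (h.le_cf0 x)
  set y : ℝ := quad e x ξ / cf0 e x - 1
  have hy : (y : ℂ) = cfz e x * zD ξ + (starRingEnd ℂ) (cfz e x) * (starRingEnd ℂ) (zD ξ) := by
    simp only [y]; push_cast
    rw [quad_eq hμ h x ξ, mul_div_cancel_left₀ _ (by exact_mod_cast h0.ne')]; ring
  have hy1 : |y| < 1 := by
    have h1 : ‖(y : ℂ)‖ ≤ 1 - μ / A := by
      rw [hy]
      refine (norm_add_le _ _).trans ?_
      rw [norm_mul, norm_mul, RCLike.norm_conj, RCLike.norm_conj]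
      have h2 := norm_cfz_le hμ h x
      have h3 := isHomogeneousSymbol_zD.norm_le ξ
      have h4 : ‖cfz e x‖ * ‖zD ξ‖ ≤ ‖cfz e x‖ * 1 :=
        mul_le_mul_of_nonneg_left h3 (norm_nonneg _)
      linarith
    rw [Complex.norm_real, Real.norm_eq_abs] at h1
    have := div_pos hμ (hμ.trans_le h.le_bound)
    linarith
  have hs := (Complex.hasSum_ofReal.2 (hasSum_binomial_inv_sqrt hy1)).mul_left
    (((Real.sqrt (cf0 e x))⁻¹ : ℝ) : ℂ)
  have e1 : invRoot e x ξ = (Real.sqrt (cf0 e x))⁻¹ * (Real.sqrt (1 + y))⁻¹ := by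
    rw [invRoot, ← mul_inv, ← Real.sqrt_mul h0.le]
    congr 2
    simp only [y]; field_simp; ring
  rw [e1, ← hy]
  push_cast at hs ⊢
  exact hs

/-- The main structural fact: q^{-1/2} is a tensor symbol with constants depending only on μ, A, L
and the annulus. It comes from summing the binomial series with `TensorBound.pow` and
`TensorBound.tsum`. -/
theorem exists_tensorBound_invRoot {r R : ℝ} (hr : 0 < r) (hR : r < R) (hμ : 0 < μ) :
    ∃ C C' : ℝ, ∀ e, Admissible μ A L e →
      TensorBound (annulus r R) (fun x ξ => (invRoot e x ξ : ℂ)) C C' := by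
  -- If A < μ there are no admissible coefficients and any constants do.
  by_cases hA : μ ≤ A
  swap
  · exact ⟨0, 0, fun e he => absurd he.le_bound hA⟩
  obtain ⟨M, hM⟩ := isHomogeneousSymbol_zD.exists_commBound hr hR
  obtain ⟨M', hM'⟩ := isHomogeneousSymbol_zD.conj.exists_commBound hr hR
  have hA0 := hμ.trans_le hA
  -- Slightly larger than the natural rate 1 - μ/A, so that q stays positive even when μ = A.
  set q : ℝ := 1 - μ / (2 * A)
  have hq1 : q < 1 := by
    have : 0 < μ / (2 * A) := by positivity
    simp only [q]; linarith
  have hq0 : 0 < q := by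
    have : μ / (2 * A) < 1 := by rw [div_lt_one (by positivity)]; linarith
    simp only [q]; linarith
  obtain ⟨s1, s2⟩ := summable_binomial hq0 hq1
  set L₁ : ℝ := (L / μ + A * L / μ ^ 2 + q / 2 * M) + (L / μ + A * L / μ ^ 2 + q / 2 * M')
  set S1 := ∑' n : ℕ, |Ring.choose (-1 / 2 : ℝ) n| * q ^ n
  set S2 := ∑' n : ℕ, |Ring.choose (-1 / 2 : ℝ) n| * (n * q ^ (n - 1) * L₁)
  refine ⟨(Real.sqrt μ)⁻¹ * S1, L / (2 * μ * Real.sqrt μ) * S1 + (Real.sqrt μ)⁻¹ * S2,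
    fun e h => ?_⟩
  have hz : ∀ x, ‖cfz e x‖ ≤ q / 2 := fun x => (norm_cfz_le hμ h x).trans (by
    have : μ / (2 * A) ≤ μ / A := by gcongr; linarith
    simp only [q]; linarith)
  have t1 := TensorBound.single (K := annulus r R) hz (lip_cfz hμ h) hM
  have t2 := TensorBound.single (K := annulus r R) (c := fun x => (starRingEnd ℂ) (cfz e x))
    (A := q / 2) (L := L / μ + A * L / μ ^ 2)
    (fun x => by rw [RCLike.norm_conj]; exact hz x)
    (fun x y => by rw [← map_sub, RCLike.norm_conj]; exact lip_cfz hμ h x y) hM'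
  have t3 := t1.add t2
  rw [add_halves] at t3
  have t4 : ∀ n : ℕ, TensorBound (annulus r R)
      (fun x ξ => ((Ring.choose (-1 / 2 : ℝ) n : ℝ) : ℂ) * (cfz e x * zD ξ
        + (starRingEnd ℂ) (cfz e x) * (starRingEnd ℂ) (zD ξ)) ^ n)
      (|Ring.choose (-1 / 2 : ℝ) n| * q ^ n)
      (|Ring.choose (-1 / 2 : ℝ) n| * (n * q ^ (n - 1) * L₁)) := fun n => by
    have := (TensorBound.coeff (K := annulus r R)
      (c := fun _ => ((Ring.choose (-1 / 2 : ℝ) n : ℝ) : ℂ)) (A := |Ring.choose (-1 / 2 : ℝ) n|)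
      (L := 0) (fun x => by rw [Complex.norm_real, Real.norm_eq_abs]) (by simp)).mul (t3.pow n)
    simpa using this
  -- The factor cf0^{-1/2} is taken out of the series and multiplied back at the end as a single
  -- coefficient.
  have hsum : ∀ x ξ, HasSum (fun n => (((Ring.choose (-1 / 2 : ℝ) n : ℝ) : ℂ) *
      (cfz e x * zD ξ + (starRingEnd ℂ) (cfz e x) * (starRingEnd ℂ) (zD ξ)) ^ n))
      ((Real.sqrt (cf0 e x) : ℂ) * (invRoot e x ξ : ℂ)) := fun x ξ => by
    have h0 : ((Real.sqrt (cf0 e x) : ℝ) : ℂ) ≠ 0 := by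
      exact_mod_cast (Real.sqrt_pos.2 (hμ.trans_le (h.le_cf0 x))).ne'
    have := (invRoot_eq hμ h x ξ).mul_left ((Real.sqrt (cf0 e x) : ℝ) : ℂ)
    simpa only [mul_inv_cancel_left₀ h0] using this
  have s2' : Summable fun n : ℕ => |Ring.choose (-1 / 2 : ℝ) n| * (n * q ^ (n - 1) * L₁) := by
    simpa only [mul_assoc] using s2.mul_right L₁
  have t5 := TensorBound.tsum t4 s1 s2' hsum
  have t6 := TensorBound.coeff (K := annulus r R)
    (c := fun x => (((Real.sqrt (cf0 e x))⁻¹ : ℝ) : ℂ)) (A := (Real.sqrt μ)⁻¹)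
    (L := L / (2 * μ * Real.sqrt μ))
    (fun x => by
      rw [Complex.norm_real, Real.norm_of_nonneg (by positivity)]
      exact inv_anti₀ (Real.sqrt_pos.2 hμ) (Real.sqrt_le_sqrt (h.le_cf0 x)))
    (fun x y => by
      rw [← Complex.ofReal_sub, Complex.norm_real]; exact lip_inv_sqrt_cf0 hμ h x y)
  convert t6.mul t5 using 3 with x ξ
  have h0 : ((Real.sqrt (cf0 e x) : ℝ) : ℂ) ≠ 0 := by
    exact_mod_cast (Real.sqrt_pos.2 (hμ.trans_le (h.le_cf0 x))).ne'
  push_cast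
  rw [inv_mul_cancel_left₀ h0]

theorem exists_tensorBound_quad {r R : ℝ} (hr : 0 < r) (hR : r < R) :
    ∃ C C' : ℝ, ∀ e, Admissible μ A L e →
      TensorBound (annulus r R) (fun x ξ => (quad e x ξ : ℂ)) C C' := by
  obtain ⟨M, hM⟩ := isHomogeneousSymbol_cosD.exists_commBound hr hR
  obtain ⟨M', hM'⟩ := isHomogeneousSymbol_sinD.exists_commBound hr hR
  refine ⟨A + A + A, L + (L + A * M) + (L + A * M'), fun e h => ?_⟩
  have t0 := TensorBound.coeff (K := annulus r R) (c := fun x => ((cf0 e x : ℝ) : ℂ)) (A := A)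
    (L := L) (fun x => by rw [Complex.norm_real]; exact h.abs_cf0_le x)
    (fun x y => by rw [← Complex.ofReal_sub, Complex.norm_real]; exact h.lip_cf0 x y)
  have t1 := TensorBound.single (K := annulus r R) (c := fun x => ((cf1 e x : ℝ) : ℂ)) (A := A)
    (L := L) (fun x => by rw [Complex.norm_real]; exact h.abs_cf1_le x)
    (fun x y => by rw [← Complex.ofReal_sub, Complex.norm_real]; exact h.lip_cf1 x y) hM
  have t2 := TensorBound.single (K := annulus r R) (c := fun x => ((cf2 e x : ℝ) : ℂ)) (A := A)
    (L := L) (fun x => by rw [Complex.norm_real]; exact h.abs_cf2_le x)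
    (fun x y => by rw [← Complex.ofReal_sub, Complex.norm_real]; exact h.lip_cf2 x y) hM'
  have := (t0.add t1).add t2
  simpa only [quad, Complex.ofReal_add, Complex.ofReal_mul] using this

end

section

/-! ### Classes of regular functions -/

theorem pd_add {u w : E → ℂ} (hu : Differentiable ℝ u) (hw : Differentiable ℝ w) (k : Fin 3) :
    pd k (u + w) = pd k u + pd k w := by
  funext x
  simp only [pd, Pi.add_apply, fderiv_add (hu x) (hw x), add_apply]

theorem pd_smul (c : ℂ) {u : E → ℂ} (hu : Differentiable ℝ u) (k : Fin 3) :
    pd k (c • u) = c • pd k u := by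
  funext x
  simp only [pd, Pi.smul_apply, fderiv_const_smul (hu x), smul_apply]

theorem pd_mul {u w : E → ℂ} (hu : Differentiable ℝ u) (hw : Differentiable ℝ w) (k : Fin 3) :
    pd k (u * w) = pd k u * w + u * pd k w := by
  funext x
  simp only [pd, Pi.add_apply, Pi.mul_apply, fderiv_mul (hu x) (hw x), add_apply, smul_apply,
    smul_eq_mul]
  ring

/-- All partial derivatives up to order `n` exist and are square integrable. -/
def HasL2Derivs : ℕ → (E → ℂ) → Prop
  | 0, w => MemLp w 2
  | n + 1, w => MemLp w 2 ∧ Differentiable ℝ w ∧ ∀ k, HasL2Derivs n (pd k w)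

theorem HasL2Derivs.memLp {n : ℕ} {w : E → ℂ} (h : HasL2Derivs n w) : MemLp w 2 := by
  cases n with
  | zero => exact h
  | succ n => exact h.1

theorem HasL2Derivs.add {n : ℕ} {u w : E → ℂ} (hu : HasL2Derivs n u) (hw : HasL2Derivs n w) :
    HasL2Derivs n (u + w) := by
  induction n generalizing u w with
  | zero => exact MemLp.add hu hw
  | succ n ih =>
    refine ⟨hu.1.add hw.1, hu.2.1.add hw.2.1, fun k => ?_⟩
    rw [pd_add hu.2.1 hw.2.1]
    exact ih (hu.2.2 k) (hw.2.2 k)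

theorem HasL2Derivs.const_smul {n : ℕ} {u : E → ℂ} (c : ℂ) (hu : HasL2Derivs n u) :
    HasL2Derivs n (c • u) := by
  induction n generalizing u with
  | zero => exact MemLp.const_smul hu c
  | succ n ih =>
    refine ⟨hu.1.const_smul c, hu.2.1.const_smul c, fun k => ?_⟩
    rw [pd_smul c hu.2.1]
    exact ih (hu.2.2 k)

theorem HasL2Derivs.of_succ {n : ℕ} {w : E → ℂ} (h : HasL2Derivs (n + 1) w) : HasL2Derivs n w := by
  induction n generalizing w with
  | zero => exact h.1
  | succ n ih => exact ⟨h.1, h.2.1, fun k => ih (h.2.2 k)⟩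

/-- All partial derivatives up to order `n` exist and are bounded. -/
def HasBddDerivs : ℕ → (E → ℂ) → Prop
  | 0, g => Measurable g ∧ ∃ C, ∀ x, ‖g x‖ ≤ C
  | n + 1, g => (Measurable g ∧ ∃ C, ∀ x, ‖g x‖ ≤ C) ∧ Differentiable ℝ g ∧
      ∀ k, HasBddDerivs n (pd k g)

theorem HasBddDerivs.bdd {n : ℕ} {g : E → ℂ} (h : HasBddDerivs n g) :
    Measurable g ∧ ∃ C, ∀ x, ‖g x‖ ≤ C := by
  cases n with
  | zero => exact h
  | succ n => exact h.1

theorem HasBddDerivs.of_succ {n : ℕ} {g : E → ℂ} (h : HasBddDerivs (n + 1) g) :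
    HasBddDerivs n g := by
  induction n generalizing g with
  | zero => exact h.1
  | succ n ih => exact ⟨h.1, h.2.1, fun k => ih (h.2.2 k)⟩

theorem HasBddDerivs.add {n : ℕ} {u w : E → ℂ} (hu : HasBddDerivs n u) (hw : HasBddDerivs n w) :
    HasBddDerivs n (u + w) := by
  have key : Measurable (u + w) ∧ ∃ C, ∀ x, ‖(u + w) x‖ ≤ C := by
    obtain ⟨h1, C1, h2⟩ := hu.bdd
    obtain ⟨h3, C2, h4⟩ := hw.bdd
    exact ⟨h1.add h3, C1 + C2, fun x => (norm_add_le _ _).trans (add_le_add (h2 x) (h4 x))⟩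
  induction n generalizing u w with
  | zero => exact key
  | succ n ih =>
    refine ⟨key, hu.2.1.add hw.2.1, fun k => ?_⟩
    rw [pd_add hu.2.1 hw.2.1]
    refine ih (hu.2.2 k) (hw.2.2 k) ?_
    obtain ⟨h1, C1, h2⟩ := (hu.2.2 k).bdd
    obtain ⟨h3, C2, h4⟩ := (hw.2.2 k).bdd
    exact ⟨h1.add h3, C1 + C2, fun x => (norm_add_le _ _).trans (add_le_add (h2 x) (h4 x))⟩

theorem HasBddDerivs.const_smul {n : ℕ} {u : E → ℂ} (c : ℂ) (hu : HasBddDerivs n u) :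
    HasBddDerivs n (c • u) := by
  have key : ∀ {u : E → ℂ}, (Measurable u ∧ ∃ C, ∀ x, ‖u x‖ ≤ C) →
      Measurable (c • u) ∧ ∃ C, ∀ x, ‖(c • u) x‖ ≤ C := by
    rintro u ⟨h1, C, h2⟩
    refine ⟨h1.const_smul c, ‖c‖ * C, fun x => ?_⟩
    rw [Pi.smul_apply, norm_smul]
    exact mul_le_mul_of_nonneg_left (h2 x) (norm_nonneg _)
  induction n generalizing u with
  | zero => exact key hu
  | succ n ih =>
    refine ⟨key hu.1, hu.2.1.const_smul c, fun k => ?_⟩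
    rw [pd_smul c hu.2.1]
    exact ih (hu.2.2 k)

theorem memLp_two_mul {g w : E → ℂ} (hg : Measurable g ∧ ∃ C, ∀ x, ‖g x‖ ≤ C) (hw : MemLp w 2) :
    MemLp (g * w) 2 := by
  obtain ⟨h1, C, h2⟩ := hg
  exact hw.mul (memLp_top_of_le h1 h2)

theorem HasL2Derivs.mul {n : ℕ} {g w : E → ℂ} (hg : HasBddDerivs n g) (hw : HasL2Derivs n w) :
    HasL2Derivs n (g * w) := by
  induction n generalizing g w with
  | zero => exact memLp_two_mul hg hw
  | succ n ih =>
    refine ⟨memLp_two_mul hg.1 hw.1, hg.2.1.mul hw.2.1, fun k => ?_⟩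
    rw [pd_mul hg.2.1 hw.2.1]
    exact (ih (hg.2.2 k) hw.of_succ).add (ih hg.of_succ (hw.2.2 k))

/-- All partial derivatives exist and are square integrable. -/
def SmoothL2 (w : E → ℂ) : Prop := ∀ n, HasL2Derivs n w

/-- All partial derivatives exist and are bounded. -/
def SmoothBdd (g : E → ℂ) : Prop := ∀ n, HasBddDerivs n g

namespace SmoothL2

variable {u w g : E → ℂ}

theorem memLp (h : SmoothL2 w) : MemLp w 2 := h 0
theorem differentiable (h : SmoothL2 w) : Differentiable ℝ w := (h 1).2.1
theorem pd (h : SmoothL2 w) (k : Fin 3) : SmoothL2 (pd k w) := fun n => (h (n + 1)).2.2 k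
theorem add (hu : SmoothL2 u) (hw : SmoothL2 w) : SmoothL2 (u + w) := fun n => (hu n).add (hw n)
theorem const_smul (hu : SmoothL2 u) (c : ℂ) : SmoothL2 (c • u) := fun n => (hu n).const_smul c
theorem mul (hg : SmoothBdd g) (hw : SmoothL2 w) : SmoothL2 (g * w) := fun n => HasL2Derivs.mul (hg n) (hw n)

theorem neg (hu : SmoothL2 u) : SmoothL2 (-u) := by
  have := hu.const_smul (-1); rwa [neg_one_smul] at this

theorem sub (hu : SmoothL2 u) (hw : SmoothL2 w) : SmoothL2 (u - w) := by
  rw [sub_eq_add_neg]; exact hu.add hw.neg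

end SmoothL2

namespace SmoothBdd

variable {u w : E → ℂ}

theorem bdd (h : SmoothBdd u) : Measurable u ∧ ∃ C, ∀ x, ‖u x‖ ≤ C := h 0
theorem differentiable (h : SmoothBdd w) : Differentiable ℝ w := (h 1).2.1
theorem pd (h : SmoothBdd w) (k : Fin 3) : SmoothBdd (pd k w) := fun n => (h (n + 1)).2.2 k
theorem add (hu : SmoothBdd u) (hw : SmoothBdd w) : SmoothBdd (u + w) := fun n => (hu n).add (hw n)
theorem const_smul (hu : SmoothBdd u) (c : ℂ) : SmoothBdd (c • u) := fun n => (hu n).const_smul c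

/-- A family of bounded differentiable functions stable under partial derivatives consists of
smooth functions with bounded derivatives. -/
theorem of_stable {P : (E → ℂ) → Prop}
    (hP : ∀ g, P g → (Measurable g ∧ ∃ C, ∀ x, ‖g x‖ ≤ C) ∧ Differentiable ℝ g ∧
      ∀ k, P (MaxwellDiag.pd k g)) {g : E → ℂ} (hg : P g) : SmoothBdd g := by
  intro n
  induction n generalizing g with
  | zero => exact (hP g hg).1
  | succ n ih => exact ⟨(hP g hg).1, (hP g hg).2.1, fun k => ih ((hP g hg).2.2 k)⟩

end SmoothBdd

/-- The products of `v` with polynomials of degree at most `n` are square integrable. -/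
def HasL2Moments : ℕ → (E → ℂ) → Prop
  | 0, v => MemLp v 2
  | n + 1, v => MemLp v 2 ∧ ∀ k : Fin 3, HasL2Moments n fun ξ => (ξ k : ℂ) * v ξ

theorem HasL2Moments.congr {n : ℕ} {v v' : E → ℂ} (h : HasL2Moments n v) (hv : v =ᵐ[volume] v') :
    HasL2Moments n v' := by
  induction n generalizing v v' with
  | zero => exact (memLp_congr_ae hv).1 h
  | succ n ih =>
    refine ⟨(memLp_congr_ae hv).1 h.1, fun k => ih (h.2 k) ?_⟩
    filter_upwards [hv] with ξ hξ
    rw [hξ]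

theorem HasL2Moments.add {n : ℕ} {u w : E → ℂ} (hu : HasL2Moments n u) (hw : HasL2Moments n w) :
    HasL2Moments n (u + w) := by
  induction n generalizing u w with
  | zero => exact MemLp.add hu hw
  | succ n ih =>
    refine ⟨hu.1.add hw.1, fun k => ?_⟩
    simp only [Pi.add_apply, mul_add]
    exact ih (hu.2 k) (hw.2 k)

theorem HasL2Moments.bdd_mul {n : ℕ} {m v : E → ℂ} (hm : Measurable m ∧ ∃ C, ∀ ξ, ‖m ξ‖ ≤ C)
    (hv : HasL2Moments n v) : HasL2Moments n fun ξ => m ξ * v ξ := by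
  induction n generalizing v with
  | zero => exact memLp_two_mul hm hv
  | succ n ih =>
    refine ⟨memLp_two_mul hm hv.1, fun k => ?_⟩
    simp only [mul_left_comm _ (m _)]
    exact ih (hv.2 k)

/-- The products of `v` with all polynomials are square integrable. -/
def RapidL2 (v : E → ℂ) : Prop := ∀ n, HasL2Moments n v

namespace RapidL2

variable {u v v' m : E → ℂ}

theorem memLp (h : RapidL2 v) : MemLp v 2 := h 0
theorem coord_mul (h : RapidL2 v) (k : Fin 3) : RapidL2 fun ξ => (ξ k : ℂ) * v ξ :=
  fun n => (h (n + 1)).2 k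
theorem congr (h : RapidL2 v) (hv : v =ᵐ[volume] v') : RapidL2 v' := fun n => (h n).congr hv
theorem add (hu : RapidL2 u) (hv : RapidL2 v) : RapidL2 (u + v) := fun n => (hu n).add (hv n)
theorem bdd_mul (hm : Measurable m ∧ ∃ C, ∀ ξ, ‖m ξ‖ ≤ C) (hv : RapidL2 v) :
    RapidL2 fun ξ => m ξ * v ξ := fun n => (hv n).bdd_mul hm

theorem const_mul (c : ℂ) (hv : RapidL2 v) : RapidL2 fun ξ => c * v ξ :=
  bdd_mul ⟨measurable_const, ‖c‖, fun _ => le_rfl⟩ hv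

/-- Uses |ξ| = ∑ₖ (ξₖ/|ξ|) ξₖ, whose quotients are bounded multipliers. -/
theorem norm_mul (hv : RapidL2 v) : RapidL2 fun ξ => (‖ξ‖ : ℂ) * v ξ := by
  have h : ∀ k : Fin 3, RapidL2 fun ξ : E => ((ξ k / ‖ξ‖ : ℝ) : ℂ) * ((ξ k : ℂ) * v ξ) := fun k => by
    refine bdd_mul ⟨by fun_prop, 1, fun ξ => ?_⟩ (hv.coord_mul k)
    rw [Complex.norm_real, Real.norm_eq_abs, abs_div, abs_norm]
    exact div_le_one_of_le₀ (PiLp.norm_apply_le ξ k) (norm_nonneg _)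
  refine (((h 0).add (h 1)).add (h 2)).congr (Filter.Eventually.of_forall fun ξ => ?_)
  simp only [Pi.add_apply]
  rcases eq_or_ne ξ 0 with rfl | hξ
  · simp
  · have h0 : ((‖ξ‖ : ℝ) : ℂ) ≠ 0 := by exact_mod_cast norm_ne_zero_iff.2 hξ
    have h1 : ((‖ξ‖ : ℝ) : ℂ) ^ 2 = (ξ 0 : ℂ) ^ 2 + (ξ 1 : ℂ) ^ 2 + (ξ 2 : ℂ) ^ 2 := by
      have := norm_sq_eq ξ
      rw [rho] at this
      rw [← add_assoc] at this
      exact_mod_cast this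
    push_cast
    field_simp
    rw [h1, mul_comm]

theorem norm_pow_mul (hv : RapidL2 v) (n : ℕ) : RapidL2 fun ξ => (‖ξ‖ : ℂ) ^ n * v ξ := by
  induction n with
  | zero => simpa using hv
  | succ n ih => simpa only [pow_succ', mul_assoc] using ih.norm_mul

/-- Cauchy–Schwarz against (1 + |ξ|²)^{-1}, which is square integrable because its square decays
like |ξ|^{-4} in dimension three. -/
theorem integrable (hv : RapidL2 v) : Integrable v := by
  have h1 : RapidL2 fun ξ => ((1 + ‖ξ‖ ^ 2 : ℝ) : ℂ) * v ξ := by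
    refine (hv.add (hv.norm_pow_mul 2)).congr (Filter.Eventually.of_forall fun ξ => ?_)
    simp only [Pi.add_apply]; push_cast; ring
  have h2 : MemLp (fun ξ : E => (((1 + ‖ξ‖ ^ 2 : ℝ)⁻¹ : ℝ) : ℂ)) 2 := by
    refine (memLp_two_iff_integrable_sq_norm (by fun_prop)).2 ?_
    have := integrable_rpow_neg_one_add_norm_sq (E := E) (μ := volume) (r := 4)
      (by simp [finrank_euclideanSpace]; norm_num)
    refine this.congr (Filter.Eventually.of_forall fun ξ => ?_)
    have h0 : 0 < 1 + ‖ξ‖ ^ 2 := by positivity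
    simp only [Complex.norm_real, norm_inv, Real.norm_eq_abs, abs_of_pos h0]
    rw [show (-4 / 2 : ℝ) = -(2 : ℕ) by norm_num, Real.rpow_neg h0.le, Real.rpow_natCast, inv_pow]
  refine (MemLp.integrable_mul h2 h1.memLp).congr (Filter.Eventually.of_forall fun ξ => ?_)
  have h0 : ((1 + ‖ξ‖ ^ 2 : ℝ) : ℂ) ≠ 0 := by exact_mod_cast (by positivity : (1 + ‖ξ‖ ^ 2) ≠ 0)
  simp only [Pi.mul_apply]
  rw [Complex.ofReal_inv, inv_mul_cancel_left₀ h0]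

end RapidL2

theorem HasL2Derivs.l2Fourier {n : ℕ} {w : E → ℂ} (h : HasL2Derivs n w) :
    HasL2Moments n (l2Fourier w) := by
  induction n generalizing w with
  | zero => exact memLp_l2Fourier w
  | succ n ih =>
    refine ⟨memLp_l2Fourier w, fun k => ?_⟩
    have h1 := (ih (h.2.2 k)).bdd_mul (m := fun _ => (2 * Real.pi * Complex.I)⁻¹)
      ⟨measurable_const, _, fun _ => le_rfl⟩
    refine h1.congr ?_
    filter_upwards [l2Fourier_pd k h.1 h.2.1 (h.2.2 k).memLp] with ξ hξ
    rw [hξ, mul_assoc (2 * (Real.pi : ℂ) * Complex.I), inv_mul_cancel_left₀ Complex.two_pi_I_ne_zero]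

theorem SmoothL2.l2Fourier {w : E → ℂ} (h : SmoothL2 w) : RapidL2 (l2Fourier w) :=
  fun n => (h n).l2Fourier

end

section

/-! ### Derivatives of oscillatory integrals -/

/-- Admissible coefficients with bounded derivatives of all orders, the second ones by `B`. -/
structure SmoothAdmissible (μ A L B : ℝ) (e : E → Matrix (Fin 2) (Fin 2) ℝ) : Prop
    extends Admissible μ A L e where
  smooth : ∀ i j, SmoothBdd fun x => (e x i j : ℂ)
  second : ∀ i j k l x, ‖pd k (pd l fun x => (e x i j : ℂ)) x‖ ≤ B

/-- The coefficients of the normalised quadratic form. -/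
def cf (e : E → Matrix (Fin 2) (Fin 2) ℝ) : Fin 3 → E → ℂ :=
  ![fun x => (cf0 e x : ℂ), fun x => (cf1 e x : ℂ), fun x => (cf2 e x : ℂ)]

/-- The trigonometric polynomials occurring in the normalised quadratic form. -/
def trig : Fin 3 → E → ℂ := ![fun _ => 1, fun ξ => (cosD ξ : ℂ), fun ξ => (sinD ξ : ℂ)]

theorem quad_eq_sum (e : E → Matrix (Fin 2) (Fin 2) ℝ) (x ξ : E) :
    (quad e x ξ : ℂ) = ∑ i, cf e i x * trig i ξ := by
  simp [Fin.sum_univ_three, cf, trig, quad]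

theorem isHomogeneousSymbol_trig (i : Fin 3) : IsHomogeneousSymbol (trig i) := by
  fin_cases i
  · exact isHomogeneousSymbol_one
  · exact isHomogeneousSymbol_cosD
  · exact isHomogeneousSymbol_sinD

theorem IsHomogeneousSymbol.bdd {m : E → ℂ} (hm : IsHomogeneousSymbol m) :
    Measurable m ∧ ∃ C, ∀ ξ, ‖m ξ‖ ≤ C := ⟨hm.measurable, 1, hm.norm_le⟩

theorem norm_pd_le {g : E → ℂ} {L : ℝ} (hL : ∀ x y, ‖g x - g y‖ ≤ L * ‖x - y‖) (k : Fin 3) (x : E) :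
    ‖pd k g x‖ ≤ L := by
  have h := norm_fderiv_le_of_lip' ℝ (f := g) (x₀ := x) (lipschitz_nonneg hL)
    (Filter.Eventually.of_forall fun y => hL y x)
  refine ((fderiv ℝ g x).le_opNorm _).trans ?_
  simpa using h

variable {μ A L B : ℝ} {e : E → Matrix (Fin 2) (Fin 2) ℝ}

theorem cf0_eq (e : E → Matrix (Fin 2) (Fin 2) ℝ) :
    cf e 0 = (1 / 2 : ℂ) • ((fun x => (e x 0 0 : ℂ)) + fun x => (e x 1 1 : ℂ)) := by
  funext x; simp [cf, cf0]; ring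

theorem cf1_eq (e : E → Matrix (Fin 2) (Fin 2) ℝ) :
    cf e 1 = (1 / 2 : ℂ) • ((fun x => (e x 1 1 : ℂ)) + (-1 : ℂ) • fun x => (e x 0 0 : ℂ)) := by
  funext x; simp [cf, cf1]; ring

theorem cf2_eq (e : E → Matrix (Fin 2) (Fin 2) ℝ) :
    cf e 2 = (-1 : ℂ) • fun x => (e x 0 1 : ℂ) := by
  funext x; simp [cf, cf2]

theorem Admissible.lip_cf (h : Admissible μ A L e) (i : Fin 3) (x y : E) :
    ‖cf e i x - cf e i y‖ ≤ L * ‖x - y‖ := by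
  fin_cases i
  · simpa [cf, ← Complex.ofReal_sub] using h.lip_cf0 x y
  · simpa [cf, ← Complex.ofReal_sub] using h.lip_cf1 x y
  · simpa [cf, ← Complex.ofReal_sub] using h.lip_cf2 x y

theorem Admissible.norm_pd_cf_le (h : Admissible μ A L e) (i k : Fin 3) (x : E) :
    ‖pd k (cf e i) x‖ ≤ L := norm_pd_le (h.lip_cf i) k x

theorem Admissible.norm_pd_coeff_le (h : Admissible μ A L e) (i j : Fin 2) (k : Fin 3) (x : E) :
    ‖pd k (fun x => (e x i j : ℂ)) x‖ ≤ L :=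
  norm_pd_le (fun x y => by
    rw [← Complex.ofReal_sub, Complex.norm_real]; exact h.lip x y i j) k x

namespace SmoothAdmissible

theorem smooth_cf (h : SmoothAdmissible μ A L B e) (i : Fin 3) : SmoothBdd (cf e i) := by
  fin_cases i
  · change SmoothBdd (cf e 0)
    rw [cf0_eq]; exact ((h.smooth 0 0).add (h.smooth 1 1)).const_smul _
  · change SmoothBdd (cf e 1)
    rw [cf1_eq]; exact ((h.smooth 1 1).add ((h.smooth 0 0).const_smul _)).const_smul _
  · change SmoothBdd (cf e 2)
    rw [cf2_eq]; exact (h.smooth 0 1).const_smul _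

theorem second_cf (h : SmoothAdmissible μ A L B e) (i k l : Fin 3) (x : E) :
    ‖pd k (pd l (cf e i)) x‖ ≤ B := by
  have d := fun i j => (h.smooth i j).differentiable
  have d' := fun i j l => ((h.smooth i j).pd l).differentiable
  fin_cases i
  · change ‖pd k (pd l (cf e 0)) x‖ ≤ B
    rw [cf0_eq, pd_smul _ ((d 0 0).add (d 1 1)), pd_add (d 0 0) (d 1 1),
      pd_smul _ ((d' 0 0 l).add (d' 1 1 l)), pd_add (d' 0 0 l) (d' 1 1 l)]
    have h1 := h.second 0 0 k l x
    have h2 := h.second 1 1 k l x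
    have h3 := norm_add_le (pd k (pd l fun x => (e x 0 0 : ℂ)) x)
      (pd k (pd l fun x => (e x 1 1 : ℂ)) x)
    simp only [Pi.smul_apply, Pi.add_apply, norm_smul]
    norm_num
    linarith
  · change ‖pd k (pd l (cf e 1)) x‖ ≤ B
    rw [cf1_eq, pd_smul _ ((d 1 1).add ((d 0 0).const_smul _)),
      pd_add (d 1 1) ((d 0 0).const_smul _), pd_smul _ (d 0 0),
      pd_smul _ ((d' 1 1 l).add ((d' 0 0 l).const_smul _)),
      pd_add (d' 1 1 l) ((d' 0 0 l).const_smul _), pd_smul _ (d' 0 0 l)]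
    have h1 := h.second 0 0 k l x
    have h2 := h.second 1 1 k l x
    have h3 := norm_sub_le (pd k (pd l fun x => (e x 1 1 : ℂ)) x)
      (pd k (pd l fun x => (e x 0 0 : ℂ)) x)
    simp only [Pi.smul_apply, norm_smul, neg_smul, one_smul, ← sub_eq_add_neg]
    norm_num
    linarith
  · change ‖pd k (pd l (cf e 2)) x‖ ≤ B
    rw [cf2_eq, pd_smul _ (d 0 1), pd_smul _ (d' 0 1 l), Pi.smul_apply, norm_smul]
    simpa using h.second 0 1 k l x

end SmoothAdmissible

theorem Admissible.invRoot_nonneg (e : E → Matrix (Fin 2) (Fin 2) ℝ) (x ξ : E) :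
    0 ≤ invRoot e x ξ := inv_nonneg.2 (Real.sqrt_nonneg _)

theorem Admissible.invRoot_le (hμ : 0 < μ) (h : Admissible μ A L e) (x ξ : E) :
    invRoot e x ξ ≤ (Real.sqrt μ)⁻¹ :=
  inv_anti₀ (Real.sqrt_pos.2 hμ) (Real.sqrt_le_sqrt (h.le_quad x ξ))

theorem Admissible.quad_mul_invRoot_sq (hμ : 0 < μ) (h : Admissible μ A L e) (x ξ : E) :
    quad e x ξ * invRoot e x ξ ^ 2 = 1 := by
  have h0 := hμ.trans_le (h.le_quad x ξ)
  rw [invRoot, inv_pow, Real.sq_sqrt h0.le, mul_inv_cancel₀ h0.ne']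

theorem measurable_quad (e : E → Matrix (Fin 2) (Fin 2) ℝ) (x : E) : Measurable (quad e x) := by
  have h1 := measurable_cosD
  have h2 := measurable_sinD
  unfold quad; fun_prop

theorem measurable_invRoot (e : E → Matrix (Fin 2) (Fin 2) ℝ) (x : E) : Measurable (invRoot e x) := by
  have := measurable_quad e x
  unfold invRoot; fun_prop

/-- The oscillatory integral with symbol `(|ξ'| / ‖ξ'‖_{ε̃(x)}) ^ m`. -/
def oscRoot (e : E → Matrix (Fin 2) (Fin 2) ℝ) (m : ℕ) (v : E → ℂ) : E → ℂ :=
  osc (fun x ξ => (invRoot e x ξ : ℂ) ^ m) v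

theorem hasDerivAt_inv_sqrt_pow (m : ℕ) {s : ℝ} (hs : 0 < s) :
    HasDerivAt (fun s : ℝ => (Real.sqrt s)⁻¹ ^ m) (-(m / 2) * (Real.sqrt s)⁻¹ ^ (m + 2)) s := by
  have h0 : Real.sqrt s ≠ 0 := (Real.sqrt_pos.2 hs).ne'
  have h := ((Real.hasDerivAt_sqrt hs.ne').inv h0).pow m
  refine h.congr_deriv ?_
  rcases m with _ | m
  · simp
  · simp only [Nat.add_sub_cancel, Pi.inv_apply]
    push_cast
    field_simp
    rw [add_assoc, pow_add _ m 3]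
    field_simp

/-- The derivative in `x` of the integrand of `oscRoot`. -/
def oscRootDeriv (e : E → Matrix (Fin 2) (Fin 2) ℝ) (m : ℕ) (v : E → ℂ) (x ξ : E) : E →L[ℝ] ℂ :=
  (Complex.exp (2 * Real.pi * Complex.I * (inner ℝ x ξ : ℝ)) *
      (invRoot e x ((2 * Real.pi) • ξ) : ℂ) ^ m * v ξ * (2 * Real.pi * Complex.I)) •
      Complex.ofRealCLM.comp (innerSL ℝ ξ) +
    ∑ i, (-(m / 2 : ℂ) * (Complex.exp (2 * Real.pi * Complex.I * (inner ℝ x ξ : ℝ)) *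
      (invRoot e x ((2 * Real.pi) • ξ) : ℂ) ^ (m + 2) * (trig i ξ * v ξ))) •
      fderiv ℝ (cf e i) x

/-- Since q is linear in its coefficients, differentiating q^{-m/2} in x yields q^{-(m+2)/2} times
trigonometric factors in ξ and derivatives of the coefficients in x. -/
theorem hasFDerivAt_invRoot_pow (hμ : 0 < μ) (h : SmoothAdmissible μ A L B e) (m : ℕ) (x η : E) :
    HasFDerivAt (fun x => (invRoot e x η : ℂ) ^ m)
      (∑ i, (-(m / 2 : ℂ) * (invRoot e x η : ℂ) ^ (m + 2) * trig i η) • fderiv ℝ (cf e i) x) x := by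
  have hq : HasFDerivAt (fun x => (quad e x η : ℂ)) (∑ i, trig i η • fderiv ℝ (cf e i) x) x := by
    simp only [quad_eq_sum]
    exact HasFDerivAt.fun_sum fun i _ =>
      ((h.smooth_cf i).differentiable x).hasFDerivAt.mul_const (trig i η)
  have hq' : HasFDerivAt (fun x => quad e x η)
      (Complex.reCLM.comp (∑ i, trig i η • fderiv ℝ (cf e i) x)) x := by
    simpa [Function.comp_def] using Complex.reCLM.hasFDerivAt.comp x hq
  have h1 := (hasDerivAt_inv_sqrt_pow m (hμ.trans_le (h.le_quad x η))).comp_hasFDerivAt x hq'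
  have h2 := Complex.ofRealCLM.hasFDerivAt.comp x h1
  have e1 : (Complex.ofRealCLM ∘ (fun s => (Real.sqrt s)⁻¹ ^ m) ∘ fun x => quad e x η)
      = fun x => (invRoot e x η : ℂ) ^ m := by
    funext y; simp [invRoot]
  rw [e1] at h2
  refine h2.congr_fderiv ?_
  -- The complex-valued derivative of q is real, by uniqueness of the derivative, so taking real
  -- parts loses nothing.
  have hre : Complex.ofRealCLM.comp (Complex.reCLM.comp (∑ i, trig i η • fderiv ℝ (cf e i) x))
      = ∑ i, trig i η • fderiv ℝ (cf e i) x :=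
    (Complex.ofRealCLM.hasFDerivAt.comp x hq').unique hq
  ext w
  have := congrArg (fun T : E →L[ℝ] ℂ => T w) hre
  simp only [ContinuousLinearMap.comp_apply, Complex.ofRealCLM_apply, smul_apply, sum_apply,
    smul_eq_mul, Complex.reCLM_apply] at this ⊢
  rw [Complex.ofReal_mul, this, Finset.mul_sum]
  refine Finset.sum_congr rfl fun i _ => ?_
  simp only [invRoot]; push_cast; ring

theorem hasFDerivAt_oscRoot_integrand (hμ : 0 < μ) (h : SmoothAdmissible μ A L B e) (m : ℕ)
    (v : E → ℂ) (x ξ : E) :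
    HasFDerivAt (fun x => Complex.exp (2 * Real.pi * Complex.I * (inner ℝ x ξ : ℝ)) *
      (invRoot e x ((2 * Real.pi) • ξ) : ℂ) ^ m * v ξ) (oscRootDeriv e m v x ξ) x := by
  have h1 : HasFDerivAt (fun x : E => ((inner ℝ x ξ : ℝ) : ℂ))
      (Complex.ofRealCLM.comp (innerSL ℝ ξ)) x := by
    have : (fun x : E => ((inner ℝ x ξ : ℝ) : ℂ)) = Complex.ofRealCLM.comp (innerSL ℝ ξ) := by
      funext y; simp [real_inner_comm]
    rw [this]; exact ContinuousLinearMap.hasFDerivAt _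
  have h2 := (h1.const_mul (2 * (Real.pi : ℂ) * Complex.I)).cexp
  have h3 := (h2.mul (hasFDerivAt_invRoot_pow hμ h m x ((2 * Real.pi) • ξ))).mul_const (v ξ)
  refine h3.congr_fderiv ?_
  ext w
  have ht : ∀ i, trig i ((2 * Real.pi) • ξ) = trig i ξ := fun i =>
    (isHomogeneousSymbol_trig i).hom _ ξ (by positivity)
  simp only [oscRootDeriv, ContinuousLinearMap.comp_apply, Complex.ofRealCLM_apply, smul_apply,
    add_apply, sum_apply, smul_eq_mul, ht]
  simp only [Fin.sum_univ_three]
  ring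

end

section

variable {μ A L B : ℝ} {e : E → Matrix (Fin 2) (Fin 2) ℝ}

/-! ### Regularity of oscillatory integrals -/

theorem norm_invRoot_pow_le (hμ : 0 < μ) (h : Admissible μ A L e) (m : ℕ) (x ξ : E) :
    ‖(invRoot e x ξ : ℂ) ^ m‖ ≤ (Real.sqrt μ)⁻¹ ^ m := by
  rw [norm_pow, Complex.norm_real, Real.norm_of_nonneg (Admissible.invRoot_nonneg e x ξ)]
  exact pow_le_pow_left₀ (Admissible.invRoot_nonneg e x ξ) (h.invRoot_le hμ x ξ) m

theorem integrable_osc {b : E → E → ℂ} {x : E} (hb : Measurable (b x)) {C : ℝ}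
    (hC : ∀ ξ, ‖b x ξ‖ ≤ C) {v : E → ℂ} (hv : Integrable v) :
    Integrable fun ξ => Complex.exp (2 * Real.pi * Complex.I * (inner ℝ x ξ : ℝ)) *
      b x ((2 * Real.pi) • ξ) * v ξ := by
  refine hv.bdd_mul (c := C) ?_ (Filter.Eventually.of_forall fun ξ => ?_)
  · exact ((continuous_phase x).measurable.mul (measurable_dil hb)).aestronglyMeasurable
  · rw [norm_mul, norm_exp_phase, one_mul]; exact hC _

theorem integrable_oscRoot (hμ : 0 < μ) (h : Admissible μ A L e) (m : ℕ) (x : E) {v : E → ℂ}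
    (hv : Integrable v) :
    Integrable fun ξ => Complex.exp (2 * Real.pi * Complex.I * (inner ℝ x ξ : ℝ)) *
      (invRoot e x ((2 * Real.pi) • ξ) : ℂ) ^ m * v ξ :=
  integrable_osc (b := fun x ξ => (invRoot e x ξ : ℂ) ^ m)
    (by have := measurable_invRoot e x; fun_prop) (norm_invRoot_pow_le hμ h m x) hv

theorem osc_add {b : E → E → ℂ} (hb : ∀ x, Measurable (b x)) {C : ℝ} (hC : ∀ x ξ, ‖b x ξ‖ ≤ C)
    {u v : E → ℂ} (hu : Integrable u) (hv : Integrable v) :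
    osc b (fun ξ => u ξ + v ξ) = osc b u + osc b v := by
  funext x
  rw [Pi.add_apply, osc, osc, osc, ← integral_add (integrable_osc (hb x) (hC x) hu)
    (integrable_osc (hb x) (hC x) hv)]
  simp only [mul_add]

theorem osc_const_mul (b : E → E → ℂ) (c : ℂ) (v : E → ℂ) :
    osc b (fun ξ => c * v ξ) = c • osc b v := by
  funext x
  rw [Pi.smul_apply, smul_eq_mul, osc, osc, ← integral_const_mul]
  simp only [mul_left_comm _ c]

theorem osc_mul_coeff (g : E → ℂ) (b : E → E → ℂ) (v : E → ℂ) :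
    osc (fun x ξ => g x * b x ξ) v = g * osc b v := by
  funext x
  rw [Pi.mul_apply, osc, osc, ← integral_const_mul]
  congr 1; funext ξ; ring

theorem osc_mul_symbol (b : E → E → ℂ) {m : E → ℂ} (hm : IsHomogeneousSymbol m) (v : E → ℂ) :
    osc (fun x ξ => b x ξ * m ξ) v = osc b fun ξ => m ξ * v ξ := by
  funext x
  rw [osc, osc]
  congr 1; funext ξ
  rw [hm.hom _ ξ (by positivity)]; ring

theorem osc_congr {b : E → E → ℂ} {v v' : E → ℂ} (h : v =ᵐ[volume] v') : osc b v = osc b v' := by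
  refine osc_congr_ae fun x => ?_
  filter_upwards [h] with ξ hξ
  rw [hξ]

theorem RapidL2.integrable_norm_mul {v : E → ℂ} (hv : RapidL2 v) :
    Integrable fun ξ => ‖ξ‖ * ‖v ξ‖ := by
  simpa using hv.norm_mul.integrable.norm

theorem norm_trig_le (i : Fin 3) (ξ : E) : ‖trig i ξ‖ ≤ 1 := (isHomogeneousSymbol_trig i).norm_le ξ

theorem RapidL2.trig_mul {v : E → ℂ} (hv : RapidL2 v) (i : Fin 3) :
    RapidL2 fun ξ => trig i ξ * v ξ := hv.bdd_mul (isHomogeneousSymbol_trig i).bdd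

/-- Differentiation under the integral: the derivative of the integrand is dominated, uniformly in
x, by a combination of |ξ| |v| and |v|. -/
theorem hasFDerivAt_oscRoot (hμ : 0 < μ) (h : SmoothAdmissible μ A L B e) (m : ℕ) {v : E → ℂ}
    (hv : RapidL2 v) (x : E) :
    Integrable (oscRootDeriv e m v x) ∧
      HasFDerivAt (oscRoot e m v) (∫ ξ, oscRootDeriv e m v x ξ) x := by
  have hm := hv.integrable
  have hF : ∀ x, Integrable fun ξ => Complex.exp (2 * Real.pi * Complex.I * (inner ℝ x ξ : ℝ)) *
      (invRoot e x ((2 * Real.pi) • ξ) : ℂ) ^ m * v ξ := fun x =>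
    integrable_oscRoot hμ h.toAdmissible m x hm
  set κ := (Real.sqrt μ)⁻¹
  have hκ : 0 ≤ κ := by positivity
  have hL := h.lip_nonneg
  have hmeas : AEStronglyMeasurable (oscRootDeriv e m v x) := by
    refine AEStronglyMeasurable.add ?_ ?_
    · refine ((hF x).aestronglyMeasurable.mul_const _).smul ?_
      exact (by fun_prop : Continuous fun ξ : E =>
        Complex.ofRealCLM.comp (innerSL ℝ ξ)).aestronglyMeasurable
    · refine Finset.aestronglyMeasurable_fun_sum _ fun i _ => ?_
      refine AEStronglyMeasurable.smul_const ?_ _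
      exact ((integrable_oscRoot hμ h.toAdmissible (m + 2) x
        (hv.trig_mul i).integrable).aestronglyMeasurable).const_mul _
  have hbound : ∀ y ξ, ‖oscRootDeriv e m v y ξ‖
      ≤ (κ ^ m * (2 * Real.pi)) * (‖ξ‖ * ‖v ξ‖) + (3 * (m / 2 * κ ^ (m + 2) * L)) * ‖v ξ‖ := by
    intro y ξ
    have n1 := norm_invRoot_pow_le hμ h.toAdmissible m y ((2 * Real.pi) • ξ)
    have n2 := norm_invRoot_pow_le hμ h.toAdmissible (m + 2) y ((2 * Real.pi) • ξ)
    have n3 : ∀ i, ‖fderiv ℝ (cf e i) y‖ ≤ L := fun i =>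
      norm_fderiv_le_of_lip' ℝ hL (Filter.Eventually.of_forall fun z => h.lip_cf i z y)
    refine (norm_add_le _ _).trans (add_le_add ?_ ?_)
    · rw [norm_smul, norm_mul, norm_mul, norm_mul, norm_exp_phase, one_mul]
      have n4 : ‖Complex.ofRealCLM.comp (innerSL ℝ ξ)‖ ≤ ‖ξ‖ := by
        refine (ContinuousLinearMap.opNorm_comp_le _ _).trans ?_
        rw [Complex.ofRealCLM_norm, one_mul, innerSL_apply_norm]
      have n5 : ‖(2 * Real.pi * Complex.I : ℂ)‖ = 2 * Real.pi := by
        simp [abs_of_pos Real.pi_pos]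
      rw [n5]
      calc _ ≤ κ ^ m * ‖v ξ‖ * (2 * Real.pi) * ‖ξ‖ := by gcongr
        _ = _ := by ring
    · refine (norm_sum_le _ _).trans ?_
      have : ∀ i ∈ (Finset.univ : Finset (Fin 3)),
          ‖(-(m / 2 : ℂ) * (Complex.exp (2 * Real.pi * Complex.I * (inner ℝ y ξ : ℝ)) *
            (invRoot e y ((2 * Real.pi) • ξ) : ℂ) ^ (m + 2) * (trig i ξ * v ξ))) •
            fderiv ℝ (cf e i) y‖ ≤ m / 2 * (κ ^ (m + 2) * (1 * ‖v ξ‖)) * L := fun i _ => by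
        rw [norm_smul, norm_mul, norm_mul, norm_mul, norm_mul, norm_exp_phase, one_mul, norm_neg,
          norm_div, Complex.norm_natCast]
        have := norm_trig_le i ξ
        have := n3 i
        simp only [RCLike.norm_ofNat]
        gcongr
      refine (Finset.sum_le_sum this).trans (le_of_eq ?_)
      simp; ring
  have hint : Integrable fun ξ => (κ ^ m * (2 * Real.pi)) * (‖ξ‖ * ‖v ξ‖)
      + (3 * (m / 2 * κ ^ (m + 2) * L)) * ‖v ξ‖ :=
    (hv.integrable_norm_mul.const_mul _).add (hm.norm.const_mul _)
  exact ⟨hint.mono' hmeas (Filter.Eventually.of_forall (hbound x)),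
    hasFDerivAt_integral_of_dominated_of_fderiv_le (s := Set.univ) Filter.univ_mem
    (Filter.Eventually.of_forall fun y => (hF y).aestronglyMeasurable) (hF x) hmeas
    (Filter.Eventually.of_forall fun ξ y _ => hbound y ξ) hint
    (Filter.Eventually.of_forall fun ξ y _ => hasFDerivAt_oscRoot_integrand hμ h m v y ξ)⟩

theorem differentiable_oscRoot (hμ : 0 < μ) (h : SmoothAdmissible μ A L B e) (m : ℕ) {v : E → ℂ}
    (hv : RapidL2 v) : Differentiable ℝ (oscRoot e m v) :=
  fun x => (hasFDerivAt_oscRoot hμ h m hv x).2.differentiableAt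

/-- The family of these integrals, with bounded smooth coefficients, is closed under
differentiation. Either the derivative acts on the frequency side, or the exponent rises from m to m
+ 2 and a derivative of the coefficients appears. -/
theorem pd_oscRoot (hμ : 0 < μ) (h : SmoothAdmissible μ A L B e) (m : ℕ) {v : E → ℂ}
    (hv : RapidL2 v) (k : Fin 3) :
    pd k (oscRoot e m v) = oscRoot e m (fun ξ => 2 * Real.pi * Complex.I * ξ k * v ξ) +
      ∑ i, (-(m / 2 : ℂ)) • (pd k (cf e i) * oscRoot e (m + 2) fun ξ => trig i ξ * v ξ) := by
  funext x
  obtain ⟨h1, h2⟩ := hasFDerivAt_oscRoot hμ h m hv x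
  rw [pd, h2.fderiv, ContinuousLinearMap.integral_apply h1]
  have e1 : ∀ ξ, oscRootDeriv e m v x ξ (EuclideanSpace.single k 1) =
      Complex.exp (2 * Real.pi * Complex.I * (inner ℝ x ξ : ℝ)) *
        (invRoot e x ((2 * Real.pi) • ξ) : ℂ) ^ m * (2 * Real.pi * Complex.I * ξ k * v ξ) +
      ∑ i, (-(m / 2 : ℂ) * pd k (cf e i) x) *
        (Complex.exp (2 * Real.pi * Complex.I * (inner ℝ x ξ : ℝ)) *
        (invRoot e x ((2 * Real.pi) • ξ) : ℂ) ^ (m + 2) * (trig i ξ * v ξ)) := fun ξ => by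
    simp only [oscRootDeriv, add_apply, smul_apply, sum_apply, ContinuousLinearMap.comp_apply,
      innerSL_apply_apply, inner_single, Complex.ofRealCLM_apply, smul_eq_mul, pd]
    congr 1
    · ring
    · refine Finset.sum_congr rfl fun i _ => ?_
      ring
  simp only [e1]
  have i1 : Integrable fun ξ : E => 2 * Real.pi * Complex.I * ξ k * v ξ := by
    simpa only [mul_assoc] using ((hv.coord_mul k).const_mul (2 * Real.pi * Complex.I)).integrable
  have i2 := fun i => integrable_oscRoot hμ h.toAdmissible (m + 2) x (hv.trig_mul i).integrable
  rw [integral_add (integrable_oscRoot hμ h.toAdmissible m x i1)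
    (integrable_finsetSum _ fun i _ => (i2 i).const_mul _),
    integral_finsetSum _ fun i _ => (i2 i).const_mul _, Pi.add_apply, Finset.sum_apply]
  simp only [integral_const_mul, Pi.smul_apply, Pi.mul_apply, smul_eq_mul, oscRoot, osc]
  congr 1
  exact Finset.sum_congr rfl fun i _ => by ring

theorem memLp_oscRoot (hμ : 0 < μ) (h : Admissible μ A L e) (m : ℕ) {v : E → ℂ}
    (h1 : Integrable v) (h2 : MemLp v 2) : MemLp (oscRoot e m v) 2 := by
  -- The annulus is arbitrary: plain L² boundedness does not use frequency localization.
  obtain ⟨C, C', hC⟩ := exists_tensorBound_invRoot (A := A) (L := L) one_pos one_lt_two hμ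
  have hv : L2Bound v (eLpNorm v 2).toReal := ⟨h2, by rw [ENNReal.ofReal_toReal h2.2.ne]⟩
  exact (((hC e h).pow m).l2Bound_osc h1 hv ENNReal.toReal_nonneg).1

theorem RapidL2.deriv_mul {v : E → ℂ} (hv : RapidL2 v) (k : Fin 3) :
    RapidL2 fun ξ => 2 * Real.pi * Complex.I * ξ k * v ξ := by
  simpa only [mul_assoc] using (hv.coord_mul k).const_mul (2 * Real.pi * Complex.I)

theorem smoothL2_oscRoot (hμ : 0 < μ) (h : SmoothAdmissible μ A L B e) (m : ℕ) {v : E → ℂ}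
    (hv : RapidL2 v) : SmoothL2 (oscRoot e m v) := by
  intro n
  induction n generalizing m v with
  | zero => exact memLp_oscRoot hμ h.toAdmissible m hv.integrable hv.memLp
  | succ n ih =>
    refine ⟨memLp_oscRoot hμ h.toAdmissible m hv.integrable hv.memLp,
      differentiable_oscRoot hμ h m hv, fun k => ?_⟩
    rw [pd_oscRoot hμ h m hv, Fin.sum_univ_three]
    have h1 := fun i => HasL2Derivs.const_smul (-(m / 2 : ℂ))
      (HasL2Derivs.mul ((h.smooth_cf i).pd k n) (ih (m + 2) (hv.trig_mul i)))
    exact (ih m (hv.deriv_mul k)).add (((h1 0).add (h1 1)).add (h1 2))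

end

section

variable {μ A L B : ℝ} {e : E → Matrix (Fin 2) (Fin 2) ℝ}

/-! ### The operators `D` and `1 / D` -/

theorem epsNorm_eq_sqrt (h : Admissible μ A L e) (x ξ : E) :
    epsNorm e x ξ = Real.sqrt (quad e x ξ * rho ξ) := by
  rw [epsNorm]
  congr 1
  have hs := h.symm x
  simp only [Fin.sum_univ_two, epsTilde, Matrix.of_apply, Matrix.cons_val_zero,
    Matrix.cons_val_one, Matrix.cons_val', Matrix.cons_val_fin_one, Fin.succ_zero_eq_one,
    Fin.succ_one_eq_two, quad, cf0, cf1, cf2, cosD, sinD, ← hs]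
  by_cases h0 : rho ξ = 0
  · have h1 : ξ 1 = 0 := by rw [rho] at h0; nlinarith [sq_nonneg (ξ 1), sq_nonneg (ξ 2)]
    have h2 : ξ 2 = 0 := by rw [rho] at h0; nlinarith [sq_nonneg (ξ 1), sq_nonneg (ξ 2)]
    simp [h0, h1, h2]
  · field_simp
    rw [rho]; ring

/-- The root q^{1/2} is written q · q^{-1/2}, so that only the inverse root needs a series
expansion. -/
theorem epsNorm_eq (hμ : 0 < μ) (h : Admissible μ A L e) (x ξ : E) :
    epsNorm e x ξ = quad e x ξ * invRoot e x ξ * spatialNorm ξ := by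
  have h0 := hμ.trans_le (h.le_quad x ξ)
  rw [epsNorm_eq_sqrt h, Real.sqrt_mul h0.le, invRoot, ← div_eq_mul_inv, Real.div_sqrt]
  rfl

theorem inv_epsNorm (h : Admissible μ A L e) (hμ : 0 < μ) (x ξ : E) :
    (epsNorm e x ξ)⁻¹ = invRoot e x ξ / spatialNorm ξ := by
  have h0 := hμ.trans_le (h.le_quad x ξ)
  rw [epsNorm_eq_sqrt h, Real.sqrt_mul h0.le, mul_inv, invRoot, div_eq_mul_inv]
  rfl

theorem spatialNorm_two_pi (ξ : E) :
    spatialNorm ((2 * Real.pi) • ξ) = 2 * Real.pi * spatialNorm ξ :=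
  spatialNorm_smul _ (by positivity) ξ

theorem opInvD_eq (hμ : 0 < μ) (h : Admissible μ A L e) (u : E → ℂ) :
    opInvD e u = oscRoot e 1 fun ξ => l2Fourier u ξ / (2 * Real.pi * spatialNorm ξ : ℝ) := by
  funext x
  rw [opInvD, op, oscRoot, osc]
  congr 1; funext ξ
  rw [← Complex.ofReal_inv, inv_epsNorm h hμ, spatialNorm_two_pi]
  push_cast; ring

/-- The operator with symbol `‖ξ'‖_{ε̃(x)} / |ξ'|`. -/
def oscQuad (e : E → Matrix (Fin 2) (Fin 2) ℝ) (v : E → ℂ) : E → ℂ :=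
  osc (fun x ξ => (quad e x ξ : ℂ) * invRoot e x ξ) v

theorem opD_eq (hμ : 0 < μ) (h : Admissible μ A L e) (u : E → ℂ) :
    opD e u = oscQuad e fun ξ => (2 * Real.pi * spatialNorm ξ : ℝ) * l2Fourier u ξ := by
  funext x
  rw [opD, op, oscQuad, osc]
  congr 1; funext ξ
  rw [epsNorm_eq hμ h, spatialNorm_two_pi]
  push_cast; ring

theorem RapidL2.spatialNorm_mul {v : E → ℂ} (hv : RapidL2 v) :
    RapidL2 fun ξ => ((2 * Real.pi * spatialNorm ξ : ℝ) : ℂ) * v ξ := by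
  have h : RapidL2 fun ξ : E => ((spatialNorm ξ / ‖ξ‖ : ℝ) : ℂ) * ((‖ξ‖ : ℂ) * v ξ) := by
    refine RapidL2.bdd_mul ⟨?_, 1, fun ξ => ?_⟩ hv.norm_mul
    · have := continuous_spatialNorm.measurable
      fun_prop
    rw [Complex.norm_real, Real.norm_eq_abs, abs_div, abs_norm, abs_of_nonneg (spatialNorm_nonneg _)]
    refine div_le_one_of_le₀ (Real.sqrt_le_iff.2 ⟨norm_nonneg _, ?_⟩) (norm_nonneg _)
    rw [norm_sq_eq, rho]
    nlinarith [sq_nonneg (ξ 0)]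
  refine (h.const_mul (2 * Real.pi)).congr (Filter.Eventually.of_forall fun ξ => ?_)
  rcases eq_or_ne ξ 0 with rfl | hξ
  · simp [spatialNorm]
  · have h0 : ((‖ξ‖ : ℝ) : ℂ) ≠ 0 := by exact_mod_cast norm_ne_zero_iff.2 hξ
    push_cast
    field_simp

theorem oscQuad_eq_sum (hμ : 0 < μ) (h : Admissible μ A L e) {v : E → ℂ} (hv : RapidL2 v) :
    oscQuad e v = ∑ i, cf e i * oscRoot e 1 fun ξ => trig i ξ * v ξ := by
  funext x
  simp only [Finset.sum_apply, Pi.mul_apply, oscRoot, osc, oscQuad]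
  have i1 := fun i => integrable_oscRoot hμ h 1 x (hv.trig_mul i).integrable
  simp only [← integral_const_mul]
  rw [← integral_finsetSum _ fun i _ => (i1 i).const_mul _]
  congr 1; funext ξ
  rw [quad_eq_sum]
  simp only [fun i => (isHomogeneousSymbol_trig i).hom (2 * Real.pi) ξ (by positivity),
    Fin.sum_univ_three]
  ring

theorem smoothL2_oscQuad (hμ : 0 < μ) (h : SmoothAdmissible μ A L B e) {v : E → ℂ}
    (hv : RapidL2 v) : SmoothL2 (oscQuad e v) := by
  rw [oscQuad_eq_sum hμ h.toAdmissible hv, Fin.sum_univ_three]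
  have h1 := fun i => SmoothL2.mul (h.smooth_cf i) (smoothL2_oscRoot hμ h 1 (hv.trig_mul i))
  exact ((h1 0).add (h1 1)).add (h1 2)

theorem oscRoot_add (hμ : 0 < μ) (h : Admissible μ A L e) (m : ℕ) {u v : E → ℂ}
    (hu : Integrable u) (hv : Integrable v) :
    oscRoot e m (fun ξ => u ξ + v ξ) = oscRoot e m u + oscRoot e m v :=
  osc_add (fun x => by have := measurable_invRoot e x; fun_prop) (norm_invRoot_pow_le hμ h m) hu hv

theorem measurable_quad_mul_invRoot (e : E → Matrix (Fin 2) (Fin 2) ℝ) (x : E) :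
    Measurable fun ξ => (quad e x ξ : ℂ) * invRoot e x ξ := by
  have := measurable_invRoot e x
  have := measurable_quad e x
  fun_prop

theorem Admissible.abs_quad_le (h : Admissible μ A L e) (x ξ : E) : |quad e x ξ| ≤ 3 * A := by
  have h0 := h.abs_cf0_le x
  have h1 := h.abs_cf1_le x
  have h2 := h.abs_cf2_le x
  have c1 : |cosD ξ| ≤ 1 := by simpa using isHomogeneousSymbol_cosD.norm_le ξ
  have c2 : |sinD ξ| ≤ 1 := by simpa using isHomogeneousSymbol_sinD.norm_le ξ
  have hA := (abs_nonneg _).trans h0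
  have m1 := mul_le_mul h1 c1 (abs_nonneg _) hA
  have m2 := mul_le_mul h2 c2 (abs_nonneg _) hA
  rw [← abs_mul, mul_one] at m1 m2
  rw [quad]
  have := abs_add_three (cf0 e x) (cf1 e x * cosD ξ) (cf2 e x * sinD ξ)
  linarith

theorem norm_quad_mul_invRoot_le (hμ : 0 < μ) (h : Admissible μ A L e) (x ξ : E) :
    ‖(quad e x ξ : ℂ) * invRoot e x ξ‖ ≤ 3 * A * (Real.sqrt μ)⁻¹ := by
  have h1 := norm_invRoot_pow_le hμ h 1 x ξ
  rw [pow_one, pow_one] at h1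
  rw [norm_mul]
  refine mul_le_mul ?_ h1 (norm_nonneg _) ?_
  · rw [Complex.norm_real]; exact h.abs_quad_le x ξ
  · exact (abs_nonneg _).trans (h.abs_quad_le x ξ)

theorem oscQuad_add (hμ : 0 < μ) (h : Admissible μ A L e) {u v : E → ℂ}
    (hu : Integrable u) (hv : Integrable v) :
    oscQuad e (fun ξ => u ξ + v ξ) = oscQuad e u + oscQuad e v :=
  osc_add (measurable_quad_mul_invRoot e) (norm_quad_mul_invRoot_le hμ h) hu hv

theorem opD_add (hμ : 0 < μ) (h : Admissible μ A L e) {u w : E → ℂ} (hu : SmoothL2 u)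
    (hw : SmoothL2 w) : opD e (u + w) = opD e u + opD e w := by
  simp only [opD_eq hμ h]
  rw [← oscQuad_add hμ h hu.l2Fourier.spatialNorm_mul.integrable
    hw.l2Fourier.spatialNorm_mul.integrable]
  refine osc_congr ?_
  filter_upwards [l2Fourier_add hu.memLp hw.memLp] with ξ hξ
  rw [hξ, Pi.add_apply, mul_add]

theorem opD_smul (hμ : 0 < μ) (h : Admissible μ A L e) (c : ℂ) {u : E → ℂ} (hu : SmoothL2 u) :
    opD e (c • u) = c • opD e u := by
  simp only [opD_eq hμ h]
  rw [oscQuad, oscQuad, ← osc_const_mul]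
  refine osc_congr ?_
  filter_upwards [l2Fourier_smul c hu.memLp] with ξ hξ
  rw [hξ, Pi.smul_apply, smul_eq_mul]; ring

theorem SmoothL2.opD (hμ : 0 < μ) (h : SmoothAdmissible μ A L B e) {w : E → ℂ} (hw : SmoothL2 w) :
    SmoothL2 (opD e w) := by
  rw [opD_eq hμ h.toAdmissible]
  exact smoothL2_oscQuad hμ h hw.l2Fourier.spatialNorm_mul

/-- The functions on which `1 / D` acts without singularity at `ξ' = 0`. -/
def InvDomain (u : E → ℂ) : Prop :=
  MemLp u 2 ∧ RapidL2 fun ξ => l2Fourier u ξ / (2 * Real.pi * spatialNorm ξ : ℝ)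

theorem opInvD_add (hμ : 0 < μ) (h : Admissible μ A L e) {u w : E → ℂ} (hu : InvDomain u)
    (hw : InvDomain w) : opInvD e (u + w) = opInvD e u + opInvD e w := by
  simp only [opInvD_eq hμ h]
  rw [← oscRoot_add hμ h 1 hu.2.integrable hw.2.integrable]
  refine osc_congr ?_
  filter_upwards [l2Fourier_add hu.1 hw.1] with ξ hξ
  rw [hξ, Pi.add_apply, add_div]

theorem opInvD_smul (hμ : 0 < μ) (h : Admissible μ A L e) (c : ℂ) {u : E → ℂ} (hu : MemLp u 2) :
    opInvD e (c • u) = c • opInvD e u := by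
  simp only [opInvD_eq hμ h]
  rw [oscRoot, oscRoot, ← osc_const_mul]
  refine osc_congr ?_
  filter_upwards [l2Fourier_smul c hu] with ξ hξ
  rw [hξ, Pi.smul_apply, smul_eq_mul, mul_div_assoc]

theorem InvDomain.const_smul {u : E → ℂ} (hu : InvDomain u) (c : ℂ) : InvDomain (c • u) := by
  refine ⟨hu.1.const_smul c, (hu.2.const_mul c).congr ?_⟩
  filter_upwards [l2Fourier_smul c hu.1] with ξ hξ
  rw [hξ, Pi.smul_apply, smul_eq_mul, mul_div_assoc]

/-! ### The operators D and 1/D combined with spatial derivatives -/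

theorem l2Fourier_pd_div {w : E → ℂ} (hw : SmoothL2 w) (j : Fin 3) :
    (fun ξ => l2Fourier (pd j w) ξ / (2 * Real.pi * spatialNorm ξ : ℝ))
      =ᵐ[volume] fun ξ => riesz j ξ * l2Fourier w ξ := by
  filter_upwards [l2Fourier_pd j hw.memLp hw.differentiable (hw.pd j).memLp] with ξ hξ
  rw [hξ, riesz]
  push_cast
  have : (2 * Real.pi : ℂ) ≠ 0 := by simp [Real.pi_ne_zero]
  rw [show (2 * (Real.pi : ℂ) * Complex.I * ξ j * l2Fourier w ξ)
    = 2 * Real.pi * (Complex.I * ξ j * l2Fourier w ξ) by ring, mul_div_mul_left _ _ this]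
  ring

/-- A spatial derivative compensates 1/|ξ'|: the quotient is a Riesz symbol, bounded also near ξ' =
0. The time derivative would not do. -/
theorem SmoothL2.invDomain_pd {w : E → ℂ} (hw : SmoothL2 w) {j : Fin 3} (hj : j ≠ 0) :
    InvDomain (MaxwellDiag.pd j w) :=
  ⟨(hw.pd j).memLp, (hw.l2Fourier.bdd_mul (isHomogeneousSymbol_riesz j hj).bdd).congr
    (l2Fourier_pd_div hw j).symm⟩

theorem opInvD_pd (hμ : 0 < μ) (h : Admissible μ A L e) {w : E → ℂ} (hw : SmoothL2 w)
    {j : Fin 3} (hj : j ≠ 0) :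
    opInvD e (pd j w) = osc (fun x ξ => (invRoot e x ξ : ℂ) * riesz j ξ) (l2Fourier w) := by
  rw [opInvD_eq hμ h, osc_mul_symbol _ (isHomogeneousSymbol_riesz j hj), oscRoot]
  simp only [pow_one]
  exact osc_congr (l2Fourier_pd_div hw j)

theorem riesz_sq_add_sq {ξ : E} (hξ : rho ξ ≠ 0) : riesz 1 ξ ^ 2 + riesz 2 ξ ^ 2 = -1 := by
  have h1 := spatialNorm_sq ξ
  have h0 : spatialNorm ξ ≠ 0 := fun h => hξ (by rw [← h1, h]; simp)
  have h2 : (ξ 1 / spatialNorm ξ) ^ 2 + (ξ 2 / spatialNorm ξ) ^ 2 = 1 := by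
    field_simp; rw [h1, rho]
  have h3 : ((ξ 1 / spatialNorm ξ : ℝ) : ℂ) ^ 2 + ((ξ 2 / spatialNorm ξ : ℝ) : ℂ) ^ 2 = 1 := by
    rw [← Complex.ofReal_pow, ← Complex.ofReal_pow, ← Complex.ofReal_add, h2, Complex.ofReal_one]
  rw [riesz, riesz, mul_pow, mul_pow, Complex.I_sq]
  linear_combination -h3

theorem spatialNorm_mul_riesz {ξ : E} (hξ : rho ξ ≠ 0) (k : Fin 3) :
    ((2 * Real.pi * spatialNorm ξ : ℝ) : ℂ) * riesz k ξ = 2 * Real.pi * Complex.I * ξ k := by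
  have h0 : (spatialNorm ξ : ℂ) ≠ 0 := by
    exact_mod_cast fun h => hξ (by rw [← spatialNorm_sq ξ, h]; simp)
  rw [riesz]; push_cast; field_simp

theorem ae_rho_ne_zero : ∀ᵐ ξ : E, rho ξ ≠ 0 := by
  have h : volume ((LinearMap.ker (EuclideanSpace.proj (1 : Fin 3) : E →L[ℝ] ℝ).toLinearMap :
      Submodule ℝ E) : Set E) = 0 := by
    refine Measure.addHaar_submodule _ _ fun h => ?_
    have h1 : EuclideanSpace.single (1 : Fin 3) (1 : ℝ) ∈
        LinearMap.ker (EuclideanSpace.proj (1 : Fin 3) : E →L[ℝ] ℝ).toLinearMap := by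
      rw [h]; trivial
    simp at h1
  filter_upwards [measure_eq_zero_iff_ae_notMem.1 h] with ξ h1 h2
  refine h1 ?_
  have : ξ 1 = 0 := by rw [rho] at h2; nlinarith [sq_nonneg (ξ 1), sq_nonneg (ξ 2)]
  simpa using this

/-- By `riesz_sq_add_sq`, |ξ'| is minus the sum of Riesz symbols times symbols of derivatives. D
thereby becomes a sum of bounded operators applied to ∂₁w and ∂₂w, which suits products w that are
no longer frequency localized. -/
theorem opD_eq_sub (hμ : 0 < μ) (h : Admissible μ A L e) {w : E → ℂ} (hw : SmoothL2 w) :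
    opD e w = -(osc (fun x ξ => (quad e x ξ : ℂ) * invRoot e x ξ * riesz 1 ξ) (l2Fourier (pd 1 w)) +
      osc (fun x ξ => (quad e x ξ : ℂ) * invRoot e x ξ * riesz 2 ξ) (l2Fourier (pd 2 w))) := by
  have hr : ∀ j : Fin 3, j ≠ 0 → Integrable fun ξ => riesz j ξ * l2Fourier (pd j w) ξ :=
    fun j hj => ((hw.pd j).l2Fourier.bdd_mul (isHomogeneousSymbol_riesz j hj).bdd).integrable
  rw [opD_eq hμ h, osc_mul_symbol _ (isHomogeneousSymbol_riesz 1 (by decide)),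
    osc_mul_symbol _ (isHomogeneousSymbol_riesz 2 (by decide))]
  have e1 := oscQuad_add hμ h (hr 1 (by decide)) (hr 2 (by decide))
  rw [oscQuad, oscQuad, oscQuad] at e1
  rw [← e1, ← neg_one_smul ℂ, ← osc_const_mul, oscQuad]
  refine osc_congr ?_
  filter_upwards [ae_rho_ne_zero, l2Fourier_pd 1 hw.memLp hw.differentiable (hw.pd 1).memLp,
    l2Fourier_pd 2 hw.memLp hw.differentiable (hw.pd 2).memLp] with ξ h0 h1 h2
  rw [h1, h2, ← spatialNorm_mul_riesz h0 1, ← spatialNorm_mul_riesz h0 2]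
  linear_combination ((2 * Real.pi * spatialNorm ξ : ℝ) * l2Fourier w ξ) * riesz_sq_add_sq h0

end

section

variable {μ A L B : ℝ} {e : E → Matrix (Fin 2) (Fin 2) ℝ}

/-! ### Calculus of square integral bounds -/

namespace L2Bound

variable {f g w : E → ℂ} {M N : ℝ}

theorem mono (h : L2Bound w M) (hMN : M ≤ N) : L2Bound w N :=
  ⟨h.1, h.2.trans (ENNReal.ofReal_le_ofReal hMN)⟩

theorem add (hf : L2Bound f M) (hg : L2Bound g N) (hM : 0 ≤ M) (hN : 0 ≤ N) :
    L2Bound (f + g) (M + N) := by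
  refine ⟨hf.1.add hg.1, (eLpNorm_add_le hf.1.1 hg.1.1 (by norm_num)).trans ?_⟩
  rw [ENNReal.ofReal_add hM hN]
  exact add_le_add hf.2 hg.2

theorem const_smul (hf : L2Bound f M) (c : ℂ) : L2Bound (c • f) (‖c‖ * M) := by
  refine ⟨hf.1.const_smul c, ?_⟩
  rw [eLpNorm_const_smul, ENNReal.ofReal_mul (norm_nonneg c), ofReal_norm]
  gcongr
  exact hf.2

theorem neg (hf : L2Bound f M) : L2Bound (-f) M := by
  have := hf.const_smul (-1)
  simpa using this

theorem sub (hf : L2Bound f M) (hg : L2Bound g N) (hM : 0 ≤ M) (hN : 0 ≤ N) :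
    L2Bound (f - g) (M + N) := by
  rw [sub_eq_add_neg]; exact hf.add hg.neg hM hN

theorem of_norm_le (hf : L2Bound f M) (hg : AEStronglyMeasurable g) {c : ℝ} (hc : 0 ≤ c)
    (h : ∀ᵐ x, ‖g x‖ ≤ c * ‖f x‖) : L2Bound g (c * M) := by
  refine ⟨hf.1.of_le_mul hg h, (eLpNorm_le_mul_eLpNorm_of_ae_le_mul h 2).trans ?_⟩
  rw [ENNReal.ofReal_mul hc]
  gcongr
  exact hf.2

theorem mul (hw : L2Bound w M) (hg : Measurable g) {c : ℝ} (hc : 0 ≤ c) (h : ∀ x, ‖g x‖ ≤ c) :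
    L2Bound (g * w) (c * M) :=
  hw.of_norm_le (hg.aestronglyMeasurable.mul hw.1.1) hc (Filter.Eventually.of_forall fun x => by
    rw [Pi.mul_apply, norm_mul]; exact mul_le_mul_of_nonneg_right (h x) (norm_nonneg _))

theorem l2Fourier (hw : L2Bound w M) : L2Bound (l2Fourier w) M :=
  ⟨memLp_l2Fourier w, (eLpNorm_l2Fourier hw.1).trans_le hw.2⟩

theorem sum {ι : Type} (s : Finset ι) {F : ι → E → ℂ} {N : ι → ℝ} (h : ∀ i ∈ s, L2Bound (F i) (N i))
    (hN : ∀ i ∈ s, 0 ≤ N i) : L2Bound (∑ i ∈ s, F i) (∑ i ∈ s, N i) := by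
  classical
  induction s using Finset.induction_on with
  | empty => exact ⟨by simp, by simp⟩
  | insert i s hi ih =>
    rw [Finset.sum_insert hi, Finset.sum_insert hi]
    exact (h i (by simp)).add (ih (fun j hj => h j (by simp [hj])) fun j hj => hN j (by simp [hj]))
      (hN i (by simp)) (Finset.sum_nonneg fun j hj => hN j (by simp [hj]))

end L2Bound

/-- Multiplication by the symbol of `∂ₖ`. -/
def freqMul (k : Fin 3) (v : E → ℂ) (ξ : E) : ℂ := 2 * Real.pi * Complex.I * ξ k * v ξ

/-- Rapidly decreasing functions supported at frequency `lam`. -/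
structure Packet (r R lam : ℝ) (v : E → ℂ) (N : ℝ) : Prop where
  rapid : RapidL2 v
  loc : Localized (annulus r R) lam v
  bound : L2Bound v N
  nonneg : 0 ≤ N

theorem measurableSet_annulus (r R : ℝ) : MeasurableSet (annulus r R) := by
  have := measurable_rho
  refine (measurableSet_le measurable_const this).inter
    ((measurableSet_le this measurable_const).inter (measurableSet_le
      (f := fun ξ : E => ξ 0 ^ 2) (g := fun _ => R) (by fun_prop) measurable_const))

namespace Packet

variable {r R lam N : ℝ} {v m : E → ℂ}

/-- The multiplier is controlled only on the frequency support of v, so it is first cut off there;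
the product is unchanged almost everywhere. -/
theorem mul (h : Packet r R lam v N) (hm : Measurable m) {c : ℝ} (hc : 0 ≤ c)
    (hmc : ∀ ξ, lam⁻¹ • ξ ∈ annulus r R → ‖m ξ‖ ≤ c) : Packet r R lam (fun ξ => m ξ * v ξ) (c * N) := by
  set S : Set E := {ξ | lam⁻¹ • ξ ∈ annulus r R}
  have hS : MeasurableSet S :=
    (measurable_const_smul (lam⁻¹ : ℝ) : Measurable fun ξ : E => lam⁻¹ • ξ) (measurableSet_annulus r R)
  have hb : ∀ ξ, ‖S.indicator m ξ‖ ≤ c := fun ξ => by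
    by_cases hξ : ξ ∈ S
    · rw [Set.indicator_of_mem hξ]; exact hmc ξ hξ
    · rw [Set.indicator_of_notMem hξ, norm_zero]; exact hc
  have he : (fun ξ => S.indicator m ξ * v ξ) =ᵐ[volume] fun ξ => m ξ * v ξ := by
    filter_upwards [h.loc] with ξ hξ
    by_cases h0 : v ξ = 0
    · simp [h0]
    · have hS' : ξ ∈ S := hξ h0
      rw [Set.indicator_of_mem hS']
  have hr := (h.rapid.bdd_mul ⟨hm.indicator hS, c, hb⟩).congr he
  refine ⟨hr, ?_, ?_, mul_nonneg hc h.nonneg⟩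
  · filter_upwards [h.loc] with ξ hξ h0
    exact hξ (right_ne_zero_of_mul h0)
  · refine h.bound.of_norm_le hr.memLp.1 hc ?_
    filter_upwards [h.loc] with ξ hξ
    by_cases h0 : v ξ = 0
    · simp [h0]
    · rw [norm_mul]; exact mul_le_mul_of_nonneg_right (hmc ξ (hξ h0)) (norm_nonneg _)

theorem mem_iff (hlam : 0 < lam) (ξ : E) : lam⁻¹ • ξ ∈ annulus r R ↔
    r * lam ^ 2 ≤ rho ξ ∧ rho ξ ≤ R * lam ^ 2 ∧ ξ 0 ^ 2 ≤ R * lam ^ 2 := by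
  have h2 : 0 < lam ^ 2 := by positivity
  have e1 : lam⁻¹ ^ 2 * rho ξ = rho ξ / lam ^ 2 := by field_simp
  have e2 : (lam⁻¹ • ξ) 0 ^ 2 = ξ 0 ^ 2 / lam ^ 2 := by
    rw [PiLp.smul_apply, smul_eq_mul]; field_simp
  simp only [annulus, Set.mem_ofPred_eq, rho_smul, e1, e2, le_div_iff₀ h2, div_le_iff₀ h2]

theorem coord_le (hlam : 0 < lam) {ξ : E} (hξ : lam⁻¹ • ξ ∈ annulus r R) (k : Fin 3) :
    |ξ k| ≤ Real.sqrt R * lam := by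
  obtain ⟨h1, h2, h3⟩ := (mem_iff hlam ξ).1 hξ
  have h4 : |ξ k| ≤ Real.sqrt (R * lam ^ 2) := by
    refine Real.abs_le_sqrt ?_
    rw [rho] at h2
    fin_cases k
    · exact h3
    · change ξ 1 ^ 2 ≤ _; nlinarith [sq_nonneg (ξ 2)]
    · change ξ 2 ^ 2 ≤ _; nlinarith [sq_nonneg (ξ 1)]
  rwa [Real.sqrt_mul' _ (by positivity), Real.sqrt_sq hlam.le] at h4

theorem freqMul (hlam : 0 < lam) (h : Packet r R lam v N) (k : Fin 3) :
    Packet r R lam (freqMul k v) (2 * Real.pi * (Real.sqrt R * lam) * N) :=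
  h.mul (m := fun ξ => 2 * Real.pi * Complex.I * ξ k) (by fun_prop) (by positivity) fun ξ hξ => by
    have := coord_le hlam hξ k
    have h5 : ‖(2 * Real.pi * Complex.I : ℂ)‖ = 2 * Real.pi := by
      simp [abs_of_pos Real.pi_pos]
    rw [norm_mul, h5, Complex.norm_real, Real.norm_eq_abs]
    gcongr

theorem symbol_mul (h : Packet r R lam v N) (hm : IsHomogeneousSymbol m) :
    Packet r R lam (fun ξ => m ξ * v ξ) N := by
  simpa using h.mul hm.measurable zero_le_one fun ξ _ => hm.norm_le ξ

theorem spatialNorm_mul (hlam : 0 < lam) (h : Packet r R lam v N) :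
    Packet r R lam (fun ξ => (2 * Real.pi * spatialNorm ξ : ℝ) * v ξ)
      (2 * Real.pi * (Real.sqrt R * lam) * N) :=
  h.mul (m := fun ξ => ((2 * Real.pi * spatialNorm ξ : ℝ) : ℂ))
    (by have := continuous_spatialNorm.measurable; fun_prop) (by positivity) fun ξ hξ => by
    obtain ⟨-, h2, -⟩ := (mem_iff hlam ξ).1 hξ
    have h3 : spatialNorm ξ ≤ Real.sqrt (R * lam ^ 2) := Real.sqrt_le_sqrt h2
    rw [Real.sqrt_mul' _ (by positivity), Real.sqrt_sq hlam.le] at h3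
    have := spatialNorm_nonneg ξ
    rw [Complex.norm_real, Real.norm_of_nonneg (by positivity)]
    gcongr

theorem div_spatialNorm (hr : 0 < r) (hlam : 0 < lam) (h : Packet r R lam v N) :
    Packet r R lam (fun ξ => v ξ / (2 * Real.pi * spatialNorm ξ : ℝ))
      ((2 * Real.pi * (Real.sqrt r * lam))⁻¹ * N) := by
  have := h.mul (m := fun ξ => (((2 * Real.pi * spatialNorm ξ : ℝ)⁻¹ : ℝ) : ℂ))
    (c := (2 * Real.pi * (Real.sqrt r * lam))⁻¹)
    (by have := continuous_spatialNorm.measurable; fun_prop) (by positivity) fun ξ hξ => by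
      obtain ⟨h2, -, -⟩ := (mem_iff hlam ξ).1 hξ
      have h3 : Real.sqrt (r * lam ^ 2) ≤ spatialNorm ξ := Real.sqrt_le_sqrt h2
      rw [Real.sqrt_mul' _ (by positivity), Real.sqrt_sq hlam.le] at h3
      have := spatialNorm_nonneg ξ
      rw [Complex.norm_real, Real.norm_of_nonneg (by positivity)]
      gcongr
  convert this using 2 with ξ
  rw [div_eq_inv_mul, Complex.ofReal_inv]

end Packet

theorem RapidL2.freqMul {v : E → ℂ} (hv : RapidL2 v) (k : Fin 3) : RapidL2 (freqMul k v) :=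
  hv.deriv_mul k

/-! ### Bounds for oscillatory integrals and their derivatives -/

theorem exists_l2Bound_oscRoot (m : ℕ) (hμ : 0 < μ) : ∃ C, 0 ≤ C ∧ ∀ e, Admissible μ A L e →
    ∀ v N, RapidL2 v → L2Bound v N → 0 ≤ N → L2Bound (oscRoot e m v) (C * N) := by
  obtain ⟨C, C', hC⟩ := exists_tensorBound_invRoot (A := A) (L := L) one_pos one_lt_two hμ
  -- The absolute value makes the constant nonnegative even if no admissible coefficients exist.
  refine ⟨|C ^ m|, abs_nonneg _, fun e h v N hv hN h0 => ?_⟩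
  exact (((hC e h).pow m).l2Bound_osc hv.integrable hN h0).mono
    (mul_le_mul_of_nonneg_right (le_abs_self _) h0)

theorem trig_bound {v : E → ℂ} {N : ℝ} (hN : L2Bound v N) (i : Fin 3) :
    L2Bound (fun ξ => trig i ξ * v ξ) N := by
  have := hN.mul (isHomogeneousSymbol_trig i).measurable zero_le_one (norm_trig_le i)
  rwa [one_mul] at this

/-- The difference consists of the terms in which ∂ₖ hits a coefficient. They involve only first
derivatives of coefficients, so the constant is independent of B. -/
theorem exists_l2Bound_pd_oscRoot (m : ℕ) (hμ : 0 < μ) : ∃ C, 0 ≤ C ∧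
    ∀ B e, SmoothAdmissible μ A L B e → ∀ (k : Fin 3) v N, RapidL2 v → L2Bound v N → 0 ≤ N →
      L2Bound (pd k (oscRoot e m v) - oscRoot e m (freqMul k v)) (C * N) := by
  obtain ⟨C, hC0, hC⟩ := exists_l2Bound_oscRoot (A := A) (L := L) (m + 2) hμ
  refine ⟨3 * (m / 2 * (|L| * C)), by positivity, fun B e h k v N hv hN h0 => ?_⟩
  have e1 : pd k (oscRoot e m v) - oscRoot e m (freqMul k v)
      = ∑ i, (-(m / 2 : ℂ)) • (pd k (cf e i) * oscRoot e (m + 2) fun ξ => trig i ξ * v ξ) := by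
    rw [pd_oscRoot hμ h m hv]; exact add_sub_cancel_left _ _
  rw [e1]
  have hc : ‖(-(m / 2 : ℂ))‖ = m / 2 := by
    rw [norm_neg, norm_div, Complex.norm_natCast]; simp
  refine (L2Bound.sum Finset.univ (N := fun _ => m / 2 * (|L| * (C * N))) (fun i _ => ?_)
    fun i _ => by positivity).mono (le_of_eq (by simp; ring))
  rw [← hc]
  exact ((hC e h.toAdmissible _ N (hv.trig_mul i) (trig_bound hN i) h0).mul
    ((h.smooth_cf i).pd k).bdd.1 (abs_nonneg L)
    fun x => (h.norm_pd_cf_le i k x).trans (le_abs_self L)).const_smul _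

/-- Second derivatives of coefficients, of size B, multiply only N, whereas N' accompanies at most
one derivative of a coefficient. In the application B is of order lam and N of order 1/lam. -/
theorem exists_l2Bound_pd_pd_oscRoot (hμ : 0 < μ) : ∃ C, 0 ≤ C ∧
    ∀ B e, SmoothAdmissible μ A L B e → ∀ (j k : Fin 3) v N N', RapidL2 v → L2Bound v N → 0 ≤ N →
      L2Bound (freqMul j v) N' → L2Bound (freqMul k v) N' → 0 ≤ N' →
      L2Bound (pd j (pd k (oscRoot e 1 v)) - oscRoot e 1 (freqMul j (freqMul k v)))
        (C * (N' + (1 + |B|) * N)) := by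
  obtain ⟨C1, h1, H1⟩ := exists_l2Bound_pd_oscRoot (A := A) (L := L) 1 hμ
  obtain ⟨C3, h3, H3⟩ := exists_l2Bound_pd_oscRoot (A := A) (L := L) 3 hμ
  obtain ⟨C, hC, H⟩ := exists_l2Bound_oscRoot (A := A) (L := L) 3 hμ
  refine ⟨C1 + 2 * C + 2 * |L| * (C3 + C), by positivity,
    fun B e h j k v N N' hv hN h0 hj hk h0' => ?_⟩
  set y : Fin 3 → E → ℂ := fun i ξ => trig i ξ * v ξ
  have hy : ∀ i, RapidL2 (y i) := fun i => hv.trig_mul i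
  have hS : ∀ i, SmoothL2 (oscRoot e 3 (y i)) := fun i => smoothL2_oscRoot hμ h 3 (hy i)
  have hP : ∀ i, SmoothL2 (pd k (cf e i) * oscRoot e 3 (y i)) := fun i =>
    SmoothL2.mul ((h.smooth_cf i).pd k) (hS i)
  have e0 : pd k (oscRoot e 1 v) = oscRoot e 1 (freqMul k v) +
      ∑ i, (-(1 / 2 : ℂ)) • (pd k (cf e i) * oscRoot e 3 (y i)) := by
    have := pd_oscRoot hμ h 1 hv k
    rw [Nat.cast_one] at this
    exact this
  have e1 : pd j (pd k (oscRoot e 1 v)) - oscRoot e 1 (freqMul j (freqMul k v))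
      = (pd j (oscRoot e 1 (freqMul k v)) - oscRoot e 1 (freqMul j (freqMul k v))) +
        ∑ i, (-(1 / 2 : ℂ)) • (pd j (pd k (cf e i)) * oscRoot e 3 (y i) +
          pd k (cf e i) * ((pd j (oscRoot e 3 (y i)) - oscRoot e 3 (freqMul j (y i))) +
            oscRoot e 3 (freqMul j (y i)))) := by
    have d1 := (smoothL2_oscRoot hμ h 1 (hv.freqMul k)).differentiable
    have d2 := fun i => ((hP i).const_smul (-(1 / 2 : ℂ))).differentiable
    rw [e0]
    simp only [Fin.sum_univ_three]
    rw [pd_add d1 (((d2 0).add (d2 1)).add (d2 2)), pd_add ((d2 0).add (d2 1)) (d2 2),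
      pd_add (d2 0) (d2 1)]
    simp only [pd_smul _ (hP _).differentiable,
      pd_mul ((h.smooth_cf _).pd k).differentiable (hS _).differentiable, sub_add_cancel]
    abel
  rw [e1]
  have hm : ‖(-(1 / 2 : ℂ))‖ = 1 / 2 := by simp
  have t1 := H1 B e h j _ N' (hv.freqMul k) hk h0'
  have t2 : ∀ i, L2Bound (pd j (pd k (cf e i)) * oscRoot e 3 (y i)) (|B| * (C * N)) := fun i =>
    (H e h.toAdmissible _ N (hy i) (trig_bound hN i) h0).mul
      (((h.smooth_cf i).pd k).pd j).bdd.1 (abs_nonneg B)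
      fun x => (h.second_cf i j k x).trans (le_abs_self B)
  have t3 : ∀ i, L2Bound (pd j (oscRoot e 3 (y i)) - oscRoot e 3 (freqMul j (y i))) (C3 * N) :=
    fun i => H3 B e h j _ N (hy i) (trig_bound hN i) h0
  have t4 : ∀ i, L2Bound (oscRoot e 3 (freqMul j (y i))) (C * N') := fun i => by
    have e2 : freqMul j (y i) = fun ξ => trig i ξ * freqMul j v ξ := by
      funext ξ; simp only [freqMul, y]; ring
    rw [e2]
    exact H e h.toAdmissible _ N' ((hv.freqMul j).trig_mul i) (trig_bound hj i) h0'
  have t5 : ∀ i, L2Bound ((-(1 / 2 : ℂ)) • (pd j (pd k (cf e i)) * oscRoot e 3 (y i) +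
          pd k (cf e i) * ((pd j (oscRoot e 3 (y i)) - oscRoot e 3 (freqMul j (y i))) +
            oscRoot e 3 (freqMul j (y i))))) (1 / 2 * (|B| * (C * N) + |L| * (C3 * N + C * N'))) :=
    fun i => by
    rw [← hm]
    exact ((t2 i).add (((t3 i).add (t4 i) (by positivity) (by positivity)).mul
      ((h.smooth_cf i).pd k).bdd.1 (abs_nonneg L)
      fun x => (h.norm_pd_cf_le i k x).trans (le_abs_self L)) (by positivity)
      (by positivity)).const_smul _
  refine (t1.add (L2Bound.sum Finset.univ (fun i _ => t5 i) fun i _ => by positivity)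
    (by positivity) (Finset.sum_nonneg fun i _ => by positivity)).mono ?_
  simp only [Finset.sum_const, Finset.card_univ, Fintype.card_fin, nsmul_eq_mul]
  have p1 : 0 ≤ C1 * N := by positivity
  have p2 : 0 ≤ C1 * (|B| * N) := by positivity
  have p3 : 0 ≤ C * N := by positivity
  have p4 : 0 ≤ C * (|B| * N) := by positivity
  have p5 : 0 ≤ |L| * (C3 * N) := by positivity
  have p6 : 0 ≤ |L| * (C * N') := by positivity
  have p7 : 0 ≤ |L| * (C3 * N') := by positivity
  have p8 : 0 ≤ C * N' := by positivity
  have p9 : 0 ≤ |L| * (C * N) := by positivity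
  have q1 : 0 ≤ |L| * (C3 * (|B| * N)) := by positivity
  have q2 : 0 ≤ |L| * (C * (|B| * N)) := by positivity
  push_cast
  linarith

end

section

variable {μ A L B : ℝ} {e : E → Matrix (Fin 2) (Fin 2) ℝ}

/-! ### Symbols with uniform tensor bounds -/

namespace TensorBound

variable {K : Set E} {b b' : E → E → ℂ} {C C' D D' : ℝ}

theorem nonneg (h : TensorBound K b C C') : 0 ≤ C ∧ 0 ≤ C' := by
  obtain ⟨ι, _, T, h1, h2⟩ := h
  exact ⟨(tsum_nonneg T.κ_nonneg).trans h1, (tsum_nonneg T.κ'_nonneg).trans h2⟩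

theorem norm_le (h : TensorBound K b C C') (x ξ : E) : ‖b x ξ‖ ≤ C := by
  obtain ⟨ι, _, T, h1, h2⟩ := h
  rw [← (T.hasSum x ξ).tsum_eq]
  exact (tsum_of_norm_bounded T.summable.hasSum fun i => T.norm_term_le i x ξ).trans h1

theorem measurable (h : TensorBound K b C C') (x : E) : Measurable (b x) := by
  obtain ⟨ι, _, T, -, -⟩ := h
  refine measurable_of_tendsto_metrizable' Filter.atTop
    (f := fun s : Finset ι => fun ξ => ∑ i ∈ s, T.c i x * T.m i ξ) (fun s => ?_)
    (tendsto_pi_nhds.2 fun ξ => T.hasSum x ξ)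
  have := fun i => (T.comm i).measurable
  fun_prop

theorem osc_l2Fourier_add (h : TensorBound K b C C') {z w : E → ℂ} (hz : SmoothL2 z)
    (hw : SmoothL2 w) :
    osc b (l2Fourier (z + w)) = osc b (l2Fourier z) + osc b (l2Fourier w) := by
  rw [← osc_add h.measurable h.norm_le hz.l2Fourier.integrable hw.l2Fourier.integrable]
  exact osc_congr (l2Fourier_add hz.memLp hw.memLp)

theorem l2Bound_osc_l2Fourier (h : TensorBound K b C C') {z : E → ℂ} (hz : SmoothL2 z) {N : ℝ}
    (hN : L2Bound z N) (h0 : 0 ≤ N) : L2Bound (osc b (l2Fourier z)) (C * N) :=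
  h.l2Bound_osc hz.l2Fourier.integrable hN.l2Fourier h0

/-- If `z` is close to `b'(x,D) y`, then `b(x,D) z` is close to `(b b')(x,D) y`. -/
theorem comp_of_close {r R lam N₁ N₂ : ℝ} (hb : TensorBound (annulus r R) b C C')
    (hb' : TensorBound (annulus r R) b' D D') (hlam : 0 < lam) {y z : E → ℂ}
    (hy : Packet r R lam y N₁) (hS : SmoothL2 (osc b' y)) (hz : SmoothL2 z)
    (hzy : L2Bound (z - osc b' y) N₂) (h0 : 0 ≤ N₂) :
    L2Bound (osc b (l2Fourier z) - osc (fun x ξ => b x ξ * b' x ξ) y)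
      (C * N₂ + C' * D' / lam * N₁) := by
  have h1 := hb.osc_l2Fourier_add (hz.sub hS) hS
  rw [sub_add_cancel] at h1
  rw [h1, add_sub_assoc]
  have hC := hb.nonneg
  have hD := hb'.nonneg
  exact (hb.l2Bound_osc_l2Fourier (hz.sub hS) hzy h0).add
    (hb.comp hb' hy.rapid.integrable hy.bound hy.nonneg hlam hy.loc hS.l2Fourier.integrable)
    (mul_nonneg hC.1 h0) (mul_nonneg (div_nonneg (mul_nonneg hC.2 hD.2) hlam.le) hy.nonneg)

end TensorBound

/-- All symbols needed have uniform tensor bounds. -/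
theorem exists_tensorBounds {r R : ℝ} (hr : 0 < r) (hR : r < R) (hμ : 0 < μ) :
    ∃ C, 0 ≤ C ∧ ∀ e, Admissible μ A L e →
      (∀ j, j ≠ 0 → TensorBound (annulus r R) (fun x ξ => (invRoot e x ξ : ℂ) * riesz j ξ) C C) ∧
      TensorBound (annulus r R) (fun x ξ => (quad e x ξ : ℂ) * invRoot e x ξ) C C ∧
      (∀ j, j ≠ 0 → TensorBound (annulus r R)
        (fun x ξ => (quad e x ξ : ℂ) * invRoot e x ξ * riesz j ξ) C C) ∧
      ∀ i j, TensorBound (annulus r R) (fun x ξ => (e x i j : ℂ) * invRoot e x ξ) C C := by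
  obtain ⟨C1, C1', h1⟩ := exists_tensorBound_invRoot (A := A) (L := L) hr hR hμ
  obtain ⟨C2, C2', h2⟩ := exists_tensorBound_quad (μ := μ) (A := A) (L := L) hr hR
  have h3 : ∃ M, ∀ j, j ≠ 0 → TensorBound (annulus r R) (fun _ ξ => riesz j ξ) M M := by
    obtain ⟨M1, hM1⟩ := (isHomogeneousSymbol_riesz 1 (by decide)).exists_commBound hr hR
    obtain ⟨M2, hM2⟩ := (isHomogeneousSymbol_riesz 2 (by decide)).exists_commBound hr hR
    have n1 := hM1.nonneg
    have n2 := hM2.nonneg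
    refine ⟨1 + M1 + M2, fun j hj => ?_⟩
    fin_cases j
    · exact absurd rfl hj
    · exact (TensorBound.multiplier hM1).mono (by linarith) (by linarith)
    · exact (TensorBound.multiplier hM2).mono (by linarith) (by linarith)
  obtain ⟨M, h3⟩ := h3
  have key : ∀ x y z w t u v s : ℝ, ∃ C, 0 ≤ C ∧ x ≤ C ∧ y ≤ C ∧ z ≤ C ∧ w ≤ C ∧ t ≤ C ∧ u ≤ C ∧
      v ≤ C ∧ s ≤ C := fun x y z w t u v s => by
    refine ⟨|x| + |y| + |z| + |w| + |t| + |u| + |v| + |s|, by positivity, ?_, ?_, ?_, ?_, ?_, ?_,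
      ?_, ?_⟩ <;>
    linarith [le_abs_self x, le_abs_self y, le_abs_self z, le_abs_self w, le_abs_self t,
      le_abs_self u, le_abs_self v, le_abs_self s, abs_nonneg x, abs_nonneg y, abs_nonneg z,
      abs_nonneg w, abs_nonneg t, abs_nonneg u, abs_nonneg v, abs_nonneg s]
  obtain ⟨C, h0, k1, k2, k3, k4, k5, k6, k7, k8⟩ := key (C1 * M) (C1' * M + C1 * M) (C2 * C1)
    (C2' * C1 + C2 * C1') (C2 * C1 * M) ((C2' * C1 + C2 * C1') * M + C2 * C1 * M) (A * C1)
    (L * C1 + A * C1')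
  refine ⟨C, h0, fun e h => ⟨fun j hj => ((h1 e h).mul (h3 j hj)).mono k1 k2,
    ((h2 e h).mul (h1 e h)).mono k3 k4, fun j hj =>
    (((h2 e h).mul (h1 e h)).mul (h3 j hj)).mono k5 k6, fun i j => ?_⟩⟩
  have h4 := TensorBound.coeff (K := annulus r R) (c := fun x => ((e x i j : ℝ) : ℂ)) (A := A)
    (L := L) (fun x => by rw [Complex.norm_real]; exact h.abs_le x i j)
    (fun x y => by rw [← Complex.ofReal_sub, Complex.norm_real]; exact h.lip x y i j)
  exact (h4.mul (h1 e h)).mono k7 k8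

/-! ### The error estimates -/

/-- Division by `2π|ξ'|`. -/
def recip (v : E → ℂ) (ξ : E) : ℂ := v ξ / (2 * Real.pi * spatialNorm ξ : ℝ)

theorem freqMul_recip (k : Fin 3) (v : E → ℂ) : freqMul k (recip v) = fun ξ => riesz k ξ * v ξ := by
  funext ξ
  simp only [freqMul, recip, riesz]
  push_cast
  have : (2 * Real.pi : ℂ) ≠ 0 := by simp [Real.pi_ne_zero]
  rw [show (2 * (Real.pi : ℂ) * Complex.I * ξ k * (v ξ / (2 * Real.pi * spatialNorm ξ)))
    = 2 * Real.pi * (Complex.I * ξ k * v ξ) / (2 * Real.pi * spatialNorm ξ) by ring,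
    mul_div_mul_left _ _ this]
  ring

/-- On packets 1/|ξ'| gains 1/lam, so ∂ₖ/D is bounded. The second derivatives of coefficients,
allowed to grow like lam, are compensated by the same gain. -/
theorem exists_l2Bound_deriv_recip {r R : ℝ} (hr : 0 < r) (hμ : 0 < μ) (B₀ : ℝ) :
    ∃ C, 0 ≤ C ∧ ∀ e lam v N, 1 ≤ lam → SmoothAdmissible μ A L (B₀ * lam) e →
      Packet r R lam v N → ∀ k, L2Bound (pd k (oscRoot e 1 (recip v))) (C * N) ∧
        ∀ j, L2Bound (pd j (pd k (oscRoot e 1 (recip v))) -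
          oscRoot e 1 (freqMul j (freqMul k (recip v)))) (C * N) := by
  obtain ⟨C1, h1, H1⟩ := exists_l2Bound_oscRoot (A := A) (L := L) 1 hμ
  obtain ⟨C2, h2, H2⟩ := exists_l2Bound_pd_oscRoot (A := A) (L := L) 1 hμ
  obtain ⟨C3, h3, H3⟩ := exists_l2Bound_pd_pd_oscRoot (A := A) (L := L) hμ
  have hs : 0 < Real.sqrt r := Real.sqrt_pos.2 hr
  set c := Real.sqrt R / Real.sqrt r
  set d := (2 * Real.pi * Real.sqrt r)⁻¹
  have hc : 0 ≤ c := by positivity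
  have hd : 0 ≤ d := by positivity
  refine ⟨(C2 * d + C1 * c) + C3 * (c + (1 + |B₀|) * d), by positivity,
    fun e lam v N hl h hv k => ?_⟩
  have hlam : 0 < lam := by linarith
  have hw := hv.div_spatialNorm hr hlam
  change Packet r R lam (recip v) _ at hw
  have hwk := fun k => hw.freqMul hlam k
  have n0 := hv.nonneg
  have e1 : 2 * Real.pi * (Real.sqrt R * lam) * ((2 * Real.pi * (Real.sqrt r * lam))⁻¹ * N)
      = c * N := by
    simp only [c]; field_simp
  have e2 : (2 * Real.pi * (Real.sqrt r * lam))⁻¹ * N ≤ d * N := by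
    refine mul_le_mul_of_nonneg_right (inv_anti₀ (by positivity) ?_) n0
    have : Real.sqrt r ≤ Real.sqrt r * lam := le_mul_of_one_le_right hs.le hl
    gcongr
  have e3 : (1 + |B₀ * lam|) * ((2 * Real.pi * (Real.sqrt r * lam))⁻¹ * N)
      ≤ (1 + |B₀|) * d * N := by
    rw [abs_mul, abs_of_pos hlam]
    have : (1 + |B₀| * lam) ≤ (1 + |B₀|) * lam := by linarith
    calc _ ≤ (1 + |B₀|) * lam * ((2 * Real.pi * (Real.sqrt r * lam))⁻¹ * N) := by gcongr
      _ = _ := by simp only [d]; field_simp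
  rw [e1] at hwk
  constructor
  · have t1 := H2 _ e h k _ _ hw.rapid hw.bound hw.nonneg
    have t2 := H1 e h.toAdmissible _ _ (hwk k).rapid (hwk k).bound (hwk k).nonneg
    have t3 := t1.add t2 (mul_nonneg h2 hw.nonneg) (mul_nonneg h1 (hwk k).nonneg)
    rw [sub_add_cancel] at t3
    refine t3.mono ?_
    have := mul_le_mul_of_nonneg_left e2 h2
    have p : 0 ≤ C3 * (c + (1 + |B₀|) * d) * N := by positivity
    linarith
  · intro j
    refine (H3 _ e h j k _ _ _ hw.rapid hw.bound hw.nonneg (hwk j).bound (hwk k).bound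
      (hwk k).nonneg).mono ?_
    have := mul_le_mul_of_nonneg_left e3 h3
    have p : 0 ≤ (C2 * d + C1 * c) * N := by positivity
    linarith

theorem norm_coeff_le (h : Admissible μ A L e) (i j : Fin 2) (x : E) : ‖(e x i j : ℂ)‖ ≤ A := by
  rw [Complex.norm_real]; exact h.abs_le x i j

theorem smoothL2_deriv_recip {r R lam N : ℝ} (hr : 0 < r) (hlam : 0 < lam) (hμ : 0 < μ)
    (h : SmoothAdmissible μ A L B e) {v : E → ℂ} (hv : Packet r R lam v N) :
    SmoothL2 (oscRoot e 1 (recip v)) :=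
  smoothL2_oscRoot hμ h 1 (hv.div_spatialNorm hr hlam).rapid

theorem osc_coeff_mul_invRoot (e : E → Matrix (Fin 2) (Fin 2) ℝ) (i j : Fin 2) (y : E → ℂ) :
    osc (fun x ξ => (e x i j : ℂ) * invRoot e x ξ) y = (fun x => (e x i j : ℂ)) * oscRoot e 1 y := by
  rw [osc_mul_coeff (fun x => (e x i j : ℂ)) (fun x ξ => (invRoot e x ξ : ℂ)), oscRoot]
  simp only [pow_one]

/-- The symbol of `e_{ij} ∂ₜ∂ₖ∂ₗ / D²`. -/
def third (e : E → Matrix (Fin 2) (Fin 2) ℝ) (i j : Fin 2) (k l : Fin 3) (v : E → ℂ) : E → ℂ :=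
  (fun x => (e x i j : ℂ)) * oscRoot e 2 fun ξ => riesz l ξ * freqMul 0 (fun ξ => riesz k ξ * v ξ) ξ

/-- Here D⁻¹∂ₗ is a bounded tensor symbol, and its argument is close to a tensor symbol applied to a
packet, so `TensorBound.comp_of_close` applies. In the second estimate ∂ₜ is first moved past the
coefficient, at the price of the bounded term (∂ₜ e_{ij}) ∂ₖD⁻¹. -/
theorem exists_l2Bound_third {r R : ℝ} (hr : 0 < r) (hR : r < R) (hμ : 0 < μ) (B₀ : ℝ) :
    ∃ C, 0 ≤ C ∧ ∀ e lam v N, 1 ≤ lam → SmoothAdmissible μ A L (B₀ * lam) e →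
      Packet r R lam v N → ∀ i j k l, k ≠ 0 → l ≠ 0 →
      L2Bound (opInvD e (pd l ((fun x => (e x i j : ℂ)) * pd 0 (pd k (oscRoot e 1 (recip v)))))
        - third e i j k l v) (C * N) ∧
      L2Bound (opInvD e (pd l (pd 0 ((fun x => (e x i j : ℂ)) * pd k (oscRoot e 1 (recip v)))))
        - third e i j k l v) (C * N) := by
  obtain ⟨C, hC0, hC⟩ := exists_tensorBounds (A := A) (L := L) hr hR hμ
  obtain ⟨C1, h1, H1⟩ := exists_l2Bound_deriv_recip (A := A) (L := L) (R := R) hr hμ B₀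
  refine ⟨C * (|A| * C1) + C * C * (2 * Real.pi * Real.sqrt R) + C * (|L| * C1), by positivity,
    fun e lam v N hl h hv i j k l hk hl0 => ?_⟩
  have hlam : 0 < lam := by linarith
  obtain ⟨T1, -, -, T4⟩ := hC e h.toAdmissible
  have hG := smoothL2_deriv_recip hr hlam hμ h hv
  have hy := (hv.symbol_mul (isHomogeneousSymbol_riesz k hk)).freqMul hlam 0
  have n0 := hv.nonneg
  set G := oscRoot e 1 (recip v)
  set y := freqMul 0 (fun ξ => riesz k ξ * v ξ)
  set α : E → ℂ := fun x => (e x i j : ℂ)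
  have hα : SmoothBdd α := h.smooth i j
  have hW : SmoothL2 (α * pd 0 (pd k G)) := SmoothL2.mul hα ((hG.pd k).pd 0)
  have hS : SmoothL2 (osc (fun x ξ => (e x i j : ℂ) * invRoot e x ξ) y) := by
    rw [osc_coeff_mul_invRoot]
    exact SmoothL2.mul hα (smoothL2_oscRoot hμ h 1 hy.rapid)
  have hclose : L2Bound (α * pd 0 (pd k G) - osc (fun x ξ => (e x i j : ℂ) * invRoot e x ξ) y)
      (|A| * (C1 * N)) := by
    rw [osc_coeff_mul_invRoot, ← mul_sub]
    refine L2Bound.mul ?_ hα.bdd.1 (abs_nonneg A)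
      fun x => (norm_coeff_le h.toAdmissible i j x).trans (le_abs_self A)
    have := ((H1 e lam v N hl h hv k).2 0)
    rwa [freqMul_recip] at this
  have hthird : osc (fun x ξ => (invRoot e x ξ : ℂ) * riesz l ξ * ((e x i j : ℂ) * invRoot e x ξ)) y
      = third e i j k l v := by
    rw [third, oscRoot, ← osc_mul_symbol _ (isHomogeneousSymbol_riesz l hl0), ← osc_mul_coeff]
    congr 1; funext x ξ; ring
  have k1 := (T1 l hl0).comp_of_close (T4 i j) hlam hy hS hW hclose (by positivity)
  rw [hthird, ← opInvD_pd hμ h.toAdmissible hW hl0] at k1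
  -- The packet `y` carries one derivative, of size lam, which the gain 1/lam of the composition
  -- compensates.
  have e1 : C * C / lam * (2 * Real.pi * (Real.sqrt R * lam) * N)
      = C * C * (2 * Real.pi * Real.sqrt R) * N := by field_simp
  rw [e1] at k1
  refine ⟨k1.mono ?_, ?_⟩
  · have : 0 ≤ C * (|L| * C1) * N := by positivity
    linarith
  · have hX : SmoothL2 (pd 0 α * pd k G) := SmoothL2.mul (hα.pd 0) (hG.pd k)
    have e2 : opInvD e (pd l (pd 0 (α * pd k G))) = opInvD e (pd l (pd 0 α * pd k G)) +
        opInvD e (pd l (α * pd 0 (pd k G))) := by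
      rw [pd_mul hα.differentiable (hG.pd k).differentiable,
        pd_add hX.differentiable hW.differentiable,
        opInvD_add hμ h.toAdmissible (hX.invDomain_pd hl0) (hW.invDomain_pd hl0)]
    rw [e2, add_sub_assoc]
    have k2 : L2Bound (pd 0 α * pd k G) (|L| * (C1 * N)) :=
      (H1 e lam v N hl h hv k).1.mul (hα.pd 0).bdd.1 (abs_nonneg L)
        fun x => (h.norm_pd_coeff_le i j 0 x).trans (le_abs_self L)
    have k3 := (T1 l hl0).l2Bound_osc_l2Fourier hX k2 (by positivity)
    rw [← opInvD_pd hμ h.toAdmissible hX hl0] at k3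
    exact (k3.add k1 (by positivity) (by positivity)).mono (by linarith)

theorem freqMul_symbol (k : Fin 3) (m v : E → ℂ) :
    freqMul k (fun ξ => m ξ * v ξ) = fun ξ => m ξ * freqMul k v ξ := by
  funext ξ; simp only [freqMul]; ring

theorem pd_oscRoot_zero (hμ : 0 < μ) (h : SmoothAdmissible μ A L B e) {v : E → ℂ}
    (hv : RapidL2 v) (k : Fin 3) : pd k (oscRoot e 0 v) = oscRoot e 0 (freqMul k v) := by
  rw [pd_oscRoot hμ h 0 hv k]
  simp
  rfl

/-- The product of the symbols of D⁻¹∂ₖ and D is that of ∂ₖ, since q (q^{-1/2})² = 1. D contributes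
a factor lam and the composition defect 1/lam. -/
theorem exists_l2Bound_opInvD_pd_opD {r R : ℝ} (hr : 0 < r) (hR : r < R) (hμ : 0 < μ) :
    ∃ C, 0 ≤ C ∧ ∀ B e lam v N, 1 ≤ lam → SmoothAdmissible μ A L B e →
      Packet r R lam v N → ∀ u, l2Fourier u =ᵐ[volume] v → ∀ k, k ≠ 0 →
      L2Bound (opInvD e (pd k (opD e u)) - pd k (oscRoot e 0 v)) (C * N) := by
  obtain ⟨C, hC0, hC⟩ := exists_tensorBounds (A := A) (L := L) hr hR hμ
  refine ⟨C * C * (2 * Real.pi * Real.sqrt R), by positivity,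
    fun B e lam v N hl h hv u hu k hk => ?_⟩
  have hlam : 0 < lam := by linarith
  obtain ⟨T1, T2, -, -⟩ := hC e h.toAdmissible
  have hy := hv.spatialNorm_mul hlam
  have e0 : opD e u = oscQuad e fun ξ => (2 * Real.pi * spatialNorm ξ : ℝ) * v ξ := by
    rw [opD_eq hμ h.toAdmissible]
    refine osc_congr ?_
    filter_upwards [hu] with ξ hξ
    rw [hξ]
  have hS := smoothL2_oscQuad hμ h hy.rapid
  have k1 := (T1 k hk).comp T2 hy.rapid.integrable hy.bound hy.nonneg hlam hy.loc
    hS.l2Fourier.integrable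
  change L2Bound (osc _ (l2Fourier (oscQuad e _)) - _) _ at k1
  rw [← opInvD_pd hμ h.toAdmissible hS hk, ← e0] at k1
  have e1 : C * C / lam * (2 * Real.pi * (Real.sqrt R * lam) * N)
      = C * C * (2 * Real.pi * Real.sqrt R) * N := by field_simp
  rw [e1] at k1
  convert k1 using 2
  rw [pd_oscRoot_zero hμ h hv.rapid, oscRoot]
  have e2 : (fun x ξ => (invRoot e x ξ : ℂ) * riesz k ξ * ((quad e x ξ : ℂ) * invRoot e x ξ))
      = fun x ξ => (invRoot e x ξ : ℂ) ^ 0 * riesz k ξ := by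
    funext x ξ
    have : (quad e x ξ : ℂ) * (invRoot e x ξ : ℂ) ^ 2 = 1 := by
      exact_mod_cast h.quad_mul_invRoot_sq hμ x ξ
    linear_combination riesz k ξ * this
  rw [e2, osc_mul_symbol _ (isHomogeneousSymbol_riesz k hk)]
  refine osc_congr ?_
  filter_upwards [ae_rho_ne_zero] with ξ hξ
  rw [freqMul, ← spatialNorm_mul_riesz hξ]; ring

/-- D is split by `opD_eq_sub` into bounded symbols acting on ∂ₗ(α ∂ₖD⁻¹v). When ∂ₗ hits α the term
is bounded; otherwise the symbols compose to α times Riesz factors, since q (q^{-1/2})² = 1 removes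
the roots. -/
theorem exists_l2Bound_opD_coeff {r R : ℝ} (hr : 0 < r) (hR : r < R) (hμ : 0 < μ) (B₀ : ℝ) :
    ∃ C, 0 ≤ C ∧ ∀ e lam v N, 1 ≤ lam → SmoothAdmissible μ A L (B₀ * lam) e →
      Packet r R lam v N → ∀ i j k, k ≠ 0 →
      L2Bound (opD e ((fun x => (e x i j : ℂ)) * pd k (oscRoot e 1 (recip v)))
        - pd k ((fun x => (e x i j : ℂ)) * oscRoot e 0 v)) (C * N) := by
  obtain ⟨C, hC0, hC⟩ := exists_tensorBounds (A := A) (L := L) hr hR hμ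
  obtain ⟨C1, h1, H1⟩ := exists_l2Bound_deriv_recip (A := A) (L := L) (R := R) hr hμ B₀
  obtain ⟨C2, h2, H2⟩ := exists_l2Bound_oscRoot (A := A) (L := L) 0 hμ
  set D := C * (|L| * C1) + (C * (|A| * C1) + C * C * (2 * Real.pi * Real.sqrt R))
  refine ⟨D + D + |L| * C2, by positivity, fun e lam v N hl h hv i j k hk => ?_⟩
  have hlam : 0 < lam := by linarith
  obtain ⟨-, -, T3, T4⟩ := hC e h.toAdmissible
  have hG := smoothL2_deriv_recip hr hlam hμ h hv
  have hy := fun l => (hv.symbol_mul (isHomogeneousSymbol_riesz k hk)).freqMul hlam l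
  have n0 := hv.nonneg
  set G := oscRoot e 1 (recip v)
  set y : Fin 3 → E → ℂ := fun l => freqMul l (fun ξ => riesz k ξ * v ξ)
  set α : E → ℂ := fun x => (e x i j : ℂ)
  have hα : SmoothBdd α := h.smooth i j
  have hW : ∀ l, SmoothL2 (α * pd l (pd k G)) := fun l => SmoothL2.mul hα ((hG.pd k).pd l)
  have hX : ∀ l, SmoothL2 (pd l α * pd k G) := fun l => SmoothL2.mul (hα.pd l) (hG.pd k)
  have hS : ∀ l, SmoothL2 (osc (fun x ξ => (e x i j : ℂ) * invRoot e x ξ) (y l)) := fun l => by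
    rw [osc_coeff_mul_invRoot]
    exact SmoothL2.mul hα (smoothL2_oscRoot hμ h 1 (hy l).rapid)
  have hclose : ∀ l, L2Bound (α * pd l (pd k G) -
      osc (fun x ξ => (e x i j : ℂ) * invRoot e x ξ) (y l)) (|A| * (C1 * N)) := fun l => by
    rw [osc_coeff_mul_invRoot, ← mul_sub]
    refine L2Bound.mul ?_ hα.bdd.1 (abs_nonneg A)
      fun x => (norm_coeff_le h.toAdmissible i j x).trans (le_abs_self A)
    have := ((H1 e lam v N hl h hv k).2 l)
    rwa [freqMul_recip] at this
  have e1 : C * C / lam * (2 * Real.pi * (Real.sqrt R * lam) * N)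
      = C * C * (2 * Real.pi * Real.sqrt R) * N := by field_simp
  have hsym : ∀ l, l ≠ 0 → osc (fun x ξ => (quad e x ξ : ℂ) * invRoot e x ξ * riesz l ξ *
      ((e x i j : ℂ) * invRoot e x ξ)) (y l) = α * oscRoot e 0 fun ξ => riesz l ξ * y l ξ :=
    fun l hl0 => by
    rw [oscRoot, ← osc_mul_symbol _ (isHomogeneousSymbol_riesz l hl0), ← osc_mul_coeff]
    congr 1; funext x ξ
    have : (quad e x ξ : ℂ) * (invRoot e x ξ : ℂ) ^ 2 = 1 := by
      exact_mod_cast h.quad_mul_invRoot_sq hμ x ξ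
    linear_combination (e x i j : ℂ) * riesz l ξ * this
  have k1 : ∀ l, l ≠ 0 → L2Bound (osc (fun x ξ => (quad e x ξ : ℂ) * invRoot e x ξ * riesz l ξ)
      (l2Fourier (pd l (α * pd k G))) - α * oscRoot e 0 fun ξ => riesz l ξ * y l ξ) (D * N) :=
    fun l hl0 => by
    rw [pd_mul hα.differentiable (hG.pd k).differentiable,
      (T3 l hl0).osc_l2Fourier_add (hX l) (hW l), add_sub_assoc]
    have k2 : L2Bound (pd l α * pd k G) (|L| * (C1 * N)) :=
      (H1 e lam v N hl h hv k).1.mul (hα.pd l).bdd.1 (abs_nonneg L)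
        fun x => (h.norm_pd_coeff_le i j l x).trans (le_abs_self L)
    have k3 := (T3 l hl0).l2Bound_osc_l2Fourier (hX l) k2 (by positivity)
    have k4 := (T3 l hl0).comp_of_close (T4 i j) hlam (hy l) (hS l) (hW l) (hclose l) (by positivity)
    rw [hsym l hl0, e1] at k4
    exact (k3.add k4 (by positivity) (by positivity)).mono (by simp only [D]; linarith)
  -- The squared Riesz symbols sum to -1, so the two pieces recombine to -∂ₖ.
  have hsum : (oscRoot e 0 fun ξ => riesz 1 ξ * y 1 ξ) + (oscRoot e 0 fun ξ => riesz 2 ξ * y 2 ξ)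
      = -oscRoot e 0 (freqMul k v) := by
    have hi : ∀ l, l ≠ 0 → Integrable fun ξ => riesz l ξ * y l ξ := fun l hl0 =>
      ((hy l).rapid.bdd_mul (isHomogeneousSymbol_riesz l hl0).bdd).integrable
    rw [← oscRoot_add hμ h.toAdmissible 0 (hi 1 (by decide)) (hi 2 (by decide)),
      ← neg_one_smul ℂ (oscRoot e 0 (freqMul k v)), oscRoot, oscRoot, ← osc_const_mul]
    refine osc_congr ?_
    filter_upwards [ae_rho_ne_zero] with ξ hξ
    simp only [y, freqMul, ← spatialNorm_mul_riesz hξ]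
    linear_combination (2 * Real.pi * spatialNorm ξ : ℝ) * riesz k ξ * v ξ * riesz_sq_add_sq hξ
  have e2 : opD e (α * pd k G) - pd k (α * oscRoot e 0 v)
      = -((osc (fun x ξ => (quad e x ξ : ℂ) * invRoot e x ξ * riesz 1 ξ)
          (l2Fourier (pd 1 (α * pd k G))) - α * oscRoot e 0 fun ξ => riesz 1 ξ * y 1 ξ) +
        (osc (fun x ξ => (quad e x ξ : ℂ) * invRoot e x ξ * riesz 2 ξ)
          (l2Fourier (pd 2 (α * pd k G))) - α * oscRoot e 0 fun ξ => riesz 2 ξ * y 2 ξ))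
        - pd k α * oscRoot e 0 v := by
    rw [opD_eq_sub hμ h.toAdmissible (SmoothL2.mul hα (hG.pd k)),
      pd_mul hα.differentiable (smoothL2_oscRoot hμ h 0 hv.rapid).differentiable,
      pd_oscRoot_zero hμ h hv.rapid]
    linear_combination -α * hsum
  rw [e2]
  have k5 : L2Bound (pd k α * oscRoot e 0 v) (|L| * (C2 * N)) :=
    (H2 e h.toAdmissible v N hv.rapid hv.bound n0).mul (hα.pd k).bdd.1 (abs_nonneg L)
      fun x => (h.norm_pd_coeff_le i j k x).trans (le_abs_self L)
  have hD : 0 ≤ D * N := by positivity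
  exact (((k1 1 (by decide)).add (k1 2 (by decide)) hD hD).neg.sub k5 (by positivity)
    (by positivity)).mono (by linarith)

end

section

/-! ### Averages of coefficients against rescaled Schwartz kernels -/

/-- Bounded Lipschitz functions of class `C¹`. -/
structure C1Coeff (G L : ℝ) (γ : E → ℂ) : Prop where
  contDiff : ContDiff ℝ 1 γ
  norm_le : ∀ x, ‖γ x‖ ≤ G
  lip : ∀ x y, ‖γ x - γ y‖ ≤ L * ‖x - y‖

/-- The average of `γ` against the kernel `R³ κ(R ·)`. -/
def avg (R : ℝ) (κ : 𝓢(E, ℂ)) (γ : E → ℂ) (x : E) : ℂ := ∫ z, γ (x - R⁻¹ • z) * κ z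

/-- The partial derivative of a Schwartz function. -/
def schwartzPd (k : Fin 3) (κ : 𝓢(E, ℂ)) : 𝓢(E, ℂ) :=
  LineDeriv.lineDerivOp (EuclideanSpace.single k (1 : ℝ)) κ

variable {G L R : ℝ} {γ : E → ℂ}

namespace C1Coeff

theorem integrable (h : C1Coeff G L γ) (R : ℝ) (κ : 𝓢(E, ℂ)) (x : E) :
    Integrable fun z => γ (x - R⁻¹ • z) * κ z :=
  κ.integrable.bdd_mul (c := G)
    (h.contDiff.continuous.comp (by fun_prop)).aestronglyMeasurable
    (Filter.Eventually.of_forall fun z => h.norm_le _)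

theorem norm_avg_le (h : C1Coeff G L γ) (R : ℝ) (κ : 𝓢(E, ℂ)) (x : E) :
    ‖avg R κ γ x‖ ≤ G * ∫ z, ‖κ z‖ := by
  rw [avg, ← integral_const_mul]
  refine norm_integral_le_of_norm_le (κ.integrable.norm.const_mul G)
    (Filter.Eventually.of_forall fun z => ?_)
  rw [norm_mul]
  exact mul_le_mul_of_nonneg_right (h.norm_le _) (norm_nonneg _)

theorem lip_avg (h : C1Coeff G L γ) (R : ℝ) (κ : 𝓢(E, ℂ)) (x y : E) :
    ‖avg R κ γ x - avg R κ γ y‖ ≤ (L * ∫ z, ‖κ z‖) * ‖x - y‖ := by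
  rw [avg, avg, ← integral_sub (h.integrable R κ x) (h.integrable R κ y), mul_right_comm,
    ← integral_const_mul]
  refine norm_integral_le_of_norm_le (κ.integrable.norm.const_mul _)
    (Filter.Eventually.of_forall fun z => ?_)
  rw [← sub_mul, norm_mul]
  refine mul_le_mul_of_nonneg_right ?_ (norm_nonneg _)
  simpa using h.lip (x - R⁻¹ • z) (y - R⁻¹ • z)

theorem norm_avg_sub_le (h : C1Coeff G L γ) (hR : 0 < R) (κ : 𝓢(E, ℂ)) (hκ : ∫ z, κ z = 1) (x : E) :
    ‖avg R κ γ x - γ x‖ ≤ L / R * ∫ z, ‖z‖ * ‖κ z‖ := by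
  have e : γ x = ∫ z, γ x * κ z := by rw [integral_const_mul, hκ, mul_one]
  have hi : Integrable fun z => ‖z‖ * ‖κ z‖ := by simpa using κ.integrable_pow_mul volume 1
  rw [avg, e, ← integral_sub (h.integrable R κ x) (κ.integrable.const_mul _), ← integral_const_mul]
  refine norm_integral_le_of_norm_le (hi.const_mul _) (Filter.Eventually.of_forall fun z => ?_)
  rw [← sub_mul, norm_mul, ← mul_assoc]
  refine mul_le_mul_of_nonneg_right ((h.lip _ _).trans (le_of_eq ?_)) (norm_nonneg _)
  rw [sub_sub_cancel_left, norm_neg, norm_smul, Real.norm_of_nonneg (by positivity)]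
  ring

theorem differentiable (h : C1Coeff G L γ) : Differentiable ℝ γ :=
  h.contDiff.differentiable (by norm_num)

theorem norm_fderiv_le (h : C1Coeff G L γ) (x : E) : ‖fderiv ℝ γ x‖ ≤ L :=
  norm_fderiv_le_of_lip' ℝ (lipschitz_nonneg h.lip) (Filter.Eventually.of_forall fun y => h.lip y x)

theorem integrable_fderiv (h : C1Coeff G L γ) (R : ℝ) (κ : 𝓢(E, ℂ)) (x : E) :
    Integrable fun z => κ z • fderiv ℝ γ (x - R⁻¹ • z) := by
  refine (κ.integrable.norm.mul_const L).mono' ?_ (Filter.Eventually.of_forall fun z => ?_)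
  · have h1 := (h.contDiff.continuous_fderiv (by norm_num)).comp
      (by fun_prop : Continuous fun z : E => x - R⁻¹ • z)
    exact (κ.continuous.smul h1).aestronglyMeasurable
  · rw [norm_smul]
    exact mul_le_mul_of_nonneg_left (h.norm_fderiv_le _) (norm_nonneg _)

theorem hasFDerivAt_avg (h : C1Coeff G L γ) (R : ℝ) (κ : 𝓢(E, ℂ)) (x : E) :
    HasFDerivAt (avg R κ γ) (∫ z, κ z • fderiv ℝ γ (x - R⁻¹ • z)) x := by
  refine hasFDerivAt_integral_of_dominated_of_fderiv_le (s := Set.univ)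
    (F' := fun x z => κ z • fderiv ℝ γ (x - R⁻¹ • z)) (bound := fun z => ‖κ z‖ * L) Filter.univ_mem
    (Filter.Eventually.of_forall fun y => (h.integrable R κ y).aestronglyMeasurable)
    (h.integrable R κ x) (h.integrable_fderiv R κ x).aestronglyMeasurable
    (Filter.Eventually.of_forall fun z y _ => ?_) (κ.integrable.norm.mul_const L)
    (Filter.Eventually.of_forall fun z y _ => ?_)
  · rw [norm_smul]
    exact mul_le_mul_of_nonneg_left (h.norm_fderiv_le _) (norm_nonneg _)
  · have h1 := (h.differentiable (y - R⁻¹ • z)).hasFDerivAt.comp y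
      ((hasFDerivAt_id y).sub_const (R⁻¹ • z))
    simpa using h1.mul_const (κ z)

/-- Integration by parts moves the derivative onto the kernel at the cost of a factor R. Averages of
γ against Schwartz kernels are thus stable under differentiation although γ is only C¹. -/
theorem pd_avg (h : C1Coeff G L γ) (hR : 0 < R) (κ : 𝓢(E, ℂ)) (k : Fin 3) :
    pd k (avg R κ γ) = (R : ℂ) • avg R (schwartzPd k κ) γ := by
  funext x
  set v : E := EuclideanSpace.single k (1 : ℝ)
  have hi := h.integrable_fderiv R κ x
  rw [pd, (h.hasFDerivAt_avg R κ x).fderiv, ContinuousLinearMap.integral_apply hi, Pi.smul_apply,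
    smul_eq_mul]
  have hd : ∀ z, HasFDerivAt (fun z => γ (x - R⁻¹ • z))
      ((fderiv ℝ γ (x - R⁻¹ • z)).comp (-(R⁻¹ • ContinuousLinearMap.id ℝ E))) z := fun z =>
    (h.differentiable (x - R⁻¹ • z)).hasFDerivAt.comp z
      (((hasFDerivAt_id z).const_smul R⁻¹).const_sub x)
  have hf : ∀ z, fderiv ℝ (fun z => γ (x - R⁻¹ • z)) z v
      = -(R⁻¹ : ℂ) * fderiv ℝ γ (x - R⁻¹ • z) v := fun z => by
    rw [(hd z).fderiv]
    simp [Complex.real_smul]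
  have hi' : Integrable fun z => fderiv ℝ (fun z => γ (x - R⁻¹ • z)) z v * κ z := by
    have := (ContinuousLinearMap.integrable_comp (ContinuousLinearMap.apply ℝ ℂ v) hi).const_mul
      (-(R⁻¹ : ℂ))
    refine this.congr (Filter.Eventually.of_forall fun z => ?_)
    simp only [hf, ContinuousLinearMap.apply_apply, smul_apply, smul_eq_mul]; ring
  have key := integral_mul_fderiv_eq_neg_fderiv_mul_of_integrable (μ := volume)
    (f := fun z => γ (x - R⁻¹ • z)) (g := κ) (v := v) hi'
    (h.integrable R (schwartzPd k κ) x) (h.integrable R κ x) (fun z _ => (hd z).differentiableAt)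
    (fun z _ => κ.differentiableAt)
  have hR0 : (R : ℂ) ≠ 0 := by exact_mod_cast hR.ne'
  change ∫ z, (κ z • fderiv ℝ γ (x - R⁻¹ • z)) v = (R : ℂ) * ∫ z, γ (x - R⁻¹ • z) * fderiv ℝ κ z v
  rw [key, ← integral_neg, ← integral_const_mul]
  refine integral_congr_ae (Filter.Eventually.of_forall fun z => ?_)
  simp only [hf, smul_apply, smul_eq_mul]
  field_simp

theorem differentiable_avg (h : C1Coeff G L γ) (R : ℝ) (κ : 𝓢(E, ℂ)) :
    Differentiable ℝ (avg R κ γ) := fun x => (h.hasFDerivAt_avg R κ x).differentiableAt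

theorem smoothBdd_avg (h : C1Coeff G L γ) (hR : 0 < R) (κ : 𝓢(E, ℂ)) : SmoothBdd (avg R κ γ) := by
  refine SmoothBdd.of_stable (P := fun g => ∃ (c : ℂ) (κ : 𝓢(E, ℂ)), g = c • avg R κ γ) ?_
    ⟨1, κ, (one_smul _ _).symm⟩
  rintro _ ⟨c, κ, rfl⟩
  have hd := h.differentiable_avg R κ
  refine ⟨⟨(hd.const_smul c).continuous.measurable, ‖c‖ * (G * ∫ z, ‖κ z‖), fun x => ?_⟩,
    hd.const_smul c, fun k => ⟨c * R, schwartzPd k κ, ?_⟩⟩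
  · rw [Pi.smul_apply, norm_smul]
    exact mul_le_mul_of_nonneg_left (h.norm_avg_le R κ x) (norm_nonneg _)
  · rw [pd_smul c hd, h.pd_avg hR, smul_smul]

/-- Both derivatives fall on the kernel. With R = lam^{1/2} the cost is lam, which is all that the
error estimates can afford. -/
theorem norm_pd_pd_avg_le (h : C1Coeff G L γ) (hR : 0 < R) (κ : 𝓢(E, ℂ)) (k l : Fin 3) (x : E) :
    ‖pd k (pd l (avg R κ γ)) x‖ ≤ R ^ 2 * (G * ∫ z, ‖schwartzPd k (schwartzPd l κ) z‖) := by
  rw [h.pd_avg hR, pd_smul _ (h.differentiable_avg R _), h.pd_avg hR, smul_smul, Pi.smul_apply,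
    norm_smul, ← sq, norm_pow, Complex.norm_real, Real.norm_of_nonneg hR.le]
  exact mul_le_mul_of_nonneg_left (h.norm_avg_le R _ x) (by positivity)

end C1Coeff

/-- The kernels of low-frequency truncations are rescaled Schwartz functions of integral one. -/
theorem exists_schwartz_kernel {χ : E → ℝ} (hχ : IsLowFrequencyCutoff χ) :
    ∃ κ : 𝓢(E, ℂ), ∫ z, κ z = 1 ∧
      ∀ R, 0 < R → ∀ y, (truncKernel χ R y : ℂ) = (R : ℂ) ^ 3 * κ (R • y) := by
  obtain ⟨h1, h2, h3, h4⟩ := hχ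
  have h1' : ContDiff ℝ ∞ fun ξ => (χ ξ : ℂ) := Complex.ofRealCLM.contDiff.comp h1
  set φ : 𝓢(E, ℂ) := (h2.comp_left Complex.ofReal_zero : HasCompactSupport fun ξ => (χ ξ : ℂ)).toSchwartzMap h1'
  have hπ : (2 * Real.pi : ℝ) ≠ 0 := by positivity
  have hφ : ∀ ξ, φ ξ = (χ ξ : ℂ) := fun ξ => rfl
  set g : E ≃L[ℝ] E := ContinuousLinearEquiv.smulLeft (Units.mk0 (2 * Real.pi)⁻¹ (inv_ne_zero hπ))
  set κ : 𝓢(E, ℂ) := ((2 * Real.pi : ℂ) ^ 3)⁻¹ • compCLMOfContinuousLinearEquiv ℂ g (𝓕 φ)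
  have hκ : ∀ y, κ y = ((2 * Real.pi : ℂ) ^ 3)⁻¹ * 𝓕 (φ : E → ℂ) ((2 * Real.pi)⁻¹ • y) := fun y => by
    simp only [κ, smul_apply, compCLMOfContinuousLinearEquiv_apply, Function.comp_apply,
      smul_eq_mul, fourier_coe]
    rfl
  -- Evenness of χ allows either sign in the phase; the mean of the two exponentials is the cosine.
  have hF : ∀ y, 𝓕 (φ : E → ℂ) ((2 * Real.pi)⁻¹ • y) = ((∫ ξ, χ ξ * Real.cos (inner ℝ y ξ) : ℝ) : ℂ) := by
    intro y
    have i1 : 𝓕 (φ : E → ℂ) ((2 * Real.pi)⁻¹ • y)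
        = ∫ ξ, (χ ξ : ℂ) * Complex.exp (-((inner ℝ y ξ : ℝ) : ℂ) * Complex.I) := by
      rw [Real.fourier_eq']
      congr 1; funext ξ
      rw [hφ, smul_eq_mul, mul_comm, real_inner_smul_right, real_inner_comm]
      congr 3
      push_cast
      have : (Real.pi : ℂ) ≠ 0 := by simp [Real.pi_ne_zero]
      field_simp
    have i2 : 𝓕 (φ : E → ℂ) ((2 * Real.pi)⁻¹ • y)
        = ∫ ξ, (χ ξ : ℂ) * Complex.exp (((inner ℝ y ξ : ℝ) : ℂ) * Complex.I) := by
      rw [i1, ← integral_neg_eq_self]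
      congr 1; funext ξ
      rw [h3, inner_neg_right]; push_cast; rw [neg_neg]
    have hχi : Integrable fun ξ => (χ ξ : ℂ) := φ.integrable
    have hj : ∀ s : ℝ, Integrable fun ξ => (χ ξ : ℂ) *
        Complex.exp (((s * inner ℝ y ξ : ℝ) : ℂ) * Complex.I) := fun s =>
      hχi.mul_bdd (c := 1) (by fun_prop) (Filter.Eventually.of_forall fun ξ => by
        rw [Complex.norm_exp_ofReal_mul_I])
    have j1 := hj (-1)
    have j2 := hj 1
    simp only [neg_one_mul, one_mul, Complex.ofReal_neg] at j1 j2
    have i3 : 2 * 𝓕 (φ : E → ℂ) ((2 * Real.pi)⁻¹ • y)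
        = 2 * ((∫ ξ, χ ξ * Real.cos (inner ℝ y ξ) : ℝ) : ℂ) := by
      rw [two_mul]
      nth_rewrite 1 [i2]
      rw [i1, ← integral_add j2 j1, ← integral_complex_ofReal, ← integral_const_mul]
      congr 1; funext ξ
      push_cast
      rw [Complex.cos]; ring
    exact mul_left_cancel₀ two_ne_zero i3
  refine ⟨κ, ?_, fun R hR y => ?_⟩
  · simp only [hκ]
    rw [integral_const_mul, Measure.integral_comp_smul (μ := (volume : Measure E))]
    -- Fourier inversion at the origin, where χ equals 1.
    have hφ0 : ∫ ξ, 𝓕 (φ : E → ℂ) ξ = 1 := by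
      have e1 : 𝓕⁻ (𝓕 (φ : E → ℂ)) 0 = φ 0 := by
        have := congrArg (fun f : 𝓢(E, ℂ) => f 0) (FourierTransform.fourierInv_fourier_eq (F := 𝓢(E, ℂ)) φ)
        simpa only [fourierInv_coe, fourier_coe] using this
      rw [Real.fourierInv_eq'] at e1
      simp only [inner_zero_right, mul_zero, Complex.ofReal_zero, zero_mul, Complex.exp_zero,
        one_smul] at e1
      rw [e1, hφ, h4.self_of_nhds, Complex.ofReal_one]
    rw [hφ0, finrank_euclideanSpace, Fintype.card_fin, abs_of_pos (by positivity), inv_pow, inv_inv,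
      Complex.real_smul]
    have : (Real.pi : ℂ) ≠ 0 := by simp [Real.pi_ne_zero]
    push_cast
    field_simp
  · rw [hκ, hF, truncKernel]
    have e1 := Measure.integral_comp_smul (μ := (volume : Measure E))
      (fun ξ => χ ξ * Real.cos (inner ℝ (R • y) ξ)) R⁻¹
    have e2 : ∀ ξ : E, inner ℝ (R • y) (R⁻¹ • ξ) = inner ℝ y ξ := fun ξ => by
      rw [real_inner_smul_left, real_inner_smul_right, mul_inv_cancel_left₀ hR.ne']
    simp only [e2, finrank_euclideanSpace, Fintype.card_fin] at e1
    rw [e1, abs_of_pos (by positivity), inv_pow, inv_inv, smul_eq_mul]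
    push_cast; ring

theorem ofReal_truncate {χ : E → ℝ} {κ : 𝓢(E, ℂ)}
    (hκ : ∀ R, 0 < R → ∀ y, (truncKernel χ R y : ℂ) = (R : ℂ) ^ 3 * κ (R • y)) {R : ℝ} (hR : 0 < R)
    (g : E → ℝ) (x : E) : (truncate χ R g x : ℂ) = avg R κ (fun x => (g x : ℂ)) x := by
  rw [truncate, ← integral_complex_ofReal, avg]
  push_cast
  simp only [hκ R hR]
  have := Measure.integral_comp_smul (μ := (volume : Measure E))
    (fun z => (g (x - R⁻¹ • z) : ℂ) * κ z) R
  simp only [inv_smul_smul₀ hR.ne', finrank_euclideanSpace, Fintype.card_fin] at this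
  rw [abs_of_pos (by positivity), Complex.real_smul] at this
  have hR0 : (R : ℂ) ≠ 0 := by exact_mod_cast hR.ne'
  calc _ = (R : ℂ) ^ 3 * ∫ y, (g (x - y) : ℂ) * κ (R • y) := by
        rw [← integral_const_mul]; congr 1; funext y; ring
    _ = _ := by rw [this]; push_cast; field_simp

end

section

/-! ### The truncated inverse permittivity -/

variable {Λ₁ Λ₂ K : ℝ} {ε : E → Matrix (Fin 2) (Fin 2) ℝ}

theorem IsElliptic.form_le (h : IsElliptic Λ₁ Λ₂ ε) (x : E) (s t : ℝ) :
    Λ₁ * (s ^ 2 + t ^ 2) ≤ ε x 0 0 * s ^ 2 + 2 * ε x 0 1 * s * t + ε x 1 1 * t ^ 2 ∧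
      ε x 0 0 * s ^ 2 + 2 * ε x 0 1 * s * t + ε x 1 1 * t ^ 2 ≤ Λ₂ * (s ^ 2 + t ^ 2) := by
  obtain ⟨h1, h2⟩ := h x
  have h3 := h2 ![s, t]
  simp only [Fin.sum_univ_two, Matrix.cons_val_zero, Matrix.cons_val_one] at h3
  rw [h1 1 0] at h3
  constructor <;> linarith [h3.1, h3.2]

/-- The lower bound follows from the nonnegative determinant of ε - Λ₁ together with diagonal
entries at least Λ₁; the upper bound from diagonal entries at most Λ₂. -/
theorem IsElliptic.det_bounds (hΛ₁ : 0 < Λ₁) (h : IsElliptic Λ₁ Λ₂ ε) (x : E) :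
    Λ₁ ^ 2 ≤ (ε x).det ∧ (ε x).det ≤ Λ₂ ^ 2 := by
  have a := h.form_le x 1 0
  have b := h.form_le x 0 1
  have c := h.form_le x
  have hs := (h x).1 1 0
  rw [Matrix.det_fin_two, hs]
  have hd : discrim (ε x 0 0 - Λ₁) (2 * ε x 0 1) (ε x 1 1 - Λ₁) ≤ 0 := by
    refine discrim_le_zero fun s => ?_
    have := (c s 1).1
    nlinarith
  rw [discrim] at hd
  have a1 : Λ₁ ≤ ε x 0 0 := by linarith [a.1]
  have a2 : ε x 0 0 ≤ Λ₂ := by linarith [a.2]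
  have b1 : Λ₁ ≤ ε x 1 1 := by linarith [b.1]
  have b2 : ε x 1 1 ≤ Λ₂ := by linarith [b.2]
  constructor
  · nlinarith
  · have : ε x 0 0 * ε x 1 1 ≤ Λ₂ * Λ₂ := by gcongr <;> linarith
    nlinarith [sq_nonneg (ε x 0 1)]

theorem inv_apply_eq (M : Matrix (Fin 2) (Fin 2) ℝ) :
    M⁻¹ 0 0 = M.det⁻¹ * M 1 1 ∧ M⁻¹ 0 1 = M.det⁻¹ * -M 0 1 ∧ M⁻¹ 1 0 = M.det⁻¹ * -M 1 0 ∧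
      M⁻¹ 1 1 = M.det⁻¹ * M 0 0 := by
  rw [Matrix.inv_def, Matrix.adjugate_fin_two]
  simp

/-- Cramer's rule with det ε ≥ Λ₁². The determinant is Lipschitz with constant 4K², whence the term
4K³Λ₁⁻⁴. -/
theorem exists_c1Coeff_inv (hΛ₁ : 0 < Λ₁) : ∃ G L, ∀ ε, IsElliptic Λ₁ Λ₂ ε → HasC1Bound K ε →
    ∀ i j, C1Coeff G L fun x => (((ε x)⁻¹ i j : ℝ) : ℂ) := by
  refine ⟨(Λ₁ ^ 2)⁻¹ * K, (Λ₁ ^ 2)⁻¹ * K + 4 * K ^ 3 * (Λ₁ ^ 4)⁻¹, fun ε h hε i j => ?_⟩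
  have hd := fun x => (h.det_bounds hΛ₁ x).1
  have hd0 : ∀ x, 0 < (ε x).det := fun x => (by positivity : 0 < Λ₁ ^ 2).trans_le (hd x)
  have hK : 0 ≤ K := (abs_nonneg _).trans ((hε 0 0).2 0).1
  have hlip : ∀ i j x y, |ε x i j - ε y i j| ≤ K * ‖x - y‖ := fun i j x y => by
    have := Convex.norm_image_sub_le_of_norm_fderiv_le (𝕜 := ℝ) (f := fun x => ε x i j) (s := Set.univ)
      (x := y) (y := x) (C := K)
      (fun z _ => ((hε i j).1.differentiable (by norm_num)) z) (fun z _ => ((hε i j).2 z).2)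
      convex_univ trivial trivial
    simpa using this
  have hcd : ContDiff ℝ 1 fun x => (ε x).det := by
    simp only [Matrix.det_fin_two]
    exact ((hε 0 0).1.mul (hε 1 1).1).sub ((hε 0 1).1.mul (hε 1 0).1)
  have hdl : ∀ x y, |(ε x).det - (ε y).det| ≤ 4 * K ^ 2 * ‖x - y‖ := fun x y => by
    have prod : ∀ a b c d : ℝ, |a| ≤ K → |d| ≤ K → |a - c| ≤ K * ‖x - y‖ → |b - d| ≤ K * ‖x - y‖ →
        |a * b - c * d| ≤ 2 * K ^ 2 * ‖x - y‖ := fun a b c d ha hd h1 h2 => by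
      have e : a * b - c * d = a * (b - d) + (a - c) * d := by ring
      rw [e]
      refine (abs_add_le _ _).trans ?_
      rw [abs_mul, abs_mul]
      have m1 := mul_le_mul ha h2 (abs_nonneg _) hK
      have m2 := mul_le_mul h1 hd (abs_nonneg _) (by positivity)
      linarith
    simp only [Matrix.det_fin_two]
    have p1 := prod (ε x 0 0) (ε x 1 1) (ε y 0 0) (ε y 1 1) ((hε 0 0).2 x).1 ((hε 1 1).2 y).1
      (hlip 0 0 x y) (hlip 1 1 x y)
    have p2 := prod (ε x 0 1) (ε x 1 0) (ε y 0 1) (ε y 1 0) ((hε 0 1).2 x).1 ((hε 1 0).2 y).1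
      (hlip 0 1 x y) (hlip 1 0 x y)
    rw [abs_le] at p1 p2 ⊢
    constructor <;> linarith [p1.1, p1.2, p2.1, p2.2]
  have hinv : ∀ x, (ε x).det⁻¹ ≤ (Λ₁ ^ 2)⁻¹ := fun x => inv_anti₀ (by positivity) (hd x)
  have key : ∀ f : E → ℝ, ContDiff ℝ 1 f → (∀ x, |f x| ≤ K) → (∀ x y, |f x - f y| ≤ K * ‖x - y‖) →
      C1Coeff ((Λ₁ ^ 2)⁻¹ * K) ((Λ₁ ^ 2)⁻¹ * K + 4 * K ^ 3 * (Λ₁ ^ 4)⁻¹)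
        fun x => (((ε x).det⁻¹ * f x : ℝ) : ℂ) := fun f hf h1 h2 => by
    refine ⟨Complex.ofRealCLM.contDiff.comp ((hcd.inv fun x => (hd0 x).ne').mul hf), fun x => ?_,
      fun x y => ?_⟩
    · rw [Complex.norm_real, norm_mul, Real.norm_of_nonneg (inv_nonneg.2 (hd0 x).le)]
      exact mul_le_mul (hinv x) (h1 x) (abs_nonneg _) (by positivity)
    · rw [← Complex.ofReal_sub, Complex.norm_real, Real.norm_eq_abs]
      have e : (ε x).det⁻¹ * f x - (ε y).det⁻¹ * f y = (ε x).det⁻¹ * (f x - f y) +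
          f y * (((ε x).det⁻¹ * (ε y).det⁻¹) * ((ε y).det - (ε x).det)) := by
        have := (hd0 x).ne'
        have := (hd0 y).ne'
        field_simp; ring
      rw [e]
      refine (abs_add_le _ _).trans ?_
      rw [abs_mul, abs_mul, abs_mul, abs_mul, abs_of_pos (inv_pos.2 (hd0 x)),
        abs_of_pos (inv_pos.2 (hd0 y))]
      have d1 := hdl y x
      rw [norm_sub_rev] at d1
      have n1 := inv_nonneg.2 (hd0 x).le
      have n2 := inv_nonneg.2 (hd0 y).le
      calc _ ≤ (Λ₁ ^ 2)⁻¹ * (K * ‖x - y‖) +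
            K * ((Λ₁ ^ 2)⁻¹ * (Λ₁ ^ 2)⁻¹ * (4 * K ^ 2 * ‖x - y‖)) := by
            gcongr
            · exact hd x
            · exact h2 x y
            · exact h1 y
            · exact hd x
            · exact hd y
        _ = _ := by field_simp
  have hneg : ∀ i j, C1Coeff ((Λ₁ ^ 2)⁻¹ * K) ((Λ₁ ^ 2)⁻¹ * K + 4 * K ^ 3 * (Λ₁ ^ 4)⁻¹)
      fun x => (((ε x).det⁻¹ * -ε x i j : ℝ) : ℂ) := fun i j =>
    key (fun x => -ε x i j) (hε i j).1.neg (fun x => by rw [abs_neg]; exact ((hε i j).2 x).1)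
      fun x y => by rw [← neg_sub', abs_neg]; exact hlip i j x y
  have hpos : ∀ i j, C1Coeff ((Λ₁ ^ 2)⁻¹ * K) ((Λ₁ ^ 2)⁻¹ * K + 4 * K ^ 3 * (Λ₁ ^ 4)⁻¹)
      fun x => (((ε x).det⁻¹ * ε x i j : ℝ) : ℂ) := fun i j =>
    key (fun x => ε x i j) (hε i j).1 (fun x => ((hε i j).2 x).1) (hlip i j)
  fin_cases i <;> fin_cases j
  · have := hpos 1 1
    simp only [← (inv_apply_eq (ε _)).1] at this
    exact this
  · have := hneg 0 1
    simp only [← (inv_apply_eq (ε _)).2.1] at this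
    exact this
  · have := hneg 1 0
    simp only [← (inv_apply_eq (ε _)).2.2.1] at this
    exact this
  · have := hpos 0 0
    simp only [← (inv_apply_eq (ε _)).2.2.2] at this
    exact this

/-- In dimension two the form of ε⁻¹ at (s,t) is that of ε at the rotated vector (-t,s), divided by
the determinant, which is at most Λ₂². -/
theorem IsElliptic.le_inv_form (hΛ₁ : 0 < Λ₁) (h : IsElliptic Λ₁ Λ₂ ε) (x : E) (s t : ℝ) :
    Λ₁ / Λ₂ ^ 2 * (s ^ 2 + t ^ 2) ≤
      (ε x)⁻¹ 0 0 * s ^ 2 + 2 * (ε x)⁻¹ 0 1 * s * t + (ε x)⁻¹ 1 1 * t ^ 2 := by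
  obtain ⟨h1, h2⟩ := h.det_bounds hΛ₁ x
  obtain ⟨e1, e2, -, e4⟩ := inv_apply_eq (ε x)
  have hd : 0 < (ε x).det := (by positivity : 0 < Λ₁ ^ 2).trans_le h1
  have h3 := (h.form_le x (-t) s).1
  rw [e1, e2, e4]
  have e : (ε x).det⁻¹ * ε x 1 1 * s ^ 2 + 2 * ((ε x).det⁻¹ * -ε x 0 1) * s * t +
      (ε x).det⁻¹ * ε x 0 0 * t ^ 2 = (ε x).det⁻¹ *
        (ε x 0 0 * (-t) ^ 2 + 2 * ε x 0 1 * (-t) * s + ε x 1 1 * s ^ 2) := by ring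
  rw [e]
  calc Λ₁ / Λ₂ ^ 2 * (s ^ 2 + t ^ 2) = (Λ₂ ^ 2)⁻¹ * (Λ₁ * ((-t) ^ 2 + s ^ 2)) := by ring
    _ ≤ _ := by
      have : (Λ₂ ^ 2)⁻¹ ≤ (ε x).det⁻¹ := inv_anti₀ hd h2
      have n : 0 ≤ Λ₁ * ((-t) ^ 2 + s ^ 2) := by positivity
      have n' : 0 ≤ (ε x).det⁻¹ := by positivity
      gcongr

/-- Truncation changes a Lipschitz function by O(lam^{-1/2}), so ellipticity survives for large lam;
this is the only reason for the threshold on lam. -/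
theorem exists_smoothAdmissible {χ : E → ℝ} (hχ : IsLowFrequencyCutoff χ) (hΛ₁ : 0 < Λ₁)
    (hΛ₂ : 0 < Λ₂) (K : ℝ) :
    ∃ μ A L B₀ lam₀, 0 < μ ∧ ∀ ε, IsElliptic Λ₁ Λ₂ ε → HasC1Bound K ε → ∀ lam, 1 ≤ lam → lam₀ ≤ lam →
      SmoothAdmissible μ A L (B₀ * lam) (truncInv χ ε lam) := by
  obtain ⟨κ, hκ1, hκ⟩ := exists_schwartz_kernel hχ
  obtain ⟨G, L, hGL⟩ := exists_c1Coeff_inv (Λ₂ := Λ₂) (K := K) hΛ₁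
  set I0 := ∫ z, ‖κ z‖
  set I1 := ∫ z, ‖z‖ * ‖κ z‖
  set B₀ := ∑ k, ∑ l, |G| * ∫ z, ‖schwartzPd k (schwartzPd l κ) z‖
  set ν := Λ₁ / Λ₂ ^ 2
  have hν : 0 < ν := by positivity
  -- The threshold makes every entry change by at most ν/4. The diagonal and the off-diagonal terms
  -- then each lower the form by at most (ν/4)(s² + t²), which leaves ν/2.
  refine ⟨ν / 2, G * I0, L * I0, B₀, (4 * (|L| * I1) / ν) ^ 2, by positivity,
    fun ε h hε lam hl1 hl => ?_⟩
  have hC := hGL ε h hε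
  have hlam : 0 < lam := by linarith
  have hR : 0 < Real.sqrt lam := Real.sqrt_pos.2 hlam
  have e1 : ∀ i j, (fun x => (truncInv χ ε lam x i j : ℂ))
      = avg (Real.sqrt lam) κ fun x => (((ε x)⁻¹ i j : ℝ) : ℂ) := fun i j => by
    funext x
    exact ofReal_truncate hκ hR _ x
  have e2 := fun i j x => congrFun (e1 i j) x
  have hsymm : ∀ x, (ε x)⁻¹ 0 1 = (ε x)⁻¹ 1 0 := fun x => by
    obtain ⟨-, h2, h3, -⟩ := inv_apply_eq (ε x)
    rw [h2, h3, (h x).1 0 1]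
  have hI1 : 0 ≤ I1 := integral_nonneg fun z => by positivity
  have hclose : ∀ x i j, |truncInv χ ε lam x i j - (ε x)⁻¹ i j| ≤ ν / 4 := fun x i j => by
    have h1 := (hC i j).norm_avg_sub_le hR κ hκ1 x
    rw [← e2 i j x, ← Complex.ofReal_sub, Complex.norm_real, Real.norm_eq_abs] at h1
    refine h1.trans ?_
    have h2 : 4 * (|L| * I1) / ν ≤ Real.sqrt lam := Real.le_sqrt_of_sq_le hl
    rw [div_mul_eq_mul_div, div_le_iff₀ hR]
    rw [div_le_iff₀ hν] at h2
    have := mul_le_mul_of_nonneg_right (le_abs_self L) hI1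
    linarith
  refine ⟨⟨fun x => ?_, fun x i j => ?_, fun x y i j => ?_, fun x s t => ?_⟩, fun i j => ?_,
    fun i j k l x => ?_⟩
  · simp only [truncInv, hsymm]
  · have := (hC i j).norm_avg_le (Real.sqrt lam) κ x
    rwa [← e2 i j x, Complex.norm_real] at this
  · have := (hC i j).lip_avg (Real.sqrt lam) κ x y
    rwa [← e2 i j x, ← e2 i j y, ← Complex.ofReal_sub, Complex.norm_real] at this
  · have h0 := h.le_inv_form hΛ₁ x s t
    have a0 := abs_le.1 (hclose x 0 0)
    have a1 := abs_le.1 (hclose x 0 1)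
    have a2 := abs_le.1 (hclose x 1 1)
    change ν * _ ≤ _ at h0
    have b0 := mul_le_mul_of_nonneg_right a0.1 (sq_nonneg s)
    have b2 := mul_le_mul_of_nonneg_right a2.1 (sq_nonneg t)
    have b1 : -(ν / 4) * (s ^ 2 + t ^ 2) ≤
        2 * (truncInv χ ε lam x 0 1 - (ε x)⁻¹ 0 1) * s * t := by
      have := mul_le_mul_of_nonneg_right (hclose x 0 1) (abs_nonneg (2 * s * t))
      rw [← abs_mul] at this
      have c1 : |2 * s * t| ≤ s ^ 2 + t ^ 2 := by
        rw [abs_le]; constructor <;> nlinarith [sq_nonneg (s - t), sq_nonneg (s + t)]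
      have c2 := mul_le_mul_of_nonneg_left c1 (by positivity : 0 ≤ ν / 4)
      have c3 := neg_abs_le ((truncInv χ ε lam x 0 1 - (ε x)⁻¹ 0 1) * (2 * s * t))
      linarith
    linarith
  · rw [e1 i j]; exact (hC i j).smoothBdd_avg hR κ
  · rw [e1 i j]
    refine ((hC i j).norm_pd_pd_avg_le hR κ k l x).trans ?_
    rw [Real.sq_sqrt hlam.le, mul_comm]
    refine mul_le_mul_of_nonneg_right ?_ hlam.le
    have n : ∀ k l, 0 ≤ |G| * ∫ z, ‖schwartzPd k (schwartzPd l κ) z‖ := fun k l =>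
      mul_nonneg (abs_nonneg _) (integral_nonneg fun z => norm_nonneg _)
    calc G * ∫ z, ‖schwartzPd k (schwartzPd l κ) z‖
        ≤ |G| * ∫ z, ‖schwartzPd k (schwartzPd l κ) z‖ :=
          mul_le_mul_of_nonneg_right (le_abs_self G) (integral_nonneg fun z => norm_nonneg _)
      _ ≤ ∑ l, |G| * ∫ z, ‖schwartzPd k (schwartzPd l κ) z‖ :=
          Finset.single_le_sum (f := fun l => |G| * ∫ z, ‖schwartzPd k (schwartzPd l κ) z‖)
            (fun l _ => n k l) (Finset.mem_univ l)
      _ ≤ B₀ := Finset.single_le_sum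
            (f := fun k => ∑ l, |G| * ∫ z, ‖schwartzPd k (schwartzPd l κ) z‖)
            (fun k _ => Finset.sum_nonneg fun l _ => n k l) (Finset.mem_univ k)

end

section

variable {μ A L B : ℝ} {e : E → Matrix (Fin 2) (Fin 2) ℝ}

/-! ### Expansion of the composition -/

/-- `F` and `H` differ by a function of square integral norm at most `M`. -/
def Close (M : ℝ) (F H : E → ℂ) : Prop := 0 ≤ M ∧ L2Bound (F - H) M

theorem Close.add {M M' : ℝ} {F F' H H' : E → ℂ} (h : Close M F H) (h' : Close M' F' H') :
    Close (M + M') (F + F') (H + H') := by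
  refine ⟨add_nonneg h.1 h'.1, ?_⟩
  rw [add_sub_add_comm]
  exact h.2.add h'.2 h.1 h'.1

theorem Close.sub {M M' : ℝ} {F F' H H' : E → ℂ} (h : Close M F H) (h' : Close M' F' H') :
    Close (M + M') (F - F') (H - H') := by
  refine ⟨add_nonneg h.1 h'.1, ?_⟩
  rw [sub_sub_sub_comm]
  exact h.2.sub h'.2 h.1 h'.1

theorem Close.refl (F : E → ℂ) : Close 0 F F := ⟨le_rfl, by rw [sub_self]; exact ⟨by simp, by simp⟩⟩

theorem act_apply (T : Fin 3 → Fin 3 → Oper) (u : Fin 3 → E → ℂ) (i : Fin 3) :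
    act T u i = T i 0 (u 0) + T i 1 (u 1) + T i 2 (u 2) := by
  funext x
  simp only [act, Fin.sum_univ_three, Pi.add_apply]

/-- The coefficient `e_{ij}` as a complex function. -/
def coeff (e : E → Matrix (Fin 2) (Fin 2) ℝ) (i j : Fin 2) (x : E) : ℂ := (e x i j : ℂ)

theorem opInvD_pd_add (hμ : 0 < μ) (h : Admissible μ A L e) {u w : E → ℂ} (hu : SmoothL2 u)
    (hw : SmoothL2 w) {l : Fin 3} (hl : l ≠ 0) :
    opInvD e (pd l (u + w)) = opInvD e (pd l u) + opInvD e (pd l w) := by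
  rw [pd_add hu.differentiable hw.differentiable,
    opInvD_add hμ h (hu.invDomain_pd hl) (hw.invDomain_pd hl)]

theorem opInvD_pd_smul (hμ : 0 < μ) (h : Admissible μ A L e) (c : ℂ) {u : E → ℂ} (hu : SmoothL2 u)
    (l : Fin 3) : opInvD e (pd l (c • u)) = c • opInvD e (pd l u) := by
  rw [pd_smul c hu.differentiable, opInvD_smul hμ h c (hu.pd l).memLp]

theorem opInvD_pd_sub (hμ : 0 < μ) (h : Admissible μ A L e) {u w : E → ℂ} (hu : SmoothL2 u)
    (hw : SmoothL2 w) {l : Fin 3} (hl : l ≠ 0) :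
    opInvD e (pd l (u - w)) = opInvD e (pd l u) - opInvD e (pd l w) := by
  rw [sub_eq_add_neg, ← neg_one_smul ℂ w, opInvD_pd_add hμ h hu (hw.const_smul _) hl,
    opInvD_pd_smul hμ h _ hw, neg_one_smul, ← sub_eq_add_neg]

theorem opD_sub (hμ : 0 < μ) (h : Admissible μ A L e) {u w : E → ℂ} (hu : SmoothL2 u)
    (hw : SmoothL2 w) : opD e (u - w) = opD e u - opD e w := by
  rw [sub_eq_add_neg, ← neg_one_smul ℂ w, opD_add hμ h hu (hw.const_smul _), opD_smul hμ h _ hw,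
    neg_one_smul, ← sub_eq_add_neg]

theorem opInvD_sub (hμ : 0 < μ) (h : Admissible μ A L e) {u w : E → ℂ} (hu : InvDomain u)
    (hw : InvDomain w) : opInvD e (u - w) = opInvD e u - opInvD e w := by
  rw [sub_eq_add_neg, ← neg_one_smul ℂ w, opInvD_add hμ h hu (hw.const_smul _),
    opInvD_smul hμ h _ hw.1, neg_one_smul, ← sub_eq_add_neg]

theorem pd_sub {u w : E → ℂ} (hu : Differentiable ℝ u) (hw : Differentiable ℝ w) (k : Fin 3) :
    pd k (u - w) = pd k u - pd k w := by
  rw [sub_eq_add_neg, ← neg_one_smul ℂ w, pd_add hu (hw.const_smul _), pd_smul _ hw, neg_one_smul,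
    ← sub_eq_add_neg]

theorem third_comm (e : E → Matrix (Fin 2) (Fin 2) ℝ) (i j : Fin 2) (k l : Fin 3) (v : E → ℂ) :
    third e i j k l v = third e i j l k v := by
  rw [third, third]
  congr 2; funext ξ
  simp only [freqMul]; ring

/-- The diagonal terms of the first two rows. The Riesz symbols carry a factor i, so the combination
of their products is exactly q; multiplied by (q^{-1/2})² it leaves the symbol of ∂ₜ. -/
theorem third_sum (hμ : 0 < μ) (h : SmoothAdmissible μ A L B e) {v : E → ℂ} (hv : RapidL2 v) :
    third e 0 1 1 2 v - third e 1 1 1 1 v + third e 0 1 1 2 v - third e 0 0 2 2 v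
      = pd 0 (oscRoot e 0 v) := by
  rw [pd_oscRoot_zero hμ h hv]
  set w := freqMul 0 v
  have hw : Integrable w := (hv.freqMul 0).integrable
  funext x
  have e1 : ∀ k l : Fin 3, (fun ξ => riesz l ξ * freqMul 0 (fun ξ => riesz k ξ * v ξ) ξ)
      = fun ξ => riesz l ξ * (riesz k ξ * w ξ) := fun k l => by
    rw [freqMul_symbol]
  have hi : ∀ k l : Fin 3, k ≠ 0 → l ≠ 0 → Integrable fun ξ =>
      Complex.exp (2 * Real.pi * Complex.I * (inner ℝ x ξ : ℝ)) *
      (invRoot e x ((2 * Real.pi) • ξ) : ℂ) ^ 2 * (riesz l ξ * (riesz k ξ * w ξ)) := fun k l hk hl =>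
    integrable_oscRoot hμ h.toAdmissible 2 x
      (((hv.freqMul 0).bdd_mul (isHomogeneousSymbol_riesz k hk).bdd).bdd_mul
        (isHomogeneousSymbol_riesz l hl).bdd).integrable
  have i12 := (hi 1 2 (by decide) (by decide)).const_mul (e x 0 1 : ℂ)
  have i11 := (hi 1 1 (by decide) (by decide)).const_mul (e x 1 1 : ℂ)
  have i22 := (hi 2 2 (by decide) (by decide)).const_mul (e x 0 0 : ℂ)
  simp only [third, Pi.add_apply, Pi.sub_apply, Pi.mul_apply, e1, oscRoot, osc]
  have key := integral_add (i12.sub i11) (i12.sub i22)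
  simp only [Pi.sub_apply] at key
  rw [integral_sub i12 i11, integral_sub i12 i22] at key
  rw [← integral_const_mul, ← integral_const_mul, ← integral_const_mul, add_sub_assoc, ← key]
  refine integral_congr_ae ?_
  filter_upwards [ae_rho_ne_zero] with ξ hξ
  have hq : (quad e x ((2 * Real.pi) • ξ) : ℂ) * (invRoot e x ((2 * Real.pi) • ξ) : ℂ) ^ 2 = 1 := by
    exact_mod_cast h.quad_mul_invRoot_sq hμ x _
  have hs : (spatialNorm ξ : ℂ) ≠ 0 := by
    exact_mod_cast fun h => hξ (by rw [← spatialNorm_sq ξ, h]; simp)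
  have hs2 : (spatialNorm ξ : ℂ) ^ 2 = rho ξ := by exact_mod_cast spatialNorm_sq ξ
  have hr : (rho ξ : ℂ) ≠ 0 := by exact_mod_cast hξ
  have hq2 : (quad e x ((2 * Real.pi) • ξ) : ℂ) = 2 * (e x 0 1 : ℂ) * (riesz 1 ξ * riesz 2 ξ)
      - (e x 1 1 : ℂ) * riesz 1 ξ ^ 2 - (e x 0 0 : ℂ) * riesz 2 ξ ^ 2 := by
    have r1 : ∀ k l : Fin 3, riesz k ξ * riesz l ξ = -((ξ k * ξ l / rho ξ : ℝ) : ℂ) := fun k l => by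
      simp only [riesz]; push_cast
      rw [← hs2]
      field_simp
      rw [Complex.I_sq]; ring
    rw [sq, sq, r1, r1, r1]
    rw [quad, cosD_smul _ ξ (by positivity : 0 < 2 * Real.pi),
      sinD_smul _ ξ (by positivity : 0 < 2 * Real.pi), cf0, cf1, cf2, cosD, sinD]
    have hrho : rho ξ = ξ 1 ^ 2 + ξ 2 ^ 2 := rfl
    have : (e x 0 0 + e x 1 1) / 2 + (e x 1 1 - e x 0 0) / 2 * ((ξ 1 ^ 2 - ξ 2 ^ 2) / rho ξ) +
        -e x 0 1 * (2 * ξ 1 * ξ 2 / rho ξ) = 2 * e x 0 1 * -(ξ 1 * ξ 2 / rho ξ)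
        - e x 1 1 * -(ξ 1 * ξ 1 / rho ξ) - e x 0 0 * -(ξ 2 * ξ 2 / rho ξ) := by
      field_simp
      rw [hrho]; ring
    rw [this]; push_cast; ring
  rw [hq2] at hq
  linear_combination (Complex.exp (2 * Real.pi * Complex.I * (inner ℝ x ξ : ℝ)) * w ξ) * hq

/-! ### The rows of the operator matrices -/

section expansion

theorem opM_apply_zero (f : Fin 3 → E → ℂ) : act (opM e) f 0 =
    Complex.I • opInvD e (pd 1 (coeff e 1 1 * f 0) - pd 2 (coeff e 0 1 * f 0)) +
      -Complex.I • opInvD e (pd 2 (f 1)) + Complex.I • opInvD e (pd 2 (f 2)) := by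
  rw [act_apply]; rfl

theorem opM_apply_one (f : Fin 3 → E → ℂ) : act (opM e) f 1 =
    Complex.I • opInvD e (pd 2 (coeff e 0 0 * f 0) - pd 1 (coeff e 0 1 * f 0)) +
      Complex.I • opInvD e (pd 1 (f 1)) + -Complex.I • opInvD e (pd 1 (f 2)) := by
  rw [act_apply]; rfl

theorem opM_apply_two (f : Fin 3 → E → ℂ) : act (opM e) f 2 = f 1 + f 2 := by
  rw [act_apply]
  change (0 : E → ℂ) + f 1 + f 2 = _
  rw [zero_add]

theorem opDiag_apply_zero (f : Fin 3 → E → ℂ) : act (opDiag e) f 0 = pd 0 (f 0) := by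
  rw [act_apply]
  change pd 0 (f 0) + (0 : E → ℂ) + (0 : E → ℂ) = _
  rw [add_zero, add_zero]

theorem opDiag_apply_one (f : Fin 3 → E → ℂ) :
    act (opDiag e) f 1 = pd 0 (f 1) - Complex.I • opD e (f 1) := by
  rw [act_apply]
  change (0 : E → ℂ) + (pd 0 (f 1) - Complex.I • opD e (f 1)) + (0 : E → ℂ) = _
  rw [zero_add, add_zero]

theorem opDiag_apply_two (f : Fin 3 → E → ℂ) :
    act (opDiag e) f 2 = pd 0 (f 2) + Complex.I • opD e (f 2) := by
  rw [act_apply]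
  change (0 : E → ℂ) + (0 : E → ℂ) + (pd 0 (f 2) + Complex.I • opD e (f 2)) = _
  rw [zero_add, zero_add]

/-- The third row of `P`, applied to `D⁻¹`. -/
def rowThree (e : E → Matrix (Fin 2) (Fin 2) ℝ) (G₀ G₁ : E → ℂ) : E → ℂ :=
  coeff e 0 1 * pd 1 G₀ - coeff e 0 0 * pd 2 G₀ + coeff e 1 1 * pd 1 G₁ - coeff e 0 1 * pd 2 G₁

theorem opN_apply_zero (u : Fin 3 → E → ℂ) : act (opN e) u 0 =
    Complex.I • (pd 1 (opInvD e (u 0)) + pd 2 (opInvD e (u 1))) := by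
  rw [act_apply]
  change Complex.I • pd 1 (opInvD e (u 0)) + Complex.I • pd 2 (opInvD e (u 1)) + (0 : E → ℂ) = _
  rw [add_zero, smul_add]

theorem opN_apply_one (u : Fin 3 → E → ℂ) : act (opN e) u 1 =
    (Complex.I / 2) • rowThree e (opInvD e (u 0)) (opInvD e (u 1)) + (1 / 2 : ℂ) • u 2 := by
  rw [act_apply]
  funext x
  simp only [opN, mulOp, rowThree, coeff, Matrix.cons_val_zero, Matrix.cons_val_one, Matrix.cons_val,
    Pi.add_apply, Pi.smul_apply, Pi.sub_apply, Pi.mul_apply, smul_eq_mul]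
  ring

theorem opN_apply_two (u : Fin 3 → E → ℂ) : act (opN e) u 2 =
    (-(Complex.I / 2)) • rowThree e (opInvD e (u 0)) (opInvD e (u 1)) + (1 / 2 : ℂ) • u 2 := by
  rw [act_apply]
  funext x
  simp only [opN, mulOp, rowThree, coeff, Matrix.cons_val_zero, Matrix.cons_val_one, Matrix.cons_val,
    Pi.add_apply, Pi.smul_apply, Pi.sub_apply, Pi.mul_apply, smul_eq_mul]
  ring

theorem opP_apply_zero (u : Fin 3 → E → ℂ) : act (opP e) u 0 = pd 0 (u 0) - pd 2 (u 2) := by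
  rw [act_apply]
  change pd 0 (u 0) + (0 : E → ℂ) + -pd 2 (u 2) = _
  rw [add_zero, ← sub_eq_add_neg]

theorem opP_apply_one (u : Fin 3 → E → ℂ) : act (opP e) u 1 = pd 0 (u 1) + pd 1 (u 2) := by
  rw [act_apply]
  change (0 : E → ℂ) + pd 0 (u 1) + pd 1 (u 2) = _
  rw [zero_add]

theorem opP_apply_two (he : ∀ x, e x 0 1 = e x 1 0) (u : Fin 3 → E → ℂ) : act (opP e) u 2 =
    pd 1 (coeff e 0 1 * u 0) - pd 2 (coeff e 0 0 * u 0) + pd 1 (coeff e 1 1 * u 1)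
      - pd 2 (coeff e 0 1 * u 1) + pd 0 (u 2) := by
  have h1 : coeff e 0 1 = coeff e 1 0 := by funext x; rw [coeff, coeff, he]
  rw [act_apply]
  change -pd 2 (coeff e 0 0 * u 0) + pd 1 (coeff e 1 0 * u 0)
    + (pd 1 (coeff e 1 1 * u 1) - pd 2 (coeff e 0 1 * u 1)) + pd 0 (u 2) = _
  rw [← h1]; abel

end expansion

theorem smoothL2_rowThree (h : SmoothAdmissible μ A L B e) {G₀ G₁ : E → ℂ} (h0 : SmoothL2 G₀)
    (h1 : SmoothL2 G₁) : SmoothL2 (rowThree e G₀ G₁) :=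
  (((SmoothL2.mul (h.smooth 0 1) (h0.pd 1)).sub (SmoothL2.mul (h.smooth 0 0) (h0.pd 2))).add
    (SmoothL2.mul (h.smooth 1 1) (h1.pd 1))).sub (SmoothL2.mul (h.smooth 0 1) (h1.pd 2))

/-- The composition `𝓓 𝓝`. -/
theorem opDiag_opN_apply (hμ : 0 < μ) (h : SmoothAdmissible μ A L B e) {u : Fin 3 → E → ℂ}
    (h0 : SmoothL2 (opInvD e (u 0))) (h1 : SmoothL2 (opInvD e (u 1))) (h2 : SmoothL2 (u 2)) :
    let W := rowThree e (opInvD e (u 0)) (opInvD e (u 1))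
    let f := act (opDiag e) (act (opN e) u)
    f 0 = Complex.I • (pd 0 (pd 1 (opInvD e (u 0))) + pd 0 (pd 2 (opInvD e (u 1)))) ∧
    f 1 = (1 / 2 : ℂ) • ((pd 0 (u 2) + opD e W) + Complex.I • (pd 0 W - opD e (u 2))) ∧
    f 2 = (1 / 2 : ℂ) • ((pd 0 (u 2) + opD e W) - Complex.I • (pd 0 W - opD e (u 2))) := by
  intro W f
  have hW : SmoothL2 W := smoothL2_rowThree h h0 h1
  have hd1 := (h0.pd 1).add (h1.pd 2)
  have hI : Complex.I * Complex.I = -1 := Complex.I_mul_I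
  refine ⟨?_, ?_, ?_⟩
  · rw [show f 0 = pd 0 (act (opN e) u 0) from opDiag_apply_zero _, opN_apply_zero,
      pd_smul _ hd1.differentiable, pd_add (h0.pd 1).differentiable (h1.pd 2).differentiable]
  · rw [show f 1 = _ from opDiag_apply_one _, opN_apply_one,
      pd_add (hW.const_smul _).differentiable (h2.const_smul _).differentiable,
      pd_smul _ hW.differentiable, pd_smul _ h2.differentiable,
      opD_add hμ h.toAdmissible (hW.const_smul _) (h2.const_smul _),
      opD_smul hμ h.toAdmissible _ hW, opD_smul hμ h.toAdmissible _ h2]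
    funext x
    simp only [Pi.add_apply, Pi.smul_apply, Pi.sub_apply, smul_eq_mul]
    linear_combination -(opD e W x / 2) * hI
  · rw [show f 2 = _ from opDiag_apply_two _, opN_apply_two,
      pd_add (hW.const_smul _).differentiable (h2.const_smul _).differentiable,
      pd_smul _ hW.differentiable, pd_smul _ h2.differentiable,
      opD_add hμ h.toAdmissible (hW.const_smul _) (h2.const_smul _),
      opD_smul hμ h.toAdmissible _ hW, opD_smul hμ h.toAdmissible _ h2]
    funext x
    simp only [Pi.add_apply, Pi.smul_apply, Pi.sub_apply, smul_eq_mul]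
    linear_combination -(opD e W x / 2) * hI

end

section

variable {μ A L B : ℝ} {e : E → Matrix (Fin 2) (Fin 2) ℝ}

/-! ### Comparison of the composition with `P` -/

theorem opInvD_pd_coeff_mul (hμ : 0 < μ) (h : SmoothAdmissible μ A L B e) {X Y f : E → ℂ}
    (hX : SmoothL2 X) (hY : SmoothL2 Y) (hf : f = Complex.I • (X + Y)) (i j : Fin 2) {l : Fin 3}
    (hl : l ≠ 0) : opInvD e (pd l (coeff e i j * f)) =
      Complex.I • (opInvD e (pd l (coeff e i j * X)) + opInvD e (pd l (coeff e i j * Y))) := by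
  have hc : SmoothBdd (coeff e i j) := h.smooth i j
  rw [hf, mul_smul_comm, mul_add,
    opInvD_pd_smul hμ h.toAdmissible _ ((SmoothL2.mul hc hX).add (SmoothL2.mul hc hY)),
    opInvD_pd_add hμ h.toAdmissible (SmoothL2.mul hc hX) (SmoothL2.mul hc hY) hl]

theorem opInvD_pd_rowThree (hμ : 0 < μ) (h : SmoothAdmissible μ A L B e) {G₀ G₁ : E → ℂ}
    (h0 : SmoothL2 G₀) (h1 : SmoothL2 G₁) {l : Fin 3} (hl : l ≠ 0) :
    opInvD e (pd l (pd 0 (rowThree e G₀ G₁))) =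
      opInvD e (pd l (pd 0 (coeff e 0 1 * pd 1 G₀))) - opInvD e (pd l (pd 0 (coeff e 0 0 * pd 2 G₀)))
      + opInvD e (pd l (pd 0 (coeff e 1 1 * pd 1 G₁)))
      - opInvD e (pd l (pd 0 (coeff e 0 1 * pd 2 G₁))) := by
  have s : ∀ i j k {G : E → ℂ}, SmoothL2 G → SmoothL2 (coeff e i j * pd k G) := fun i j k G hG =>
    SmoothL2.mul (h.smooth i j) (hG.pd k)
  have a1 := s 0 1 1 h0
  have a2 := s 0 0 2 h0
  have a3 := s 1 1 1 h1
  have a4 := s 0 1 2 h1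
  have hA := h.toAdmissible
  rw [rowThree, pd_sub ((a1.sub a2).add a3).differentiable a4.differentiable,
    pd_add (a1.sub a2).differentiable a3.differentiable, pd_sub a1.differentiable a2.differentiable,
    opInvD_pd_sub hμ hA (((a1.pd 0).sub (a2.pd 0)).add (a3.pd 0)) (a4.pd 0) hl,
    opInvD_pd_add hμ hA ((a1.pd 0).sub (a2.pd 0)) (a3.pd 0) hl,
    opInvD_pd_sub hμ hA (a1.pd 0) (a2.pd 0) hl]

theorem opD_rowThree (hμ : 0 < μ) (h : SmoothAdmissible μ A L B e) {G₀ G₁ : E → ℂ}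
    (h0 : SmoothL2 G₀) (h1 : SmoothL2 G₁) :
    opD e (rowThree e G₀ G₁) = opD e (coeff e 0 1 * pd 1 G₀) - opD e (coeff e 0 0 * pd 2 G₀)
      + opD e (coeff e 1 1 * pd 1 G₁) - opD e (coeff e 0 1 * pd 2 G₁) := by
  have s : ∀ i j k {G : E → ℂ}, SmoothL2 G → SmoothL2 (coeff e i j * pd k G) := fun i j k G hG =>
    SmoothL2.mul (h.smooth i j) (hG.pd k)
  have a1 := s 0 1 1 h0
  have a2 := s 0 0 2 h0
  have a3 := s 1 1 1 h1
  have a4 := s 0 1 2 h1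
  have hA := h.toAdmissible
  rw [rowThree, opD_sub hμ hA ((a1.sub a2).add a3) a4, opD_add hμ hA (a1.sub a2) a3,
    opD_sub hμ hA a1 a2]

section expansion

variable {u : Fin 3 → E → ℂ}

/-- The last row of 𝓜 adds the two half-wave components, and in the sum the terms with factor i
cancel. -/
theorem actMDN_two (hμ : 0 < μ) (h : SmoothAdmissible μ A L B e)
    (h0 : SmoothL2 (opInvD e (u 0))) (h1 : SmoothL2 (opInvD e (u 1))) (h2 : SmoothL2 (u 2)) :
    actMDN e u 2 = opD e (coeff e 0 1 * pd 1 (opInvD e (u 0)))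
      - opD e (coeff e 0 0 * pd 2 (opInvD e (u 0))) + opD e (coeff e 1 1 * pd 1 (opInvD e (u 1)))
      - opD e (coeff e 0 1 * pd 2 (opInvD e (u 1))) + pd 0 (u 2) := by
  obtain ⟨-, e1, e2⟩ := opDiag_opN_apply hμ h h0 h1 h2
  rw [actMDN, opM_apply_two, e1, e2, ← opD_rowThree hμ h h0 h1]
  funext x
  simp only [Pi.add_apply, Pi.smul_apply, Pi.sub_apply, smul_eq_mul]
  ring

theorem opInvD_pd_half (hμ : 0 < μ) (h : Admissible μ A L e) {S Z : E → ℂ} (hS : SmoothL2 S)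
    (hZ : SmoothL2 Z) {l : Fin 3} (hl : l ≠ 0) :
    opInvD e (pd l ((1 / 2 : ℂ) • (S + Complex.I • Z)))
      = (1 / 2 : ℂ) • (opInvD e (pd l S) + Complex.I • opInvD e (pd l Z)) ∧
    opInvD e (pd l ((1 / 2 : ℂ) • (S - Complex.I • Z)))
      = (1 / 2 : ℂ) • (opInvD e (pd l S) - Complex.I • opInvD e (pd l Z)) := by
  have hZ' := hZ.const_smul Complex.I
  rw [opInvD_pd_smul hμ h _ (hS.add hZ'), opInvD_pd_add hμ h hS hZ' hl,
    opInvD_pd_smul hμ h _ (hS.sub hZ'), opInvD_pd_sub hμ h hS hZ' hl, opInvD_pd_smul hμ h _ hZ]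
  exact ⟨rfl, rfl⟩

/-- Only the difference of the two half-wave components enters, so D W and ∂ₜu₂ drop out. The
brackets collect the contributions of u₀ and of u₁: the first will give ∂ₜu₀ and the second will
cancel. -/
theorem actMDN_zero (hμ : 0 < μ) (h : SmoothAdmissible μ A L B e)
    (h0 : SmoothL2 (opInvD e (u 0))) (h1 : SmoothL2 (opInvD e (u 1))) (h2 : SmoothL2 (u 2)) :
    actMDN e u 0 =
      (opInvD e (pd 2 (coeff e 0 1 * pd 0 (pd 1 (opInvD e (u 0)))))
        - opInvD e (pd 1 (coeff e 1 1 * pd 0 (pd 1 (opInvD e (u 0)))))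
        + opInvD e (pd 2 (pd 0 (coeff e 0 1 * pd 1 (opInvD e (u 0)))))
        - opInvD e (pd 2 (pd 0 (coeff e 0 0 * pd 2 (opInvD e (u 0)))))) +
      (opInvD e (pd 2 (coeff e 0 1 * pd 0 (pd 2 (opInvD e (u 1)))))
        - opInvD e (pd 1 (coeff e 1 1 * pd 0 (pd 2 (opInvD e (u 1)))))
        + opInvD e (pd 2 (pd 0 (coeff e 1 1 * pd 1 (opInvD e (u 1)))))
        - opInvD e (pd 2 (pd 0 (coeff e 0 1 * pd 2 (opInvD e (u 1)))))) -
      opInvD e (pd 2 (opD e (u 2))) := by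
  obtain ⟨e0, e1, e2⟩ := opDiag_opN_apply hμ h h0 h1 h2
  have hA := h.toAdmissible
  have hW := smoothL2_rowThree h h0 h1
  have hX := (h0.pd 1).pd 0
  have hY := (h1.pd 2).pd 0
  have hf : SmoothL2 (act (opDiag e) (act (opN e) u) 0) := by
    rw [e0]; exact (hX.add hY).const_smul _
  have hc : ∀ i j, SmoothL2 (coeff e i j * act (opDiag e) (act (opN e) u) 0) := fun i j =>
    SmoothL2.mul (h.smooth i j) hf
  obtain ⟨k1, k2⟩ := opInvD_pd_half hμ hA ((h2.pd 0).add (hW.opD hμ h))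
    ((hW.pd 0).sub (h2.opD hμ h)) (l := 2) (by decide)
  rw [actMDN, opM_apply_zero, opInvD_sub hμ hA ((hc 1 1).invDomain_pd (by decide))
    ((hc 0 1).invDomain_pd (by decide)), opInvD_pd_coeff_mul hμ h hX hY e0 1 1 (by decide),
    opInvD_pd_coeff_mul hμ h hX hY e0 0 1 (by decide), e1, e2, k1, k2,
    opInvD_pd_sub hμ hA (hW.pd 0) (h2.opD hμ h) (by decide),
    opInvD_pd_rowThree hμ h h0 h1 (by decide)]
  have hI : Complex.I * Complex.I = -1 := Complex.I_mul_I
  funext x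
  simp only [Pi.add_apply, Pi.smul_apply, Pi.sub_apply, smul_eq_mul]
  ring_nf
  rw [Complex.I_sq]
  ring

theorem actMDN_one (hμ : 0 < μ) (h : SmoothAdmissible μ A L B e)
    (h0 : SmoothL2 (opInvD e (u 0))) (h1 : SmoothL2 (opInvD e (u 1))) (h2 : SmoothL2 (u 2)) :
    actMDN e u 1 =
      (opInvD e (pd 1 (coeff e 0 1 * pd 0 (pd 2 (opInvD e (u 1)))))
        - opInvD e (pd 2 (coeff e 0 0 * pd 0 (pd 2 (opInvD e (u 1)))))
        + opInvD e (pd 1 (pd 0 (coeff e 0 1 * pd 2 (opInvD e (u 1)))))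
        - opInvD e (pd 1 (pd 0 (coeff e 1 1 * pd 1 (opInvD e (u 1)))))) +
      (opInvD e (pd 1 (coeff e 0 1 * pd 0 (pd 1 (opInvD e (u 0)))))
        - opInvD e (pd 2 (coeff e 0 0 * pd 0 (pd 1 (opInvD e (u 0)))))
        + opInvD e (pd 1 (pd 0 (coeff e 0 0 * pd 2 (opInvD e (u 0)))))
        - opInvD e (pd 1 (pd 0 (coeff e 0 1 * pd 1 (opInvD e (u 0)))))) +
      opInvD e (pd 1 (opD e (u 2))) := by
  obtain ⟨e0, e1, e2⟩ := opDiag_opN_apply hμ h h0 h1 h2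
  have hA := h.toAdmissible
  have hW := smoothL2_rowThree h h0 h1
  have hX := (h0.pd 1).pd 0
  have hY := (h1.pd 2).pd 0
  have hf : SmoothL2 (act (opDiag e) (act (opN e) u) 0) := by
    rw [e0]; exact (hX.add hY).const_smul _
  have hc : ∀ i j, SmoothL2 (coeff e i j * act (opDiag e) (act (opN e) u) 0) := fun i j =>
    SmoothL2.mul (h.smooth i j) hf
  obtain ⟨k1, k2⟩ := opInvD_pd_half hμ hA ((h2.pd 0).add (hW.opD hμ h))
    ((hW.pd 0).sub (h2.opD hμ h)) (l := 1) (by decide)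
  rw [actMDN, opM_apply_one, opInvD_sub hμ hA ((hc 0 0).invDomain_pd (by decide))
    ((hc 0 1).invDomain_pd (by decide)), opInvD_pd_coeff_mul hμ h hX hY e0 0 0 (by decide),
    opInvD_pd_coeff_mul hμ h hX hY e0 0 1 (by decide), e1, e2, k1, k2,
    opInvD_pd_sub hμ hA (hW.pd 0) (h2.opD hμ h) (by decide),
    opInvD_pd_rowThree hμ h h0 h1 (by decide)]
  funext x
  simp only [Pi.add_apply, Pi.smul_apply, Pi.sub_apply, smul_eq_mul]
  ring_nf
  rw [Complex.I_sq]
  ring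

end expansion

/-- The composition `𝓜 𝓓 𝓝` agrees with `P` up to bounded operators on wave packets. -/
theorem exists_close {r R : ℝ} (hr : 0 < r) (hR : r < R) (hμ : 0 < μ) (B₀ : ℝ) :
    ∃ C, 0 ≤ C ∧ ∀ e lam N (v u : Fin 3 → E → ℂ), 1 ≤ lam → SmoothAdmissible μ A L (B₀ * lam) e →
      (∀ i, Packet r R lam (v i) N) → (∀ i, u i = oscRoot e 0 (v i)) →
      ∀ i, SmoothL2 (act (opP e) u i) ∧ Close (C * N) (actMDN e u i) (act (opP e) u i) := by
  obtain ⟨C1, h1, H1⟩ := exists_l2Bound_opD_coeff (A := A) (L := L) hr hR hμ B₀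
  obtain ⟨C2, h2, H2⟩ := exists_l2Bound_opInvD_pd_opD (A := A) (L := L) hr hR hμ
  obtain ⟨C3, h3, H3⟩ := exists_l2Bound_third (A := A) (L := L) hr hR hμ B₀
  -- The last row has four errors of the first kind; each of the other rows has eight of the third
  -- kind and one of the second.
  refine ⟨4 * C1 + C2 + 8 * C3, by positivity, fun e lam N v u hl h hv hu => ?_⟩
  have hlam : 0 < lam := by linarith
  have hA := h.toAdmissible
  have n0 := (hv 0).nonneg
  have hsu : ∀ i, SmoothL2 (u i) := fun i => by
    rw [hu]; exact smoothL2_oscRoot hμ h 0 (hv i).rapid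
  have hF : ∀ i, l2Fourier (u i) =ᵐ[volume] v i := fun i => by
    have e1 : u i = 𝓕⁻ (v i) := by
      rw [hu, oscRoot]
      simp only [pow_zero]
      exact osc_one _
    rw [e1]
    exact l2Fourier_fourierInv (hv i).rapid.integrable (hv i).rapid.memLp
  have hG : ∀ i, opInvD e (u i) = oscRoot e 1 (recip (v i)) := fun i => by
    rw [opInvD_eq hμ hA]
    refine osc_congr ?_
    filter_upwards [hF i] with ξ hξ
    rw [hξ, recip]
  have hGs : ∀ i, SmoothL2 (opInvD e (u i)) := fun i => by
    rw [hG]; exact smoothL2_deriv_recip hr hlam hμ h (hv i)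
  have c1 : ∀ m i j k, k ≠ 0 → Close (C1 * N) (opD e (coeff e i j * pd k (opInvD e (u m))))
      (pd k (coeff e i j * u m)) := fun m i j k hk => by
    rw [hG, hu]; exact ⟨by positivity, H1 e lam _ N hl h (hv m) i j k hk⟩
  have c2 : ∀ m k, k ≠ 0 → Close (C2 * N) (opInvD e (pd k (opD e (u m)))) (pd k (u m)) :=
    fun m k hk => by
    have := H2 _ e lam _ N hl h (hv m) _ (hF m) k hk
    rw [← hu] at this
    exact ⟨by positivity, this⟩
  have c3 : ∀ m i j k l, k ≠ 0 → l ≠ 0 →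
      Close (C3 * N) (opInvD e (pd l (coeff e i j * pd 0 (pd k (opInvD e (u m))))))
        (third e i j k l (v m)) := fun m i j k l hk hl' => by
    rw [hG]; exact ⟨by positivity, (H3 e lam _ N hl h (hv m) i j k l hk hl').1⟩
  have c4 : ∀ m i j k l, k ≠ 0 → l ≠ 0 →
      Close (C3 * N) (opInvD e (pd l (pd 0 (coeff e i j * pd k (opInvD e (u m))))))
        (third e i j k l (v m)) := fun m i j k l hk hl' => by
    rw [hG]; exact ⟨by positivity, (H3 e lam _ N hl h (hv m) i j k l hk hl').2⟩
  have mono : ∀ {M : ℝ} {F H : E → ℂ}, Close M F H → M ≤ (4 * C1 + C2 + 8 * C3) * N →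
      Close ((4 * C1 + C2 + 8 * C3) * N) F H := fun hF hM => ⟨hF.1.trans hM, hF.2.mono hM⟩
  have p1 : 0 ≤ C1 * N := by positivity
  have p2 : 0 ≤ C2 * N := by positivity
  have p3 : 0 ≤ C3 * N := by positivity
  have one : (1 : Fin 3) ≠ 0 := by decide
  have two : (2 : Fin 3) ≠ 0 := by decide
  have hcu : ∀ i j m, SmoothL2 (coeff e i j * u m) := fun i j m =>
    SmoothL2.mul (h.smooth i j) (hsu m)
  intro i
  fin_cases i
  · change SmoothL2 (act (opP e) u 0) ∧ Close _ (actMDN e u 0) (act (opP e) u 0)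
    rw [opP_apply_zero, actMDN_zero hμ h (hGs 0) (hGs 1) (hsu 2)]
    refine ⟨((hsu 0).pd 0).sub ((hsu 2).pd 2), ?_⟩
    have a := ((((c3 0 0 1 1 2 one two).sub (c3 0 1 1 1 1 one one)).add
      (c4 0 0 1 1 2 one two)).sub (c4 0 0 0 2 2 two two))
    have b := ((((c3 1 0 1 2 2 two two).sub (c3 1 1 1 2 1 two one)).add
      (c4 1 1 1 1 2 one two)).sub (c4 1 0 1 2 2 two two))
    rw [third_sum hμ h (hv 0).rapid, ← hu] at a
    -- The contribution of the other component vanishes because multipliers commute, in agreement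
    -- with the zero entry of P.
    have e1 : third e 0 1 2 2 (v 1) - third e 1 1 2 1 (v 1) + third e 1 1 1 2 (v 1)
        - third e 0 1 2 2 (v 1) = 0 := by
      rw [third_comm e 1 1 2 1]; abel
    rw [e1] at b
    have c := (a.add b).sub (c2 2 2 two)
    rw [add_zero] at c
    exact mono c (by linarith)
  · change SmoothL2 (act (opP e) u 1) ∧ Close _ (actMDN e u 1) (act (opP e) u 1)
    rw [opP_apply_one, actMDN_one hμ h (hGs 0) (hGs 1) (hsu 2)]
    refine ⟨((hsu 1).pd 0).add ((hsu 2).pd 1), ?_⟩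
    have a := ((((c3 1 0 1 2 1 two one).sub (c3 1 0 0 2 2 two two)).add
      (c4 1 0 1 2 1 two one)).sub (c4 1 1 1 1 1 one one))
    have b := ((((c3 0 0 1 1 1 one one).sub (c3 0 0 0 1 2 one two)).add
      (c4 0 0 0 2 1 two one)).sub (c4 0 0 1 1 1 one one))
    have e0 : third e 0 1 2 1 (v 1) - third e 0 0 2 2 (v 1) + third e 0 1 2 1 (v 1)
        - third e 1 1 1 1 (v 1) = pd 0 (u 1) := by
      rw [hu, ← third_sum hμ h (hv 1).rapid, third_comm e 0 1 2 1]; abel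
    rw [e0] at a
    have e1 : third e 0 1 1 1 (v 0) - third e 0 0 1 2 (v 0) + third e 0 0 2 1 (v 0)
        - third e 0 1 1 1 (v 0) = 0 := by
      rw [third_comm e 0 0 2 1]; abel
    rw [e1] at b
    have c := (a.add b).add (c2 2 1 one)
    rw [add_zero] at c
    exact mono c (by linarith)
  · change SmoothL2 (act (opP e) u 2) ∧ Close _ (actMDN e u 2) (act (opP e) u 2)
    rw [opP_apply_two h.symm, actMDN_two hμ h (hGs 0) (hGs 1) (hsu 2)]
    refine ⟨(((((hcu 0 1 0).pd 1).sub ((hcu 0 0 0).pd 2)).add ((hcu 1 1 1).pd 1)).sub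
      ((hcu 0 1 1).pd 2)).add ((hsu 2).pd 0), ?_⟩
    exact mono (((((c1 0 0 1 1 one).sub (c1 0 0 0 2 two)).add (c1 1 1 1 1 one)).sub
      (c1 1 0 1 2 two)).add (Close.refl _)) (by linarith)

/-! ### Frequency localisation -/

theorem rapidL2_of_bounded_support {M : ℝ} {v : E → ℂ} (hv : MemLp v 2)
    (h : ∀ᵐ ξ, v ξ ≠ 0 → ∀ k : Fin 3, |ξ k| ≤ M) : RapidL2 v := by
  intro n
  induction n generalizing v with
  | zero => exact hv
  | succ n ih =>
    refine ⟨hv, fun k => ih ?_ ?_⟩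
    · refine hv.of_le_mul (c := M) (AEStronglyMeasurable.mul (by fun_prop) hv.1) ?_
      filter_upwards [h] with ξ hξ
      by_cases h0 : v ξ = 0
      · simp [h0]
      · rw [norm_mul, Complex.norm_real]
        exact mul_le_mul_of_nonneg_right (hξ h0 k) (norm_nonneg _)
    · filter_upwards [h] with ξ hξ h0
      exact hξ (right_ne_zero_of_mul h0)

/-- With exponent zero the coefficients drop out, so `e` is arbitrary and the projection belongs to
the same family of integrals as the other operators. -/
theorem freqProj_eq (a : E → ℝ) (lam : ℝ) (f : E → ℂ) (e : E → Matrix (Fin 2) (Fin 2) ℝ) :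
    freqProj a lam f = oscRoot e 0 fun ξ => (a (lam⁻¹ • (2 * Real.pi) • ξ) : ℂ) * l2Fourier f ξ := by
  funext x
  rw [freqProj, op, oscRoot, osc]
  congr 1; funext ξ
  rw [pow_zero]; ring

theorem IsConeCutoff.exists_packet {a : E → ℝ} (ha : IsConeCutoff a) :
    ∃ r R C, 0 < r ∧ r < R ∧ 0 ≤ C ∧ ∀ lam, 0 < lam → ∀ f : E → ℂ, ∀ N, 0 ≤ N → L2Bound f N →
      Packet r R lam (fun ξ => (a (lam⁻¹ • (2 * Real.pi) • ξ) : ℂ) * l2Fourier f ξ) (C * N) := by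
  obtain ⟨h1, c, hc, h2⟩ := ha
  have hsupp : HasCompactSupport a := by
    refine HasCompactSupport.intro (isCompact_closedBall (0 : E) (c ^ 2 + c)) fun ξ hξ => ?_
    by_contra h0
    obtain ⟨-, k2, k3⟩ := h2 ξ h0
    refine hξ (mem_closedBall_zero_iff.2 ?_)
    have s0 := spatialNorm_nonneg ξ
    have k4 : |ξ 0| ≤ c ^ 2 := k3.trans (by rw [sq]; gcongr)
    refine abs_le_of_sq_le_sq' ?_ (by positivity) |>.2
    rw [norm_sq_eq, ← spatialNorm_sq, ← sq_abs (ξ 0)]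
    have q1 : |ξ 0| ^ 2 ≤ (c ^ 2) ^ 2 := by gcongr
    have q2 : spatialNorm ξ ^ 2 ≤ c ^ 2 := by gcongr
    nlinarith [mul_pos (pow_pos hc 2) hc]
  obtain ⟨C, hC⟩ := hsupp.exists_bound_of_continuous h1.continuous
  -- The factor 2π comes from the normalization of the Fourier transform: the cutoff is evaluated at
  -- 2πξ/lam.
  set r := (c⁻¹) ^ 2 / (2 * Real.pi) ^ 2
  have hπ : 1 ≤ (2 * Real.pi) ^ 2 := by nlinarith [Real.pi_gt_three]
  have hr : 0 < r := by positivity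
  -- In the upper radius c² controls |ξ'|², c⁴ controls ξ₀² through |ξ₀| ≤ c|ξ'| ≤ c², and r is
  -- added to ensure r < R.
  refine ⟨r, c ^ 2 + c ^ 4 + r, |C|, hr, by have : 0 < c ^ 2 + c ^ 4 := by positivity
                                            linarith, abs_nonneg C, fun lam hlam f N hN hf => ?_⟩
  have hmem : ∀ ξ : E, a (lam⁻¹ • (2 * Real.pi) • ξ) ≠ 0 →
      lam⁻¹ • ξ ∈ annulus r (c ^ 2 + c ^ 4 + r) := fun ξ hξ => by
    rw [smul_comm] at hξ
    set ζ := lam⁻¹ • ξ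
    obtain ⟨k1, k2, k3⟩ := h2 _ hξ
    rw [spatialNorm_two_pi] at k1 k2 k3
    have s0 := spatialNorm_nonneg ζ
    have q1 : (c⁻¹) ^ 2 ≤ (2 * Real.pi) ^ 2 * rho ζ := by
      rw [← spatialNorm_sq, ← mul_pow]; gcongr
    have q2 : (2 * Real.pi) ^ 2 * rho ζ ≤ c ^ 2 := by
      rw [← spatialNorm_sq, ← mul_pow]; gcongr
    have q3 : (2 * Real.pi) ^ 2 * ζ 0 ^ 2 ≤ c ^ 4 := by
      have : |2 * Real.pi * ζ 0| ≤ c ^ 2 := by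
        have : |2 * Real.pi * ζ 0| ≤ c * (2 * Real.pi * spatialNorm ζ) := k3
        refine this.trans ?_
        rw [sq]; gcongr
      calc _ = |2 * Real.pi * ζ 0| ^ 2 := by rw [sq_abs]; ring
        _ ≤ (c ^ 2) ^ 2 := by gcongr
        _ = _ := by ring
    have n1 := rho_nonneg ζ
    have n2 := sq_nonneg (ζ 0)
    have m1 := mul_le_mul_of_nonneg_right hπ n1
    have m2 := mul_le_mul_of_nonneg_right hπ n2
    have c2 : 0 ≤ c ^ 2 := by positivity
    have c4 : 0 ≤ c ^ 4 := by positivity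
    refine ⟨?_, by linarith, by linarith⟩
    simp only [r]
    rw [div_le_iff₀ (by positivity)]; linarith
  have hmeas : Measurable fun ξ : E => (a (lam⁻¹ • (2 * Real.pi) • ξ) : ℂ) := by
    have := h1.continuous
    exact (by fun_prop : Continuous fun ξ : E => (a (lam⁻¹ • (2 * Real.pi) • ξ) : ℂ)).measurable
  have hb : L2Bound (fun ξ => (a (lam⁻¹ • (2 * Real.pi) • ξ) : ℂ) * l2Fourier f ξ) (|C| * N) :=
    hf.l2Fourier.mul hmeas (abs_nonneg C) fun ξ => by
      rw [Complex.norm_real]; exact (hC _).trans (le_abs_self C)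
  have hloc : Localized (annulus r (c ^ 2 + c ^ 4 + r)) lam
      (fun ξ => (a (lam⁻¹ • (2 * Real.pi) • ξ) : ℂ) * l2Fourier f ξ) :=
    Filter.Eventually.of_forall fun ξ h0 => hmem ξ (by simpa using left_ne_zero_of_mul h0)
  refine ⟨rapidL2_of_bounded_support hb.1 (M := Real.sqrt (c ^ 2 + c ^ 4 + r) * lam) ?_, hloc, hb,
    by positivity⟩
  filter_upwards [hloc] with ξ hξ h0 k
  exact Packet.coord_le hlam (hξ h0) k

end

end MaxwellDiag

end

/-! ### Conclusion -/

open MaxwellDiag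

theorem mainTheorem11
    (χ : MaxwellDiag.E → ℝ) (hχ : MaxwellDiag.IsLowFrequencyCutoff χ)
    (a : MaxwellDiag.E → ℝ) (ha : MaxwellDiag.IsConeCutoff a)
    (Λ₁ Λ₂ K : ℝ) (hΛ₁ : 0 < Λ₁) (hΛ₂ : 0 < Λ₂) :
    ∃ C lam₀ : ℝ, ∀ ε : MaxwellDiag.E → Matrix (Fin 2) (Fin 2) ℝ,
      MaxwellDiag.IsElliptic Λ₁ Λ₂ ε → MaxwellDiag.HasC1Bound K ε →
      ∀ n : ℕ, lam₀ ≤ (2 : ℝ) ^ n →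
      ∀ f : Fin 3 → MaxwellDiag.E → ℂ, MaxwellDiag.IsL2 f →
        MaxwellDiag.IsL2 (MaxwellDiag.actMDN (MaxwellDiag.truncInv χ ε (2 ^ n))
          (fun i => MaxwellDiag.freqProj a (2 ^ n) (f i))) ∧
        MaxwellDiag.IsL2 (MaxwellDiag.act (MaxwellDiag.opP (MaxwellDiag.truncInv χ ε (2 ^ n)))
          (fun i => MaxwellDiag.freqProj a (2 ^ n) (f i))) ∧
        MaxwellDiag.l2norm
            (MaxwellDiag.actMDN (MaxwellDiag.truncInv χ ε (2 ^ n))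
                (fun i => MaxwellDiag.freqProj a (2 ^ n) (f i)) -
              MaxwellDiag.act (MaxwellDiag.opP (MaxwellDiag.truncInv χ ε (2 ^ n)))
                (fun i => MaxwellDiag.freqProj a (2 ^ n) (f i))) ≤
          ENNReal.ofReal C * MaxwellDiag.l2norm f := by
  obtain ⟨r, R, Ca, hr, hR, hCa, hpacket⟩ := ha.exists_packet
  obtain ⟨μ, A, L, B₀, lam₀, hμ, hadm⟩ := exists_smoothAdmissible hχ hΛ₁ hΛ₂ K
  obtain ⟨C, hC, hclose⟩ := exists_close (A := A) (L := L) hr hR hμ B₀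
  -- Each of the three components of the error is bounded by C · Ca times the full norm of f.
  refine ⟨3 * (C * Ca), lam₀, fun ε hε hK n hn f hf => ?_⟩
  have h1 : (1 : ℝ) ≤ 2 ^ n := one_le_pow₀ one_le_two
  obtain ⟨N, hN0, hsum⟩ : ∃ N, 0 ≤ N ∧ l2norm f = ENNReal.ofReal N :=
    ⟨(l2norm f).toReal, ENNReal.toReal_nonneg,
      (ENNReal.ofReal_toReal (ENNReal.sum_ne_top.2 fun i _ => (hf i).2.ne)).symm⟩
  have hfN : ∀ i, L2Bound (f i) N := fun i => by
    refine ⟨hf i, ?_⟩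
    rw [← hsum]
    exact Finset.single_le_sum (f := fun j => MeasureTheory.eLpNorm (f j) 2 MeasureTheory.volume)
      (fun _ _ => zero_le) (Finset.mem_univ i)
  have key := hclose (truncInv χ ε (2 ^ n)) (2 ^ n) (Ca * N) _
    (fun i => freqProj a (2 ^ n) (f i)) h1 (hadm ε hε hK _ h1 hn)
    (fun i => hpacket _ (zero_lt_one.trans_le h1) (f i) N hN0 (hfN i))
    (fun i => freqProj_eq a _ (f i) _)
  refine ⟨fun i => ?_, fun i => (key i).1.memLp, ?_⟩
  -- Square integrability of 𝓜 𝓓 𝓝 S'f is deduced from that of the error and of P S'f.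
  · have hdiff := (key i).2.2.1.add (key i).1.memLp
    rwa [sub_add_cancel] at hdiff
  · calc _ ≤ ∑ _i : Fin 3, ENNReal.ofReal (C * (Ca * N)) :=
          Finset.sum_le_sum fun i _ => (key i).2.2.2
      _ = ENNReal.ofReal (3 * (C * Ca)) * l2norm f := by
          rw [hsum, ← ENNReal.ofReal_mul (by positivity), Finset.sum_const, Finset.card_univ,
            Fintype.card_fin, nsmul_eq_mul, ← ENNReal.ofReal_natCast,
            ← ENNReal.ofReal_mul (by positivity)]
          congr 1; push_cast; ring
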